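/- **Setting.** Let $\Bbbk$ be a field. A *ribbon graph* $\Gamma$ is a finite set $H$ of half-edges with a fixed-point free involution $\iota$, a surjective map $s:H\to V$ to the set of vertices, and a permutation $\rho$ of $H$ whose cycles are exactly the fibres of $s$. The edges of $\Gamma$ are the orbits of $\iota$; $\mathrm{val}(h)$ is the number of half-edges at the vertex $s(h)$. Let $\mathbb m:V\to\mathbb Z_{\ge1}$; the pair $(\Gamma,\mathbb m)$ is a *Brauer graph*. *Algebras.* Let $Q_\Gamma$ be the quiver whose vertices are the edges of $\Gamma$, with an arrow $\alpha_h$ from the edge of $h$ to the edge of $\rho h$ for every $h\in H$. Products of paths are read from right to left. Put $\pi(\alpha_h)=\alpha_{\rho^{-1}h}$ and $C_\alpha=\alpha\,\pi(\alpha)\cdots\pi^{l}(\alpha)$, where $l+1$ is the size of the $\pi$-orbit of $\alpha$. For a function $\omega$ from the edges to $\mathbb Z$, the modified Brauer graph algebra of $(\Gamma,\mathbb m,\omega)$ is the quotient of $\Bbbk Q_\Gamma$ by the relations $\alpha_h\alpha_g=0$ for composable arrows with $g\neq\rho^{-1}h$, and $$C_{\pi(\alpha_h)}^{\mathbb m(s(h))}=(-1)^{\omega(\gamma)}\,C_{\pi(\alpha_{\iota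 h})}^{\mathbb m(s(\iota h))}\qquad\text{for every half-edge }h\text{ of an edge }\gamma .$$ The Brauer graph algebra $B$ of $(\Gamma,\mathbb m)$ is the case $\omega=0$. For an edge $\gamma$ with idempotent $e_\gamma$, put $P_\gamma=e_\gamma B$, a right $B$-module. For a non-trivial path $a$ of length at most $\mathbb m(s(h))\,\mathrm{val}(h)$ around the vertex $s(h)$ (starting at $h$), $a^*$ is the path (possibly trivial) around the same vertex such that $aa^*$ has length $\mathbb m(s(h))\,\mathrm{val}(h)$. *The graded surface.* Let $\Sigma$ be a compact oriented smooth surface with boundary, in which $\Gamma$ is embedded as follows (so $\Sigma=\Sigma_\Gamma$ is the ribbon surface). The vertices are distinct interior points, called punctures, and the edges are smoothly immersed arcs in the interior of $\Sigma$ between punctures, injective away from their end points, with no other punctures on them, meeting each other and themselves only in end points and there with different directions; $\rho h$ is the half-edge following $h$ in counter-clockwise order around $s(h)$. The embedding is filling: the complement of the graph is a disjoint union of half-open annuli, each of them a collar of one component of $\partial\Sigma$. Let $\eta_\Gamma$ be a smooth line field on the complement of the punctures such that every puncture has an oriented coordinate disc in which the leaves are the circles around the puncture, and such that every edge is transverse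 to $\eta_\Gamma$ in its interior. Every edge is graded by the shortest clockwise path from $\eta_\Gamma$ to its tangent direction, i.e. the angle of rotation from $\eta_\Gamma$ to the tangent line lies in $(-\pi,0)$ along the edge. *Degrees, winding numbers, discs.* A grading of an arc $\gamma$ is a continuous angle $\theta$ on $(0,1)$ such that the rotation by $\theta(t)$ (counter-clockwise for positive angles) takes $\eta_\Gamma$ to the tangent line of $\gamma$ at $\gamma(t)$. At a transverse intersection $q$ of two graded paths, $\gamma_1$ with angle $\theta_1$ and $\gamma_2$ with angle $\theta_2$, the degree of $q$ from $\gamma_1$ to $\gamma_2$ is $(\theta_1+c-\theta_2)/\pi\in\mathbb Z$, with $c\in(0,\pi)$ the counter-clockwise angle from the tangent line of $\gamma_1$ to that of $\gamma_2$. For half-edges $h\ne g$ at the same puncture, let $u$ be the segment of a small circular leaf which cuts off the sector to the left of the arc of $h$ and to the right of the arc of $g$, with the constant grading $0$. The degree of the oriented intersection from $h$ to $g$ is the difference of the degrees of the intersections of the arc of $h$ with $u$ and of the arc of $g$ with $u$. The degree of the arrow $\alpha_h$ is the degree of the intersection from $h$ to $\rho h$, and $0$ if $\rho h=h$. The winding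 number of an arc is the number of crossings, counted with signs, of its tangent direction with $\eta_\Gamma$. A disc sequence $a_1,\dots,a_n$ comes from a continuous map from the closed disc with $n\ge1$ marked boundary points to $\Sigma$ which is an orientation preserving smooth immersion away from the marked points, and sends marked points to punctures and the boundary segments, in clockwise order, to arcs $\delta_1,\dots,\delta_n$; $a_i$ is the path of length less than $\mathrm{val}$ around a puncture which corresponds to the corner from $\delta_i$ to $\delta_{i+1}$ (indices modulo $n$). *The Brauer graph category* $\mathbb B=\mathbb B(\Gamma,\mathbb m)$. The objects are $X_\gamma$, for the edges $\gamma$. $\mathrm{Hom}(X_\gamma,X_\delta)$ is the span of the classes of paths from $\gamma$ to $\delta$ in the modified Brauer graph algebra of $(\Gamma,\mathbb m,\omega)$, with $\omega(\gamma)$ the winding number of $\gamma$. The degree $|\cdot|$ of a path is the sum of the degrees of its arrows. The trivial paths are the units. Further $\mu^1=0$, $\mu^2(b,a)=(-1)^{|a|}ba$, and the only non-zero operations $\mu^n$ with $n\ge3$ on sequences of paths are, for disc sequences $a_1,\dots,a_n$ and (possibly trivial) paths $b$, $$\mu^n(ba_n,a_{n-1},\dots,a_1)=b\ (ba_n\ne0),\qquad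 \mu^n(a_n,\dots,a_2,a_1b)=(-1)^{|b|}b\ (a_1b\ne0),$$ $$\mu^n(a_n,\dots,a_{r+1},a_r(ba_r)^*,ba_r,a_{r-1},\dots,a_2)=(-1)^{\circ}a_1^*\quad(1<r\le n,\ ba_r\ne0),$$ with $\circ=|a_1|+\dots+|a_{r-1}|+|ba_r|+\omega(\delta_2)+\dots+\omega(\delta_r)$. *Twisted complexes.* $A_\infty$-categories are $\mathbb Z$-graded over $\Bbbk$, $\mu^n$ has degree $2-n$, and the $A_\infty$-relations are $$\sum(-1)^{|a_1|+\dots+|a_i|-i}\,\mu(a_n,\dots,a_{i+j+1},\mu(a_{i+j},\dots,a_{i+1}),a_i,\dots,a_1)=0.$$ $\mathrm{Tw}\,\mathbb A$ is the $A_\infty$-category of finite formal sums $\bigoplus_i E_i[k_i]$ with a strictly triangular $\delta$ of degree $1$ satisfying $\sum_n\mu^n(\delta,\dots,\delta)=0$; its operations insert $\delta$ in all possible ways, with the Koszul signs for the shifts. $H^0$ denotes the category with the same objects and the degree $0$ cohomology of $\mu^1$ as morphisms. It carries the shift $E\mapsto E[1]$ and the triangles $E\to F\to\mathrm{cone}(f)\to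 E[1]$. **Proposition.** In this setting: 1. $B$ is finite-dimensional, $B=\bigoplus_\gamma P_\gamma$, and the $P_\gamma$ are pairwise non-isomorphic indecomposable projective right $B$-modules. 2. The Brauer graph category $\mathbb B=\mathbb B(\Gamma,\mathbb m)$ is well-defined, i.e. the description above determines degrees, winding numbers and operations uniquely and without contradiction, and it is a strictly unital $A_\infty$-category. 3. $\mathbb B$ is (strictly) isomorphic, as an $A_\infty$-category, to the category with objects $P_\gamma$ and morphism spaces $\mathrm{Hom}_B(P_\gamma,P_\delta)$ in degree $0$, with composition as $\mu^2$ and $\mu^n=0$ for $n\neq2$. 4. $\mathrm{Tw}\,\mathbb B$ is an $A_\infty$-category, and there is a $\Bbbk$-linear equivalence $H^0(\mathrm{Tw}\,\mathbb B)\simeq K^b(\mathrm{proj}\,B)$ to the homotopy category of bounded complexes of finitely generated projective right $B$-modules, which commutes with the shifts and sends cone triangles to distinguished triangles. -/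

import Mathlib

open CategoryTheory
open scoped Manifold ContDiff

universe u v w w₁ w₂

noncomputable section

/-! ## Graded quivers and `A_∞`-categories -/

set_option linter.checkUnivs false in
/-- A set of objects with a `k`-vector space of morphisms between any two of them, together with
the subspaces `gr X Y d` of homogeneous morphisms of degree `d`. -/
structure GradedQuiver (k : Type u) [Field k] where
  Ob : Type w₁
  Hom : Ob → Ob → Type w₂
  [addCommGroup : ∀ X Y, AddCommGroup (Hom X Y)]
  [module : ∀ X Y, Module k (Hom X Y)]
  gr : ∀ X Y, ℤ → Submodule k (Hom X Y)

attribute [instance] GradedQuiver.addCommGroup GradedQuiver.module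

namespace GradedQuiver

variable {k : Type u} [Field k] (G : GradedQuiver.{u, w₁, w₂} k)

/-- A homogeneous morphism together with its degree. -/
@[ext]
structure HomogHom (X Y : G.Ob) where
  deg : ℤ
  val : G.Hom X Y
  mem : val ∈ G.gr X Y deg

/-- Composable sequences `a₁, …, aₙ` of homogeneous morphisms,
`aᵢ : X_{i-1} → X_i`; `cons` adds a new last morphism `a_{n+1}`. -/
inductive Seq : G.Ob → G.Ob → Type (max u w₁ w₂)
  | nil (X : G.Ob) : Seq X X
  | cons {X Y Z : G.Ob} (p : Seq X Y) (a : G.HomogHom Y Z) : Seq X Z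

namespace Seq

variable {G}

/-- The number `n` of morphisms in `a₁, …, aₙ`. -/
def length : ∀ {X Y : G.Ob}, G.Seq X Y → ℕ
  | _, _, nil _ => 0
  | _, _, cons p _ => p.length + 1

/-- The total degree `|a₁| + ⋯ + |aₙ|`. -/
def deg : ∀ {X Y : G.Ob}, G.Seq X Y → ℤ
  | _, _, nil _ => 0
  | _, _, cons p a => p.deg + a.deg

/-- The total reduced degree `(|a₁| - 1) + ⋯ + (|aₙ| - 1)`. -/
def redDeg : ∀ {X Y : G.Ob}, G.Seq X Y → ℤ
  | _, _, nil _ => 0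
  | _, _, cons p a => p.redDeg + (a.deg - 1)

/-- Concatenation: first the sequence `p`, then the sequence `q`. -/
def comp {X Y : G.Ob} (p : G.Seq X Y) : ∀ {Z : G.Ob}, G.Seq Y Z → G.Seq X Z
  | _, nil _ => p
  | _, cons q a => (p.comp q).cons a

/-- The sequence of length one. -/
abbrev single {X Y : G.Ob} (a : G.HomogHom X Y) : G.Seq X Y := (nil X).cons a

/-- The sequence `a, b`. -/
abbrev pair {X Y Z : G.Ob} (a : G.HomogHom X Y) (b : G.HomogHom Y Z) : G.Seq X Z :=
  ((nil X).cons a).cons b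

/-- The empty sequence between equal objects. -/
def nilOfEq {X Y : G.Ob} (h : X = Y) : G.Seq X Y := h ▸ nil X

/-- All ways to write a sequence as a concatenation of two sequences. -/
def splits {X : G.Ob} : ∀ {Y : G.Ob}, G.Seq X Y → List (Σ Z : G.Ob, G.Seq X Z × G.Seq Z Y)
  | _, nil _ => [⟨_, nil _, nil _⟩]
  | _, cons p a =>
      (p.splits.map fun d => ⟨d.1, d.2.1, d.2.2.cons a⟩) ++ [⟨_, p.cons a, nil _⟩]

end Seq

variable {G} in
/-- Linearity in every entry, on homogeneous morphisms. -/
structure IsMultilinear (μ : ∀ {X Y : G.Ob}, G.Seq X Y → G.Hom X Y) : Prop where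
  add : ∀ {X Y Z W : G.Ob} (p : G.Seq X Y) (d : ℤ) (a b : G.Hom Y Z) (ha : a ∈ G.gr Y Z d)
    (hb : b ∈ G.gr Y Z d) (q : G.Seq Z W),
    μ ((p.cons ⟨d, a + b, add_mem ha hb⟩).comp q) =
      μ ((p.cons ⟨d, a, ha⟩).comp q) + μ ((p.cons ⟨d, b, hb⟩).comp q)
  smul : ∀ {X Y Z W : G.Ob} (p : G.Seq X Y) (d : ℤ) (c : k) (a : G.Hom Y Z)
    (ha : a ∈ G.gr Y Z d) (q : G.Seq Z W),
    μ ((p.cons ⟨d, c • a, Submodule.smul_mem _ c ha⟩).comp q) =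
      c • μ ((p.cons ⟨d, a, ha⟩).comp q)

end GradedQuiver

set_option linter.checkUnivs false in
/-- The data of a strictly unital `A_∞`-category: a graded quiver, a distinguished endomorphism
`1_X` of each object, and the operations. For `p = (a₁, …, aₙ)`,
`μ p` is `μⁿ(aₙ, …, a₁)`. -/
structure AInfData (k : Type u) [Field k] extends GradedQuiver.{u, w₁, w₂} k where
  one : ∀ X, Hom X X
  μ : ∀ {X Y : Ob}, toGradedQuiver.Seq X Y → Hom X Y

namespace AInfData

variable {k : Type u} [Field k] (A : AInfData.{u, w₁, w₂} k)

/-- The data `A` is a (strictly unital) `A_∞`-category. -/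
structure IsAInf : Prop where
  /-- morphism spaces are `ℤ`-graded vector spaces -/
  internal : ∀ X Y, DirectSum.IsInternal (A.gr X Y)
  /-- `μⁿ` has degree `2 - n` -/
  mem : ∀ {X Y : A.Ob} (p : A.Seq X Y), A.μ p ∈ A.gr X Y (p.deg + 2 - p.length)
  multilinear : GradedQuiver.IsMultilinear A.μ
  /-- there is no operation `μ⁰` -/
  nil : ∀ X, A.μ (.nil X) = 0
  /-- the `A_∞`-relations: the sum over all ways to write `a₁, …, aₙ` as a
  concatenation of `s`, `q`, `r` with `q` non-empty -/
  rel : ∀ {X Y : A.Ob} (p : A.Seq X Y),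
    (p.splits.map fun d => (d.2.2.splits.map fun e =>
      if e.2.1.length = 0 then 0 else
        d.2.1.redDeg.negOnePow • A.μ ((d.2.1.cons ⟨_, A.μ e.2.1, mem e.2.1⟩).comp e.2.2)).sum).sum
      = 0
  one_mem : ∀ X, A.one X ∈ A.gr X X 0
  one_d : ∀ X, A.μ (.single ⟨0, A.one X, one_mem X⟩) = 0
  one_right : ∀ {X Y : A.Ob} (a : A.HomogHom X Y),
    A.μ (.pair ⟨0, A.one X, one_mem X⟩ a) = a.val
  one_left : ∀ {X Y : A.Ob} (a : A.HomogHom X Y),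
    a.deg.negOnePow • A.μ (.pair a ⟨0, A.one Y, one_mem Y⟩) = a.val
  one_higher : ∀ {X Y Z : A.Ob} (p : A.Seq X Y) (q : A.Seq Y Z),
    2 ≤ p.length + q.length → A.μ ((p.cons ⟨0, A.one Y, one_mem Y⟩).comp q) = 0

/-! ### The homotopy category -/

namespace IsAInf

variable {A} (h : A.IsAInf)

lemma d_add (h : A.IsAInf) {X Y : A.Ob} (d : ℤ) (a b : A.Hom X Y) (ha : a ∈ A.gr X Y d) (hb : b ∈ A.gr X Y d) :
    A.μ (.single ⟨d, a + b, add_mem ha hb⟩) =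
      A.μ (.single ⟨d, a, ha⟩) + A.μ (.single ⟨d, b, hb⟩) :=
  h.multilinear.add (.nil X) d a b ha hb (.nil Y)

lemma d_smul (h : A.IsAInf) {X Y : A.Ob} (d : ℤ) (c : k) (a : A.Hom X Y) (ha : a ∈ A.gr X Y d) :
    A.μ (.single ⟨d, c • a, Submodule.smul_mem _ c ha⟩) = c • A.μ (.single ⟨d, a, ha⟩) :=
  h.multilinear.smul (.nil X) d c a ha (.nil Y)

lemma zero_entry (h : A.IsAInf) {X Y Z W : A.Ob} (p : A.Seq X Y) (a : A.HomogHom Y Z) (q : A.Seq Z W)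
    (ha : a.val = 0) : A.μ ((p.cons a).comp q) = 0 := by
  obtain ⟨d, a, hd⟩ := a
  subst ha
  have := h.multilinear.smul p d 0 (0 : A.Hom Y Z) hd q
  simpa using this

lemma rel_one {X Y : A.Ob} (a : A.HomogHom X Y) :
    A.μ (.single ⟨_, A.μ (.single a), h.mem _⟩) = 0 := by
  have := h.rel (.single a)
  simpa [GradedQuiver.Seq.splits, GradedQuiver.Seq.length, GradedQuiver.Seq.comp,
    GradedQuiver.Seq.redDeg] using this

lemma rel_two {X Y Z : A.Ob} (a : A.HomogHom X Y) (b : A.HomogHom Y Z) :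
    A.μ (.pair ⟨_, A.μ (.single a), h.mem _⟩ b) + A.μ (.single ⟨_, A.μ (.pair a b), h.mem _⟩) +
      (a.deg - 1).negOnePow • A.μ (.pair a ⟨_, A.μ (.single b), h.mem _⟩) = 0 := by
  have := h.rel (.pair a b)
  simpa [GradedQuiver.Seq.splits, GradedQuiver.Seq.length, GradedQuiver.Seq.comp,
    GradedQuiver.Seq.redDeg] using this

lemma rel_three {X Y Z W : A.Ob} (a : A.HomogHom X Y) (b : A.HomogHom Y Z)
    (c : A.HomogHom Z W) :
    A.μ (((GradedQuiver.Seq.nil X).cons ⟨_, A.μ (.single a), h.mem _⟩ |>.cons b).cons c) +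
      A.μ (.pair ⟨_, A.μ (.pair a b), h.mem _⟩ c) +
      A.μ (.single ⟨_, A.μ ((GradedQuiver.Seq.pair a b).cons c), h.mem _⟩) +
      (a.deg - 1).negOnePow •
        A.μ (((GradedQuiver.Seq.nil X).cons a |>.cons ⟨_, A.μ (.single b), h.mem _⟩).cons c) +
      (a.deg - 1).negOnePow • A.μ (.pair a ⟨_, A.μ (.pair b c), h.mem _⟩) +
      (a.deg - 1 + (b.deg - 1)).negOnePow •
        A.μ (((GradedQuiver.Seq.nil X).cons a |>.cons b).cons ⟨_, A.μ (.single c), h.mem _⟩)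
      = 0 := by
  have := h.rel ((GradedQuiver.Seq.pair a b).cons c)
  simpa [GradedQuiver.Seq.splits, GradedQuiver.Seq.length, GradedQuiver.Seq.comp,
    GradedQuiver.Seq.redDeg, add_assoc] using this

/-- The closed morphisms of degree `0`. -/
def cycles (X Y : A.Ob) : Submodule k (A.Hom X Y) where
  carrier := {a | ∃ ha : a ∈ A.gr X Y 0, A.μ (.single ⟨0, a, ha⟩) = 0}
  zero_mem' := ⟨zero_mem _, h.zero_entry (.nil X) _ (.nil Y) rfl⟩
  add_mem' := by
    rintro a b ⟨ha, ha'⟩ ⟨hb, hb'⟩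
    exact ⟨add_mem ha hb, by rw [h.d_add 0 a b ha hb, ha', hb', add_zero]⟩
  smul_mem' := by
    rintro c a ⟨ha, ha'⟩
    exact ⟨Submodule.smul_mem _ c ha, by rw [h.d_smul 0 c a ha, ha', smul_zero]⟩

/-- The morphisms `μ¹(c)` with `c` of degree `-1`. -/
def boundaries (X Y : A.Ob) : Submodule k (A.Hom X Y) where
  carrier := {a | ∃ (c : A.Hom X Y) (hc : c ∈ A.gr X Y (-1)), A.μ (.single ⟨-1, c, hc⟩) = a}
  zero_mem' := ⟨0, zero_mem _, h.zero_entry (.nil X) _ (.nil Y) rfl⟩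
  add_mem' := by
    rintro _ _ ⟨a, ha, rfl⟩ ⟨b, hb, rfl⟩
    exact ⟨a + b, add_mem ha hb, h.d_add _ a b ha hb⟩
  smul_mem' := by
    rintro c _ ⟨a, ha, rfl⟩
    exact ⟨c • a, Submodule.smul_mem _ c ha, h.d_smul _ c a ha⟩

/-- A closed morphism of degree `0` as a homogeneous morphism. -/
def cycHom {X Y : A.Ob} (a : h.cycles X Y) : A.HomogHom X Y := ⟨0, a.1, a.2.1⟩

lemma mem_boundaries {X Y : A.Ob} (c : A.HomogHom X Y) (hc : c.deg = -1) :
    A.μ (.single c) ∈ h.boundaries X Y := by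
  obtain ⟨d, c, hd⟩ := c
  obtain rfl : d = -1 := hc
  exact ⟨c, hd, rfl⟩

lemma mem_cycles {X Y : A.Ob} (c : A.HomogHom X Y) (hc : c.deg = 0)
    (hc' : A.μ (.single c) = 0) : c.val ∈ h.cycles X Y := by
  obtain ⟨d, c, hd⟩ := c
  obtain rfl : d = 0 := hc
  exact ⟨hd, hc'⟩

lemma comp_mem {X Y Z : A.Ob} (a : h.cycles X Y) (b : h.cycles Y Z) :
    A.μ (.pair (h.cycHom a) (h.cycHom b)) ∈ h.cycles X Z := by
  refine h.mem_cycles ⟨_, _, h.mem _⟩ (by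
    simp [cycHom, GradedQuiver.Seq.deg, GradedQuiver.Seq.length]) ?_
  have := h.rel_two (h.cycHom a) (h.cycHom b)
  have h1 := h.zero_entry (.nil X) ⟨_, A.μ (.single (h.cycHom a)), h.mem _⟩
    (.single (h.cycHom b)) a.2.2
  have h2 := h.zero_entry (.single (h.cycHom a)) ⟨_, A.μ (.single (h.cycHom b)), h.mem _⟩
    (.nil Z) b.2.2
  simp only [GradedQuiver.Seq.comp] at h1 h2
  rw [h1, h2, smul_zero, zero_add, add_zero] at this
  exact this

/-- The space of morphisms of the homotopy category. -/
abbrev H0Hom (X Y : A.Ob) : Type w₂ :=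
  h.cycles X Y ⧸ (h.boundaries X Y).submoduleOf (h.cycles X Y)

/-- `[b] ∘ [a] = [μ²(b, a)]`, before passing to classes. -/
def compCycles (X Y Z : A.Ob) : h.cycles X Y →ₗ[k] h.cycles Y Z →ₗ[k] h.H0Hom X Z :=
  LinearMap.mk₂ k
    (fun a b => Submodule.Quotient.mk ⟨A.μ (.pair (h.cycHom a) (h.cycHom b)), h.comp_mem a b⟩)
    (fun a a' b => by
      rw [← Submodule.Quotient.mk_add]
      exact congrArg _ (Subtype.ext
        (h.multilinear.add (.nil X) 0 a.1 a'.1 a.2.1 a'.2.1 (.single (h.cycHom b)))))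
    (fun c a b => by
      rw [← Submodule.Quotient.mk_smul]
      exact congrArg _ (Subtype.ext
        (h.multilinear.smul (.nil X) 0 c a.1 a.2.1 (.single (h.cycHom b)))))
    (fun a b b' => by
      rw [← Submodule.Quotient.mk_add]
      exact congrArg _ (Subtype.ext
        (h.multilinear.add (.single (h.cycHom a)) 0 b.1 b'.1 b.2.1 b'.2.1 (.nil Z))))
    (fun c a b => by
      rw [← Submodule.Quotient.mk_smul]
      exact congrArg _ (Subtype.ext
        (h.multilinear.smul (.single (h.cycHom a)) 0 c b.1 b.2.1 (.nil Z))))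

lemma comp_boundary_right {X Y Z : A.Ob} (a : h.cycles X Y) (b : h.cycles Y Z)
    (hb : b.1 ∈ h.boundaries Y Z) : h.compCycles X Y Z a b = 0 := by
  obtain ⟨c, hc, hcb⟩ := hb
  refine (Submodule.Quotient.mk_eq_zero _).2 ?_
  change A.μ (.pair (h.cycHom a) (h.cycHom b)) ∈ h.boundaries X Z
  have h1 := h.rel_two (h.cycHom a) ⟨-1, c, hc⟩
  have h2 := h.zero_entry (.nil X) ⟨_, A.μ (.single (h.cycHom a)), h.mem _⟩
    (.single ⟨-1, c, hc⟩) a.2.2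
  simp only [GradedQuiver.Seq.comp] at h2
  rw [h2, zero_add] at h1
  have h3 : A.μ (.pair (h.cycHom a) ⟨_, A.μ (.single ⟨-1, c, hc⟩), h.mem _⟩) =
      A.μ (.pair (h.cycHom a) (h.cycHom b)) := by
    congr 1
    simp only [GradedQuiver.Seq.pair, cycHom, GradedQuiver.Seq.deg, GradedQuiver.Seq.length]
    congr 2
  rw [h3] at h1
  have h4 : ((h.cycHom a).deg - 1).negOnePow = -1 := by simp [cycHom]
  rw [h4, Units.neg_smul, one_smul, add_neg_eq_zero] at h1
  rw [← h1]
  exact h.mem_boundaries _ (by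
    simp [cycHom, GradedQuiver.Seq.deg, GradedQuiver.Seq.length])

lemma comp_boundary_left {X Y Z : A.Ob} (a : h.cycles X Y) (b : h.cycles Y Z)
    (ha : a.1 ∈ h.boundaries X Y) : h.compCycles X Y Z a b = 0 := by
  obtain ⟨c, hc, hca⟩ := ha
  refine (Submodule.Quotient.mk_eq_zero _).2 ?_
  change A.μ (.pair (h.cycHom a) (h.cycHom b)) ∈ h.boundaries X Z
  have h1 := h.rel_two ⟨-1, c, hc⟩ (h.cycHom b)
  have h2 := h.zero_entry (.single ⟨-1, c, hc⟩) ⟨_, A.μ (.single (h.cycHom b)), h.mem _⟩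
    (.nil Z) b.2.2
  simp only [GradedQuiver.Seq.comp] at h2
  rw [h2, smul_zero, add_zero] at h1
  have h3 : A.μ (.pair ⟨_, A.μ (.single ⟨-1, c, hc⟩), h.mem _⟩ (h.cycHom b)) =
      A.μ (.pair (h.cycHom a) (h.cycHom b)) := by
    congr 1
    simp only [GradedQuiver.Seq.pair, cycHom, GradedQuiver.Seq.deg, GradedQuiver.Seq.length]
    congr 3
  rw [h3, add_eq_zero_iff_eq_neg] at h1
  rw [h1]
  exact neg_mem (h.mem_boundaries _ (by
    simp [cycHom, GradedQuiver.Seq.deg, GradedQuiver.Seq.length]))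

/-- Composition in the homotopy category. -/
def compH0 (X Y Z : A.Ob) : h.H0Hom X Y →ₗ[k] h.H0Hom Y Z →ₗ[k] h.H0Hom X Z :=
  Submodule.liftQ _
    (LinearMap.flip (Submodule.liftQ _ (LinearMap.flip (h.compCycles X Y Z)) (by
      intro b hb
      ext a
      exact h.comp_boundary_right a b hb)))
    (by
      intro a ha
      refine LinearMap.ext fun b => ?_
      obtain ⟨b, rfl⟩ := Submodule.Quotient.mk_surjective _ b
      exact h.comp_boundary_left a b ha)

/-- The class of a closed morphism of degree `0`. -/
def cls {X Y : A.Ob} (a : A.Hom X Y) (ha : a ∈ h.cycles X Y) : h.H0Hom X Y :=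
  Submodule.Quotient.mk ⟨a, ha⟩

lemma one_mem_cycles (X : A.Ob) : A.one X ∈ h.cycles X X := ⟨h.one_mem X, h.one_d X⟩

lemma compH0_cls {X Y Z : A.Ob} (a : h.cycles X Y) (b : h.cycles Y Z) :
    h.compH0 X Y Z (h.cls a.1 a.2) (h.cls b.1 b.2) =
      h.cls (A.μ (.pair (h.cycHom a) (h.cycHom b))) (h.comp_mem a b) := rfl

lemma H0_assoc {X Y Z W : A.Ob} (a : h.cycles X Y) (b : h.cycles Y Z) (c : h.cycles Z W) :
    h.compH0 X Z W (h.compH0 X Y Z (h.cls a.1 a.2) (h.cls b.1 b.2)) (h.cls c.1 c.2) =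
      h.compH0 X Y W (h.cls a.1 a.2) (h.compH0 Y Z W (h.cls b.1 b.2) (h.cls c.1 c.2)) := by
  refine (Submodule.Quotient.eq _).2 ?_
  change A.μ (.pair (h.cycHom ⟨_, h.comp_mem a b⟩) (h.cycHom c)) -
    A.μ (.pair (h.cycHom a) (h.cycHom ⟨_, h.comp_mem b c⟩)) ∈ h.boundaries X W
  have h1 := h.rel_three (h.cycHom a) (h.cycHom b) (h.cycHom c)
  have ha := h.zero_entry (.nil X) ⟨_, A.μ (.single (h.cycHom a)), h.mem _⟩
    (.pair (h.cycHom b) (h.cycHom c)) a.2.2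
  have hb := h.zero_entry (.single (h.cycHom a)) ⟨_, A.μ (.single (h.cycHom b)), h.mem _⟩
    (.single (h.cycHom c)) b.2.2
  have hc := h.zero_entry (.pair (h.cycHom a) (h.cycHom b))
    ⟨_, A.μ (.single (h.cycHom c)), h.mem _⟩ (.nil W) c.2.2
  simp only [GradedQuiver.Seq.comp] at ha hb hc
  rw [ha, hb, hc, smul_zero, smul_zero, zero_add, add_zero, add_zero] at h1
  have h4 : ((h.cycHom a).deg - 1).negOnePow = -1 := by simp [cycHom]
  rw [h4, Units.neg_smul, one_smul] at h1
  have h5 : A.μ (.pair (h.cycHom ⟨_, h.comp_mem a b⟩) (h.cycHom c)) =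
      A.μ (.pair ⟨_, A.μ (.pair (h.cycHom a) (h.cycHom b)), h.mem _⟩ (h.cycHom c)) := by
    congr 2
    exact GradedQuiver.HomogHom.ext (by simp [cycHom, GradedQuiver.Seq.deg, GradedQuiver.Seq.length]) rfl
  have h6 : A.μ (.pair (h.cycHom a) (h.cycHom ⟨_, h.comp_mem b c⟩)) =
      A.μ (.pair (h.cycHom a) ⟨_, A.μ (.pair (h.cycHom b) (h.cycHom c)), h.mem _⟩) := by
    congr 2
    exact GradedQuiver.HomogHom.ext (by simp [cycHom, GradedQuiver.Seq.deg, GradedQuiver.Seq.length]) rfl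
  rw [h5, h6]
  have h7 := h.mem_boundaries
    ⟨_, A.μ ((GradedQuiver.Seq.pair (h.cycHom a) (h.cycHom b)).cons (h.cycHom c)), h.mem _⟩ (by
    simp [cycHom, GradedQuiver.Seq.deg, GradedQuiver.Seq.length])
  have h8 := neg_mem h7
  convert h8 using 1
  rw [eq_neg_iff_add_eq_zero, ← h1]
  abel

end IsAInf

/-- The homotopy category `H⁰ A`. -/
structure H0 (A : AInfData.{u, w₁, w₂} k) (h : A.IsAInf) where
  of : A.Ob

variable {A} {h : A.IsAInf}

instance : Category (H0 A h) where
  Hom X Y := h.H0Hom X.of Y.of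
  id X := h.cls (A.one X.of) (h.one_mem_cycles _)
  comp f g := h.compH0 _ _ _ f g
  id_comp {X Y} f := by
    obtain ⟨f, rfl⟩ := Submodule.Quotient.mk_surjective _ f
    exact congrArg Submodule.Quotient.mk (Subtype.ext (h.one_right (h.cycHom f)))
  comp_id {X Y} f := by
    obtain ⟨f, rfl⟩ := Submodule.Quotient.mk_surjective _ f
    refine congrArg Submodule.Quotient.mk (Subtype.ext ?_)
    have := h.one_left (h.cycHom f)
    have h4 : (h.cycHom f).deg.negOnePow = 1 := by simp [IsAInf.cycHom]
    rwa [h4, one_smul] at this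
  assoc {X Y Z W} f g e := by
    obtain ⟨f, rfl⟩ := Submodule.Quotient.mk_surjective _ f
    obtain ⟨g, rfl⟩ := Submodule.Quotient.mk_surjective _ g
    obtain ⟨e, rfl⟩ := Submodule.Quotient.mk_surjective _ e
    exact h.H0_assoc f g e

instance : Preadditive (H0 A h) where
  homGroup X Y := inferInstanceAs (AddCommGroup (h.H0Hom X.of Y.of))
  add_comp X Y Z f f' g := LinearMap.map_add₂ (h.compH0 X.of Y.of Z.of) f f' g
  comp_add X Y Z f g g' := (h.compH0 X.of Y.of Z.of f).map_add g g'

instance : Linear k (H0 A h) where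
  homModule X Y := inferInstanceAs (Module k (h.H0Hom X.of Y.of))
  smul_comp X Y Z c f g := LinearMap.map_smul₂ (h.compH0 X.of Y.of Z.of) c f g
  comp_smul X Y Z f c g := (h.compH0 X.of Y.of Z.of f).map_smul c g

end AInfData

/-! ### Strict isomorphisms -/

/-- An isomorphism of graded quivers: a bijection of objects and degree preserving linear
isomorphisms of morphism spaces. -/
structure GradedQuiver.Iso {k : Type u} [Field k] (A : GradedQuiver.{u, w₁, w₂} k)
    (B : GradedQuiver.{u, v, w} k) where
  obj : A.Ob ≃ B.Ob
  map : ∀ X Y, A.Hom X Y ≃ₗ[k] B.Hom (obj X) (obj Y)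
  map_mem : ∀ {X Y} (d : ℤ) (a : A.Hom X Y), map X Y a ∈ B.gr _ _ d ↔ a ∈ A.gr X Y d

/-- The sequence `F(a₁), …, F(aₙ)`. -/
def GradedQuiver.Iso.mapSeq {k : Type u} [Field k] {A : GradedQuiver.{u, w₁, w₂} k}
    {B : GradedQuiver.{u, v, w} k} (F : A.Iso B) {X : A.Ob} :
    ∀ {Y : A.Ob}, A.Seq X Y → B.Seq (F.obj X) (F.obj Y)
  | _, .nil _ => .nil _
  | _, .cons p a => (F.mapSeq p).cons ⟨a.deg, F.map _ _ a.val, (F.map_mem _ _).2 a.mem⟩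

/-- A strict, strictly unital isomorphism of `A_∞`-categories. -/
structure AInfIso {k : Type u} [Field k] (A : AInfData.{u, w₁, w₂} k)
    (B : AInfData.{u, v, w} k) extends A.toGradedQuiver.Iso B.toGradedQuiver where
  map_one : ∀ X, map X X (A.one X) = B.one (obj X)
  map_μ : ∀ {X Y} (p : A.Seq X Y), map X Y (A.μ p) = B.μ (toIso.mapSeq p)

/-! ### Twisted complexes -/

namespace AInfData

variable {k : Type u} [Field k] (A : AInfData.{u, w₁, w₂} k)

/-- A formal direct sum `⨁ᵢ Eᵢ[kᵢ]` over a finite linearly ordered index set, with a strictly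
lower triangular endomorphism `δ` of degree `1`. -/
structure PreTw where
  ι : Type
  [fintype : Fintype ι]
  [linearOrder : LinearOrder ι]
  ob : ι → A.Ob
  shift : ι → ℤ
  δ : ∀ i j, A.Hom (ob i) (ob j)
  δ_mem : ∀ i j, δ i j ∈ A.gr (ob i) (ob j) (shift j - shift i + 1)
  δ_strict : ∀ i j, ¬ i < j → δ i j = 0

attribute [instance] PreTw.fintype PreTw.linearOrder

namespace PreTw

variable {A}

/-- The sequences `δ_{i₀i₁}, …, δ_{i_{n-1}i_n}` with `i = i₀ < i₁ < ⋯ < i_n = j`. The integer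
attached to a sequence is a sign exponent, see `AInfData.tw`; it depends on
the shift `σ₀` of the very first summand of the sequence of which the `δ`s are a part. -/
def chainsOfLength (E : A.PreTw) (σ₀ : ℤ) :
    ℕ → ∀ i j : E.ι, List (ℤ × A.Seq (E.ob i) (E.ob j))
  | 0, i, j => if h : i = j then [(0, .nilOfEq (congrArg E.ob h))] else []
  | n + 1, i, j => (Finset.univ.filter (· < j)).toList.flatMap fun l =>
      (E.chainsOfLength σ₀ n i l).map fun c =>
        (c.1 + (σ₀ - E.shift l) * (E.shift j - E.shift l), c.2.cons ⟨_, E.δ l j, E.δ_mem l j⟩)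

/-- The sequences of `δ`s from `i` to `j` of all lengths. -/
def chains (E : A.PreTw) (σ₀ : ℤ) (i j : E.ι) : List (ℤ × A.Seq (E.ob i) (E.ob j)) :=
  (List.range (Fintype.card E.ι + 1)).flatMap fun n => E.chainsOfLength σ₀ n i j

/-- The Maurer-Cartan equation `∑ₖ μᵏ(δ, …, δ) = 0`. -/
def MC (E : A.PreTw) : Prop := ∀ i j,
  ((E.chains (E.shift i) i j).map fun c => c.1.negOnePow • A.μ c.2).sum = 0

end PreTw

/-- Twisted complexes, with families of morphisms between the summands as morphisms;
`f` has degree `d` if `f_{ij}` has degree `d + l_j - k_i`. -/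
@[reducible] def twQuiver : GradedQuiver k where
  Ob := {E : A.PreTw // E.MC}
  Hom E F := ∀ (i : E.1.ι) (j : F.1.ι), A.Hom (E.1.ob i) (F.1.ob j)
  gr E F d := ⨅ (i : E.1.ι) (j : F.1.ι),
    (A.gr (E.1.ob i) (F.1.ob j) (d + F.1.shift j - E.1.shift i)).comap
      ((LinearMap.proj j).comp (LinearMap.proj i))

variable {A}

lemma mem_twGr {E F : A.twQuiver.Ob} {d : ℤ} {f : A.twQuiver.Hom E F} :
    f ∈ A.twQuiver.gr E F d ↔
      ∀ i j, f i j ∈ A.gr (E.1.ob i) (F.1.ob j) (d + F.1.shift j - E.1.shift i) := by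
  simp [twQuiver]

/-- The component `f_{ij}` of a homogeneous morphism of twisted complexes. -/
def twComponent {E F : A.twQuiver.Ob} (f : A.twQuiver.HomogHom E F) (i : E.1.ι) (j : F.1.ι) :
    A.HomogHom (E.1.ob i) (F.1.ob j) :=
  ⟨f.deg + F.1.shift j - E.1.shift i, f.val i j, mem_twGr.1 f.mem i j⟩

/-- All sequences of morphisms of `A` from the `i`-th summand of `E₀` to the
`j`-th summand of `Eₙ` that are obtained from `f₁, …, fₙ` by inserting
arbitrary numbers of `δ`s, `δ⁰, …, δ⁰, f₁, δ¹, …, δ¹, f₂, …, fₙ, δⁿ, …, δⁿ`, and choosing components;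
together with the exponent of the sign with which they contribute. -/
def twExpand {E : A.twQuiver.Ob} : ∀ {F : A.twQuiver.Ob}, A.twQuiver.Seq E F →
    ∀ (i : E.1.ι) (j : F.1.ι), List (ℤ × A.Seq (E.1.ob i) (F.1.ob j))
  | _, .nil _, i, j => E.1.chains (E.1.shift i) i j
  | _, .cons (Y := F) (Z := G) p f, i, j =>
      Finset.univ.toList.flatMap fun m : F.1.ι =>
        Finset.univ.toList.flatMap fun l : G.1.ι =>
          (twExpand p i m).flatMap fun q =>
            (G.1.chains (E.1.shift i) l j).map fun c =>
              (q.1 + (E.1.shift i - F.1.shift m) * ((twComponent f m l).deg - 1) + c.1,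
                (q.2.cons (twComponent f m l)).comp c.2)

variable (A)

open Classical in
/-- The identity matrix of the family of objects `ob`. -/
def unitMatrix {ι : Type} (ob : ι → A.Ob) (i j : ι) : A.Hom (ob i) (ob j) :=
  if h : i = j then h ▸ A.one (ob i) else 0

/-- The category of twisted complexes. A morphism `x : E_i → F_j` of degree `e`
of `A`, seen as a morphism `E_i[k] → F_j[l]`, is `φ ⊗ x` with `φ` the identity map `𝕜[k] → 𝕜[l]`, of
degree `k - l`; following the Koszul rule, `μⁿ(φₙ ⊗ xₙ, …, φ₁ ⊗ x₁)` is
`φₙ ⋯ φ₁ ⊗ μⁿ(xₙ, …, x₁)` times the sign with exponent `∑_{p<q} |φ_p| (|x_q| - 1)`. As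
the sum of the `|φ_p|` with `p < q` is `σ₀ - σ_{q-1}`, where `σ_p` are
the shifts of the objects passed, this is the exponent used above. -/
def tw : AInfData k where
  toGradedQuiver := A.twQuiver
  one E := A.unitMatrix E.1.ob
  μ p := fun i j => ((twExpand p i j).map fun c => c.1.negOnePow • A.μ c.2).sum

/-! ### Shifts, cones and exact functors -/

variable {A}

/-- The shift `E[1]`. -/
def PreTw.shiftOne (E : A.PreTw) : A.PreTw where
  ι := E.ι
  ob := E.ob
  shift i := E.shift i + 1
  δ := E.δ
  δ_mem i j := by
    have := E.δ_mem i j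
    rwa [show E.shift j + 1 - (E.shift i + 1) + 1 = E.shift j - E.shift i + 1 by ring]
  δ_strict := E.δ_strict

/-- The mapping cone of `f : E → F`, for `f` of degree `0`: the direct sum of `E[1]` and `F`, with
the given differentials on both summands and `f`, up to the Koszul sign, as component from
`E[1]` to `F`. -/
def PreTw.cone (E F : A.twQuiver.Ob) (f : A.twQuiver.Hom E F) (hf : f ∈ A.twQuiver.gr E F 0) :
    A.PreTw where
  ι := E.1.ι ⊕ₗ F.1.ι
  ob x := Sum.elim E.1.ob F.1.ob (ofLex x)
  shift x := Sum.elim (fun i => E.1.shift i + 1) F.1.shift (ofLex x)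
  δ x y := match ofLex x, ofLex y with
    | .inl i, .inl j => E.1.δ i j
    | .inl i, .inr j => (F.1.shift j).negOnePow • f i j
    | .inr _, .inl _ => 0
    | .inr i, .inr j => F.1.δ i j
  δ_mem x y := by
    rcases h : ofLex x with i | i <;> rcases h' : ofLex y with j | j
    · simp only [Sum.elim_inl]
      have := E.1.δ_mem i j
      rwa [show E.1.shift j + 1 - (E.1.shift i + 1) + 1 = E.1.shift j - E.1.shift i + 1 by ring]
    · simp only [Sum.elim_inl, Sum.elim_inr]
      have := mem_twGr.1 hf i j
      rw [show F.1.shift j - (E.1.shift i + 1) + 1 = 0 + F.1.shift j - E.1.shift i by ring]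
      rcases Int.units_eq_one_or (F.1.shift j).negOnePow with h1 | h1
      · rw [h1, one_smul]; exact this
      · rw [h1, Units.neg_smul, one_smul]; exact (Submodule.neg_mem_iff _).2 this
    · exact zero_mem _
    · exact F.1.δ_mem i j
  δ_strict x y hxy := by
    rcases h : ofLex x with i | i <;> rcases h' : ofLex y with j | j
    · obtain rfl : x = Sum.inlₗ i := h
      obtain rfl : y = Sum.inlₗ j := h'
      exact E.1.δ_strict i j fun hij => hxy (Sum.Lex.inl_lt_inl_iff.2 hij)
    · obtain rfl : x = Sum.inlₗ i := h
      obtain rfl : y = Sum.inrₗ j := h'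
      exact absurd (Sum.Lex.inl_lt_inr i j) hxy
    · rfl
    · obtain rfl : x = Sum.inrₗ i := h
      obtain rfl : y = Sum.inrₗ j := h'
      exact F.1.δ_strict i j fun hij => hxy (Sum.Lex.inr_lt_inr_iff.2 hij)

/-- The inclusion of the second summand into the mapping cone. -/
def coneInr (E F : A.twQuiver.Ob) (f : A.twQuiver.Hom E F) (hf : f ∈ A.twQuiver.gr E F 0)
    (hc : (PreTw.cone E F f hf).MC) : A.twQuiver.Hom F ⟨PreTw.cone E F f hf, hc⟩ :=
  fun j => Sum.rec (motive := fun y => A.Hom (F.1.ob j) ((PreTw.cone E F f hf).ob (toLex y)))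
    (fun _ => 0) (fun j' => A.unitMatrix F.1.ob j j')

/-- The projection of the mapping cone to the shift of its first summand. -/
def coneFst (E F : A.twQuiver.Ob) (f : A.twQuiver.Hom E F) (hf : f ∈ A.twQuiver.gr E F 0)
    (hc : (PreTw.cone E F f hf).MC) (hE : E.1.shiftOne.MC) :
    A.twQuiver.Hom ⟨PreTw.cone E F f hf, hc⟩ ⟨E.1.shiftOne, hE⟩ :=
  fun x i => Sum.rec (motive := fun x => A.Hom ((PreTw.cone E F f hf).ob (toLex x)) (E.1.ob i))
    (fun i' => A.unitMatrix E.1.ob i' i) (fun _ => 0) (ofLex x)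

/-- A functor from `H⁰(Tw A)` to a triangulated category is exact if it commutes
with the shifts, up to a natural isomorphism, and sends the triangles
`E → F → cone f → E[1]` to distinguished triangles. -/
def IsExact (h : A.tw.IsAInf) {K : Type*} [Category K] [Preadditive K]
    [Limits.HasZeroObject K] [HasShift K ℤ] [∀ n : ℤ, (shiftFunctor K n).Additive]
    [Pretriangulated K] (G : H0 A.tw h ⥤ K) : Prop :=
  ∃ (hs : ∀ E : A.twQuiver.Ob, E.1.shiftOne.MC)
    (θ : ∀ E : A.twQuiver.Ob, G.obj ⟨⟨E.1.shiftOne, hs E⟩⟩ ≅ (G.obj ⟨E⟩)⟦(1 : ℤ)⟧),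
    (∀ (E F : A.twQuiver.Ob) (f : A.twQuiver.Hom E F) (hf : f ∈ h.cycles E F),
      ∃ hf' : f ∈ h.cycles ⟨E.1.shiftOne, hs E⟩ ⟨F.1.shiftOne, hs F⟩,
        G.map (X := ⟨_⟩) (Y := ⟨_⟩) (h.cls _ hf') ≫ (θ F).hom =
          (θ E).hom ≫ (G.map (X := ⟨E⟩) (Y := ⟨F⟩) (h.cls f hf))⟦(1 : ℤ)⟧') ∧
    ∀ (E F : A.twQuiver.Ob) (f : A.twQuiver.Hom E F) (hf : f ∈ h.cycles E F),
      ∃ (hc : (PreTw.cone E F f hf.1).MC)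
        (hi : coneInr E F f hf.1 hc ∈ h.cycles F ⟨PreTw.cone E F f hf.1, hc⟩)
        (hp : coneFst E F f hf.1 hc (hs E) ∈
          h.cycles ⟨PreTw.cone E F f hf.1, hc⟩ ⟨E.1.shiftOne, hs E⟩),
        Pretriangulated.Triangle.mk (G.map (X := ⟨E⟩) (Y := ⟨F⟩) (h.cls f hf))
          (G.map (X := ⟨F⟩) (Y := ⟨_⟩) (h.cls _ hi))
          (G.map (X := ⟨_⟩) (Y := ⟨_⟩) (h.cls _ hp) ≫ (θ E).hom) ∈ distTriang K

end AInfData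

/-! ## Modules over a finite-dimensional algebra -/

section Modules

variable (k : Type u) [Field k] (B : Type v) [Ring B] [Algebra k B]

/-- The right ideals `Pᵢ`, seen as right modules, with the module homomorphisms
as morphisms, all of degree `0`. -/
@[reducible] def projQuiver {ι : Type w} (P : ι → Submodule Bᵐᵒᵖ B) : GradedQuiver.{u, w, v} k where
  Ob := ι
  Hom i j := P i →ₗ[Bᵐᵒᵖ] P j
  gr _ _ d := if d = 0 then ⊤ else ⊥

/-- The composition `b ∘ a` of sequences `a, b`, and `0` for sequences of a length other than two. -/
def projComp {ι : Type w} (P : ι → Submodule Bᵐᵒᵖ B) :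
    ∀ {i j : ι}, (projQuiver k B P).Seq i j → (P i →ₗ[Bᵐᵒᵖ] P j)
  | _, _, GradedQuiver.Seq.cons (GradedQuiver.Seq.cons (GradedQuiver.Seq.nil _) a) b =>
      LinearMap.comp b.val a.val
  | _, _, _ => 0

/-- The `A_∞`-category with the right modules `Pᵢ` as objects, the module
homomorphisms as morphisms, all of degree `0`, composition as `μ²`, and no other operations. -/
def projAInf {ι : Type w} (P : ι → Submodule Bᵐᵒᵖ B) : AInfData.{u, w, v} k where
  toGradedQuiver := projQuiver k B P
  one _ := LinearMap.id
  μ := projComp k B P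

/-- A nonzero module without non-trivial direct sum decompositions. -/
def IsIndecomposableModule (R : Type*) [Ring R] (N : Type*) [AddCommGroup N] [Module R N] : Prop :=
  Nontrivial N ∧ ∀ p q : Submodule R N, IsCompl p q → p = ⊥ ∨ q = ⊥

/-- Bounded complexes of finitely generated projective right `B`-modules, as objects of the
homotopy category of complexes of right `B`-modules. -/
def IsPerfectComplex :
    ObjectProperty (HomotopyCategory (ModuleCat.{v} Bᵐᵒᵖ) (ComplexShape.up ℤ)) := fun K =>
  (∀ n, Module.Finite Bᵐᵒᵖ (K.as.X n) ∧ Module.Projective Bᵐᵒᵖ (K.as.X n)) ∧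
    ∃ a b : ℤ, ∀ n, n < a ∨ b < n → Subsingleton (K.as.X n)

/-- `K^b(proj B)`. -/
abbrev PerfectComplexes := (IsPerfectComplex B).FullSubcategory

end Modules

/-! ## Ribbon graphs and Brauer graph algebras -/

/-- Ribbon graphs. The last three fields say that the cycles of `ρ` are the sets of
half-edges at the vertices. -/
structure RibbonGraph where
  V : Type v
  H : Type v
  [finiteV : Finite V]
  [finiteH : Finite H]
  s : H → V
  ι : H → H
  ι_ι : ∀ h, ι (ι h) = h
  ι_ne : ∀ h, ι h ≠ h
  ρ : Equiv.Perm H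
  s_ρ : ∀ h, s (ρ h) = s h
  sameCycle : ∀ h h', s h = s h' → ρ.SameCycle h h'
  s_surjective : Function.Surjective s

namespace RibbonGraph

attribute [instance] finiteV finiteH

variable (Γ : RibbonGraph.{v})

/-- Two half-edges are equivalent if they belong to the same edge. -/
def edgeSetoid : Setoid Γ.H where
  r h h' := h' = h ∨ h' = Γ.ι h
  iseqv :=
    { refl := fun _ => Or.inl rfl
      symm := by
        rintro x y (rfl | rfl)
        · exact Or.inl rfl
        · exact Or.inr (Γ.ι_ι x).symm
      trans := by
        rintro x y z (rfl | rfl) (rfl | rfl)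
        · exact Or.inl rfl
        · exact Or.inr rfl
        · exact Or.inr rfl
        · exact Or.inl (Γ.ι_ι x) }

/-- The edges of `Γ`, i.e. the orbits of `ι`. -/
def Edge : Type v := Quotient Γ.edgeSetoid

/-- The edge of a half-edge. -/
def edge (h : Γ.H) : Γ.Edge := Quotient.mk Γ.edgeSetoid h

instance : Finite Γ.Edge := inferInstanceAs (Finite (Quotient Γ.edgeSetoid))

instance : Fintype Γ.Edge := Fintype.ofFinite _

/-- The valency of the vertex of `h`, i.e. the length of the cycle of `ρ` through `h`. -/
def val (h : Γ.H) : ℕ := Nat.card {h' : Γ.H // Γ.s h' = Γ.s h}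

/-- The length of the maximal paths around the vertex of `h`. -/
def maxLength (m : Γ.V → ℕ+) (h : Γ.H) : ℕ := m (Γ.s h) * Γ.val h

end RibbonGraph

/-! ### Path algebras -/

section PathAlgebra

variable (k : Type u) [Field k] {Q₀ : Type v} {Q₁ : Type v} [Fintype Q₀] (src tgt : Q₁ → Q₀)

/-- The relations among the generators `eᵢ`, for `i` a vertex, and `α`, for `α` an arrow, of a path
algebra. Products are read from right to left: `β α` is `α` followed by `β`. -/
inductive PathAlgebraRel : FreeAlgebra k (Q₀ ⊕ Q₁) → FreeAlgebra k (Q₀ ⊕ Q₁) → Prop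
  | idem (i : Q₀) : PathAlgebraRel (.ι k (.inl i) * .ι k (.inl i)) (.ι k (.inl i))
  | orth (i j : Q₀) (h : i ≠ j) : PathAlgebraRel (.ι k (.inl i) * .ι k (.inl j)) 0
  | one : PathAlgebraRel (∑ i, .ι k (.inl i)) 1
  | tgt (a : Q₁) : PathAlgebraRel (.ι k (.inl (tgt a)) * .ι k (.inr a)) (.ι k (.inr a))
  | src (a : Q₁) : PathAlgebraRel (.ι k (.inr a) * .ι k (.inl (src a))) (.ι k (.inr a))

/-- The path algebra of the quiver with vertices `Q₀`, arrows `Q₁`, and the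
given sources and targets. -/
def PathAlgebra : Type (max u v) := RingQuot (PathAlgebraRel k src tgt)

namespace PathAlgebra

instance : Ring (PathAlgebra k src tgt) := inferInstanceAs (Ring (RingQuot _))

instance : Algebra k (PathAlgebra k src tgt) := inferInstanceAs (Algebra k (RingQuot _))

/-- The trivial path at a vertex. -/
def vertex (i : Q₀) : PathAlgebra k src tgt :=
  RingQuot.mkAlgHom k (PathAlgebraRel k src tgt) (.ι k (.inl i))

/-- The path given by an arrow. -/
def arrow (a : Q₁) : PathAlgebra k src tgt :=
  RingQuot.mkAlgHom k (PathAlgebraRel k src tgt) (.ι k (.inr a))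

lemma vertex_mul_vertex (i : Q₀) :
    vertex k src tgt i * vertex k src tgt i = vertex k src tgt i :=
  (map_mul (RingQuot.mkAlgHom k (PathAlgebraRel k src tgt)) _ _).symm.trans
    (RingQuot.mkAlgHom_rel k (PathAlgebraRel.idem i))

end PathAlgebra

end PathAlgebra

/-! ### Brauer graph algebras -/

namespace RibbonGraph

variable (k : Type u) [Field k] (Γ : RibbonGraph.{v})

/-- The path algebra of the quiver of `Γ`: its vertices are the edges of `Γ`, and every half-edge
`h` gives an arrow from the edge of `h` to the edge of `ρ h`. -/
abbrev QuiverAlgebra : Type (max u v) :=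
  PathAlgebra k (fun h : Γ.H => Γ.edge h) (fun h : Γ.H => Γ.edge (Γ.ρ h))

/-- The arrow `α_h`. -/
def arrow (h : Γ.H) : Γ.QuiverAlgebra k := PathAlgebra.arrow k _ _ h

/-- The closed path `C_α = α π(α) ⋯ π^l(α)` for `α = α_h`, where `π(α_h) = α_{ρ⁻¹ h}` and
`l + 1` is the cardinality of the orbit of `α` under `π`. -/
def cyc (h : Γ.H) : Γ.QuiverAlgebra k :=
  ((List.range (Γ.val h)).map fun i => Γ.arrow k ((Γ.ρ.symm)^[i] h)).prod

/-- The relations of the modified Brauer graph algebra of `(Γ, m, ω)`. -/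
inductive BrauerRel (m : Γ.V → ℕ+) (wn : Γ.Edge → ℤ) :
    Γ.QuiverAlgebra k → Γ.QuiverAlgebra k → Prop
  | zero (h g : Γ.H) (hc : Γ.edge h = Γ.edge (Γ.ρ g)) (hg : Γ.ρ.symm h ≠ g) :
      BrauerRel m wn (Γ.arrow k h * Γ.arrow k g) 0
  | cycle (h : Γ.H) :
      BrauerRel m wn (Γ.cyc k (Γ.ρ.symm h) ^ (m (Γ.s h) : ℕ))
        ((wn (Γ.edge h)).negOnePow • Γ.cyc k (Γ.ρ.symm (Γ.ι h)) ^ (m (Γ.s (Γ.ι h)) : ℕ))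

/-- The modified Brauer graph algebra of `(Γ, m, ω)`. -/
def ModifiedBGA (m : Γ.V → ℕ+) (wn : Γ.Edge → ℤ) : Type (max u v) :=
  RingQuot (Γ.BrauerRel k m wn)

/-- The Brauer graph algebra of `(Γ, m)`. -/
abbrev BGA (m : Γ.V → ℕ+) : Type (max u v) := Γ.ModifiedBGA k m 0

namespace ModifiedBGA

variable {Γ} (m : Γ.V → ℕ+) (wn : Γ.Edge → ℤ)

instance : Ring (Γ.ModifiedBGA k m wn) := inferInstanceAs (Ring (RingQuot _))

instance : Algebra k (Γ.ModifiedBGA k m wn) := inferInstanceAs (Algebra k (RingQuot _))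

/-- The projection from the path algebra. -/
def proj : Γ.QuiverAlgebra k →ₐ[k] Γ.ModifiedBGA k m wn := RingQuot.mkAlgHom k (Γ.BrauerRel k m wn)

/-- The idempotent of an edge. -/
def e (γ : Γ.Edge) : Γ.ModifiedBGA k m wn := proj k m wn (PathAlgebra.vertex k _ _ γ)

lemma e_mul_e (γ : Γ.Edge) : e k m wn γ * e k m wn γ = e k m wn γ := by
  rw [e, ← map_mul, PathAlgebra.vertex_mul_vertex]

/-- The class of the path `α_{ρ^{ℓ-1} h} ⋯ α_{ρ h} α_h` of length `ℓ` around the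
vertex of `h`, from the edge of `h` to the edge of `ρ^ℓ h`. Every path which is nonzero in the algebra is
of this form, with `ℓ ≤ m(s(h)) val(h)`. -/
def path (h : Γ.H) : ℕ → Γ.ModifiedBGA k m wn
  | 0 => e k m wn (Γ.edge h)
  | ℓ + 1 => proj k m wn (Γ.arrow k ((Γ.ρ)^[ℓ] h)) * path h ℓ

/-- The projective right module `P_γ = e_γ B`. -/
def P (γ : Γ.Edge) : Submodule (Γ.ModifiedBGA k m wn)ᵐᵒᵖ (Γ.ModifiedBGA k m wn) :=
  Submodule.span _ {e k m wn γ}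

/-- The subspace `e_δ B e_γ`, spanned by the paths from `γ` to `δ`. -/
def homSpace (γ δ : Γ.Edge) : Submodule k (Γ.ModifiedBGA k m wn) where
  carrier := {x | e k m wn δ * x = x ∧ x * e k m wn γ = x}
  zero_mem' := by simp
  add_mem' := by
    rintro x y ⟨hx, hx'⟩ ⟨hy, hy'⟩
    exact ⟨by rw [mul_add, hx, hy], by rw [add_mul, hx', hy']⟩
  smul_mem' := by
    rintro c x ⟨hx, hx'⟩
    exact ⟨by rw [mul_smul_comm, hx], by rw [smul_mul_assoc, hx']⟩

end ModifiedBGA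

end RibbonGraph

/-! ## Surfaces, arcs and line fields -/

section Surfaces

variable (M : Type w) [TopologicalSpace M] [ChartedSpace (EuclideanHalfSpace 2) M]

/-- A smooth bundle map `J : TM → TM` with `J² = -1`, the rotation by a quarter turn in the
counter-clockwise direction. It is an auxiliary choice which records the orientation of the
surface: `(v, J v)` is a positively oriented basis for all `v ≠ 0`. -/
structure QuarterTurn [IsManifold (𝓡∂ 2) ∞ M] where
  J : ∀ x : M, TangentSpace (𝓡∂ 2) x →L[ℝ] TangentSpace (𝓡∂ 2) x
  J_J : ∀ x v, J x (J x v) = -v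
  smooth : ContMDiff (𝓡∂ 2).tangent (𝓡∂ 2).tangent ∞
    (fun p : TangentBundle (𝓡∂ 2) M => (⟨p.1, J p.1 p.2⟩ : TangentBundle (𝓡∂ 2) M))

variable {M} [IsManifold (𝓡∂ 2) ∞ M]

/-- The rotation of tangent vectors by the angle `θ`, counter-clockwise for `θ > 0`. -/
def QuarterTurn.rot (J : QuarterTurn M) (x : M) (θ : ℝ) (v : TangentSpace (𝓡∂ 2) x) :
    TangentSpace (𝓡∂ 2) x :=
  Real.cos θ • v + Real.sin θ • J.J x v

/-- Line fields on `M` with singularities in `S`: smooth sections of the projectivized tangent bundle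
over the complement of `S`; locally they are spanned by nonvanishing smooth vector fields. The
values at points of `S` have no meaning. -/
structure LineField (S : Set M) where
  line : ∀ x : M, Submodule ℝ (TangentSpace (𝓡∂ 2) x)
  smooth : ∀ x ∉ S, ∃ U : Set M, IsOpen U ∧ x ∈ U ∧ ∃ X : ∀ y : M, TangentSpace (𝓡∂ 2) y,
    ContMDiffOn (𝓡∂ 2) (𝓡∂ 2).tangent ∞ (fun y => (⟨y, X y⟩ : TangentBundle (𝓡∂ 2) M)) U ∧
      ∀ y ∈ U, X y ≠ 0 ∧ line y = Submodule.span ℝ {X y}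

/-- The derivative of a path `γ : [0, 1] → M`. -/
def velocity (γ : ℝ → M) (t : ℝ) : TangentSpace (𝓡∂ 2) (γ t) :=
  mfderivWithin 𝓘(ℝ, ℝ) (𝓡∂ 2) γ (Set.Icc 0 1) t (1 : ℝ)

/-- `θ ∈ (0, 2π]` is the angle of a counter-clockwise rotation which takes the
ray through `v` to the ray through `w`. -/
def QuarterTurn.IsCcwAngle (J : QuarterTurn M) (x : M) (v w : TangentSpace (𝓡∂ 2) x) (θ : ℝ) :
    Prop :=
  0 < θ ∧ θ ≤ 2 * Real.pi ∧ ∃ c : ℝ, 0 < c ∧ J.rot x θ v = c • w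

/-- An embedding of the ribbon graph `Γ` into an oriented surface: an arc system whose ribbon
graph is `Γ`. Every arc is given together with its two parametrizations by `[0, 1]`, which correspond
to the two half-edges `h` of an edge: `arc h` starts at the vertex of `h`. -/
structure ArcSystem (J : QuarterTurn M) (Γ : RibbonGraph.{v}) where
  vertex : Γ.V → M
  vertex_injective : Function.Injective vertex
  vertex_interior : ∀ v, vertex v ∈ (𝓡∂ 2).interior M
  arc : Γ.H → ℝ → M
  smooth : ∀ h, ContMDiffOn 𝓘(ℝ, ℝ) (𝓡∂ 2) ∞ (arc h) (Set.Icc 0 1)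
  immersion : ∀ h, ∀ t ∈ Set.Icc (0 : ℝ) 1, velocity (arc h) t ≠ 0
  reverse : ∀ h, ∀ t ∈ Set.Icc (0 : ℝ) 1, arc (Γ.ι h) t = arc h (1 - t)
  start : ∀ h, arc h 0 = vertex (Γ.s h)
  arc_interior : ∀ h, ∀ t ∈ Set.Ioo (0 : ℝ) 1,
    arc h t ∈ (𝓡∂ 2).interior M ∧ arc h t ∉ Set.range vertex
  /-- the arcs are simple and meet only in their end points -/
  disjoint : ∀ g h, ∀ t ∈ Set.Ioo (0 : ℝ) 1, ∀ u ∈ Set.Ioo (0 : ℝ) 1, arc h t = arc g u →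
    (g = h ∧ u = t) ∨ (g = Γ.ι h ∧ u = 1 - t)
  /-- different arcs have different directions at their common end points -/
  direction : ∀ g h, g ≠ h → Γ.s g = Γ.s h → ∀ c : ℝ, 0 < c →
    (velocity (arc g) 0 : EuclideanSpace ℝ (Fin 2)) ≠ c • velocity (arc h) 0
  /-- `ρ h` is the half-edge that follows `h` in the counter-clockwise order -/
  cyclic : ∀ h, ∃ θ, J.IsCcwAngle (arc h 0) (velocity (arc h) 0)
      (velocity (arc (Γ.ρ h)) 0 : EuclideanSpace ℝ (Fin 2)) θ ∧
    ∀ g θ', Γ.s g = Γ.s h → J.IsCcwAngle (arc h 0) (velocity (arc h) 0)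
      (velocity (arc g) 0 : EuclideanSpace ℝ (Fin 2)) θ' → θ ≤ θ'

namespace ArcSystem

variable {J : QuarterTurn M} {Γ : RibbonGraph.{v}} (κ : ArcSystem J Γ)

/-- The set of punctures. -/
def punctures : Set M := Set.range κ.vertex

/-- The union of all arcs. -/
def carrier : Set M := ⋃ h, κ.arc h '' Set.Icc 0 1

/-- The embedding is filling: the complement of the graph is a collar of the boundary, i.e. it is a
disjoint union of half-open annuli, one for every boundary component. -/
def IsFilling : Prop :=
  ∃ φ : ((κ.carrierᶜ : Set M) : Type w) ≃ₜ (((𝓡∂ 2).boundary M : Set M) : Type w) ×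
      (Set.Ico (0 : ℝ) 1),
    ∀ (x : (κ.carrierᶜ : Set M)) (hx : (x : M) ∈ (𝓡∂ 2).boundary M),
      φ x = (⟨x, hx⟩, ⟨0, by norm_num⟩)

end ArcSystem

/-- An oriented coordinate disc of radius `R` around the puncture `p` in
which the leaves of the line field `η` are the circles around `p`. -/
structure PolarDisc (J : QuarterTurn M) {S : Set M} (η : LineField S) (p : M) where
  R : ℝ
  R_pos : 0 < R
  ψ : ℂ → M
  smooth : ContMDiffOn 𝓘(ℝ, ℂ) (𝓡∂ 2) ∞ ψ (Metric.ball 0 R)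
  injOn : Set.InjOn ψ (Metric.ball 0 R)
  center : ψ 0 = p
  oriented : ∀ z ∈ Metric.ball (0 : ℂ) R, mfderiv 𝓘(ℝ, ℂ) (𝓡∂ 2) ψ z (1 : ℂ) ≠ 0 ∧
    ∃ a b : ℝ, 0 < b ∧ mfderiv 𝓘(ℝ, ℂ) (𝓡∂ 2) ψ z Complex.I =
      a • mfderiv 𝓘(ℝ, ℂ) (𝓡∂ 2) ψ z (1 : ℂ) + b • J.J _ (mfderiv 𝓘(ℝ, ℂ) (𝓡∂ 2) ψ z (1 : ℂ))
  regular : ∀ z ∈ Metric.ball (0 : ℂ) R, z ≠ 0 → ψ z ∉ S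
  leaves : ∀ z ∈ Metric.ball (0 : ℂ) R, z ≠ 0 →
    η.line (ψ z) = Submodule.span ℝ {mfderiv 𝓘(ℝ, ℂ) (𝓡∂ 2) ψ z (Complex.I * z : ℂ)}

namespace ArcSystem

variable {J : QuarterTurn M} {Γ : RibbonGraph.{v}} (κ : ArcSystem J Γ)
  (η : LineField κ.punctures)

/-- `η` is the line field `η_Γ` of the ribbon graph: near the vertices its leaves are circles around
the vertices, and it is transverse to all edges. -/
def IsRibbonLineField : Prop :=
  (∀ v, Nonempty (PolarDisc J η (κ.vertex v))) ∧
    ∀ h, ∀ t ∈ Set.Ioo (0 : ℝ) 1, velocity (κ.arc h) t ∉ η.line (κ.arc h t)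

/-- Gradings of all arcs. A homotopy class of paths from `η` to the direction of
the arc in the projectivized tangent spaces along the arc is given by
the angle of rotation, a continuous function on `(0, 1)`. -/
structure Grading where
  angle : Γ.H → ℝ → ℝ
  continuousOn : ∀ h, ContinuousOn (angle h) (Set.Ioo 0 1)
  reverse : ∀ h, ∀ t ∈ Set.Ioo (0 : ℝ) 1, angle (Γ.ι h) t = angle h (1 - t)
  rot_mem : ∀ h, ∀ t ∈ Set.Ioo (0 : ℝ) 1, ∀ v ∈ η.line (κ.arc h t),
    J.rot _ (angle h t) v ∈ Submodule.span ℝ {velocity (κ.arc h) t}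

variable {κ η} (𝔤 : κ.Grading η)

/-- The gradings by shortest clockwise paths from `η` to the directions of the arcs. -/
def Grading.IsShortestClockwise : Prop :=
  ∀ h, ∀ t ∈ Set.Ioo (0 : ℝ) 1, -Real.pi < 𝔤.angle h t ∧ 𝔤.angle h t < 0

/-- The winding number of the arc of `h` is `n`: the arc is transverse to `η` near
its end points, and the number of times that its direction crosses `η`, counted with signs, is `n`.
The direction is parallel to `η` where the angle is a multiple of `π`. -/
def Grading.HasWinding (h : Γ.H) (n : ℤ) : Prop :=
  ∃ ε : ℝ, 0 < ε ∧ ε < 1 / 2 ∧ ∀ t u : ℝ, 0 < t → t < ε → 1 - ε < u → u < 1 →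
    velocity (κ.arc h) t ∉ η.line (κ.arc h t) ∧ velocity (κ.arc h) u ∉ η.line (κ.arc h u) ∧
      ⌊𝔤.angle h u / Real.pi⌋ - ⌊𝔤.angle h t / Real.pi⌋ = n

/-- The half-edges `h ≠ g` start at the same puncture, and
the corresponding oriented intersection from the arc of `h` to the arc of `g` has degree `d`. For
the computation of `d` we cut off the sector which lies to the left of the arc of `h` and to the right
of the arc of `g` by the segment `u` of a leaf, with the constant grading:
`u` is the path `τ ↦ ψ(r e^{iτ})`, `a ≤ τ ≤ b`, from `arc h s₁` to `arc g s₂`. The angles of the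
counter-clockwise paths from the directions of the two arcs to the direction of `u` are
`c₁` and `c₂`, so that `n₁` and `n₂` are the degrees of the intersections of
the two arcs with `u`. -/
def Grading.HasDegree (h g : Γ.H) (d : ℤ) : Prop :=
  h ≠ g ∧ Γ.s h = Γ.s g ∧
  ∃ (D : PolarDisc J η (κ.vertex (Γ.s h))) (r a b s₁ s₂ c₁ c₂ : ℝ) (n₁ n₂ : ℤ),
    0 < r ∧ r < D.R ∧ a < b ∧ b < a + 2 * Real.pi ∧
    s₁ ∈ Set.Ioo (0 : ℝ) 1 ∧ s₂ ∈ Set.Ioo (0 : ℝ) 1 ∧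
    κ.arc h s₁ = D.ψ (r * Complex.exp (a * Complex.I)) ∧
    κ.arc g s₂ = D.ψ (r * Complex.exp (b * Complex.I)) ∧
    κ.arc h '' Set.Ico 0 s₁ ⊆ D.ψ '' Metric.ball 0 r ∧
    κ.arc g '' Set.Ico 0 s₂ ⊆ D.ψ '' Metric.ball 0 r ∧
    c₁ ∈ Set.Ioo 0 Real.pi ∧ c₂ ∈ Set.Ioo 0 Real.pi ∧
    J.rot _ c₁ (velocity (κ.arc h) s₁) ∈ η.line (κ.arc h s₁) ∧
    J.rot _ c₂ (velocity (κ.arc g) s₂) ∈ η.line (κ.arc g s₂) ∧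
    𝔤.angle h s₁ + c₁ = n₁ * Real.pi ∧ 𝔤.angle g s₂ + c₂ = n₂ * Real.pi ∧ d = n₁ - n₂

/-- The degree of the arrow `α_h` is `d`. It is the degree of an intersection, and `0`
for the loop at a vertex of valency `1`. -/
def Grading.IsArrowDegree (h : Γ.H) (d : ℤ) : Prop :=
  (Γ.ρ h = h ∧ d = 0) ∨ 𝔤.HasDegree h (Γ.ρ h) d

variable (κ)

/-- A marked disc: a continuous map from the closed unit disc to `M`, which is an orientation
preserving smooth immersion away from `n ≥ 1` marked points on the unit circle. The marked points,
`exp(-i φⱼ)`, are mapped to punctures. The edges of the disc are numbered in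
clockwise order; the `j`-th one, between the marked points with the angles `φⱼ` and `φ_{j+1}`, is
mapped to an arc, and `g j` is the half-edge at which it ends when the
boundary is traversed in clockwise direction. -/
def HasMarkedDisc (n : ℕ) (g : Fin n → Γ.H) : Prop :=
  ∃ (f : ℂ → M) (φ : ℕ → ℝ),
    (∀ j < n, φ j < φ (j + 1)) ∧ φ n = φ 0 + 2 * Real.pi ∧
    ContinuousOn f (Metric.closedBall 0 1) ∧
    (∀ j < n, f (Complex.exp (-(φ j * Complex.I))) ∈ κ.punctures) ∧
    ContMDiffOn 𝓘(ℝ, ℂ) (𝓡∂ 2) ∞ f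
      (Metric.closedBall 0 1 \ {z | ∃ j < n, z = Complex.exp (-(φ j * Complex.I))}) ∧
    (∀ z ∈ Metric.closedBall (0 : ℂ) 1, (∀ j < n, z ≠ Complex.exp (-(φ j * Complex.I))) →
      mfderivWithin 𝓘(ℝ, ℂ) (𝓡∂ 2) f (Metric.closedBall 0 1) z (1 : ℂ) ≠ 0 ∧
      ∃ a b : ℝ, 0 < b ∧
        mfderivWithin 𝓘(ℝ, ℂ) (𝓡∂ 2) f (Metric.closedBall 0 1) z Complex.I =
          a • mfderivWithin 𝓘(ℝ, ℂ) (𝓡∂ 2) f (Metric.closedBall 0 1) z (1 : ℂ) +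
          b • J.J _ (mfderivWithin 𝓘(ℝ, ℂ) (𝓡∂ 2) f (Metric.closedBall 0 1) z (1 : ℂ))) ∧
    ∀ j : Fin n, ∃ τ : ℝ → ℝ, ContinuousOn τ (Set.Icc (φ j) (φ (j + 1))) ∧
      StrictMonoOn τ (Set.Icc (φ j) (φ (j + 1))) ∧ τ (φ j) = 0 ∧ τ (φ (j + 1)) = 1 ∧
      ∀ t ∈ Set.Icc (φ j) (φ (j + 1)),
        f (Complex.exp (-(t * Complex.I))) = κ.arc (Γ.ι (g j)) (τ t)

/-- Disc sequences `a₁, …, aₙ`. A pair `(g, ℓ)` stands for the path of length `ℓ`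
which starts at the half-edge `g`, or the corresponding oriented
intersection from the arc of `g` to the arc of `ρ^ℓ g`, if `0 < ℓ < val(g)`. -/
def IsDiscSequence (L : List (Γ.H × ℕ)) : Prop :=
  ∃ (n : ℕ) (g : Fin n → Γ.H) (ℓ : Fin n → ℕ) (hn : 0 < n),
    L = List.ofFn (fun j => (g j, ℓ j)) ∧ κ.HasMarkedDisc n g ∧
    ∀ j : Fin n, 0 < ℓ j ∧ ℓ j < Γ.val (g j) ∧
      (Γ.ρ)^[ℓ j] (g j) = Γ.ι (g ⟨(j + 1) % n, Nat.mod_lt _ hn⟩)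

end ArcSystem

end Surfaces

/-! ## The Brauer graph category -/

namespace RibbonGraph

variable (k : Type u) [Field k] (Γ : RibbonGraph.{v}) (m : Γ.V → ℕ+)

variable {Γ} in
/-- The degree of the path of length `ℓ` around a vertex which starts at the half-edge `h`, if
the arrow `α_g` has degree `arrowDeg g`. -/
def pathDeg (arrowDeg : Γ.H → ℤ) (h : Γ.H) (ℓ : ℕ) : ℤ :=
  ∑ i ∈ Finset.range ℓ, arrowDeg ((Γ.ρ)^[i] h)

/-- The objects are the edges, the morphisms from `γ` to `δ` are the linear combinations
of classes of paths from `γ` to `δ` in the modified Brauer graph algebra of `(Γ, m, ω)`, and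
the degree of a path is the sum of the degrees of its arrows. -/
@[reducible] def brauerQuiver (arrowDeg : Γ.H → ℤ) (wn : Γ.Edge → ℤ) :
    GradedQuiver.{u, v, max u v} k where
  Ob := Γ.Edge
  Hom γ δ := ModifiedBGA.homSpace k m wn γ δ
  gr γ δ d := Submodule.span k {x | ∃ (h : Γ.H) (ℓ : ℕ), ℓ ≤ Γ.maxLength m h ∧ Γ.edge h = γ ∧
    Γ.edge ((Γ.ρ)^[ℓ] h) = δ ∧ pathDeg arrowDeg h ℓ = d ∧
    (x : Γ.ModifiedBGA k m wn) = ModifiedBGA.path k m wn h ℓ}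

variable {k Γ m} in
/-- The entries `a₁, …, aₙ` of a sequence, as elements of the algebra. -/
def entries {arrowDeg : Γ.H → ℤ} {wn : Γ.Edge → ℤ} :
    ∀ {γ δ : Γ.Edge}, (Γ.brauerQuiver k m arrowDeg wn).Seq γ δ → List (Γ.ModifiedBGA k m wn)
  | _, _, .nil _ => []
  | _, _, .cons p a => entries p ++ [(a.val : Γ.ModifiedBGA k m wn)]

variable {M : Type w} [TopologicalSpace M] [ChartedSpace (EuclideanHalfSpace 2) M]
  [IsManifold (𝓡∂ 2) ∞ M] {J : QuarterTurn M} {Γ} (κ : ArcSystem J Γ)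

/-- `SpecialValue L v`: the list `L = [c₁, …, cₙ]` is one of the sequences with
a prescribed value `v = μⁿ(cₙ, …, c₁)`. -/
inductive SpecialValue (arrowDeg : Γ.H → ℤ) (wn : Γ.Edge → ℤ) :
    List (Γ.ModifiedBGA k m wn) → Γ.ModifiedBGA k m wn → Prop
  /-- `μ(b aₙ, a_{n-1}, …, a₁) = b` for a disc sequence `a₁, …, aₙ` and a path `b` with
  `b aₙ ≠ 0` -/
  | last (L : List (Γ.H × ℕ)) (g : Γ.H) (ℓ ℓb : ℕ) (hL : κ.IsDiscSequence (L ++ [(g, ℓ)]))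
      (hb : ℓ + ℓb ≤ Γ.maxLength m g) :
      SpecialValue arrowDeg wn
        (L.map (fun a => ModifiedBGA.path k m wn a.1 a.2) ++
          [ModifiedBGA.path k m wn g (ℓ + ℓb)])
        (ModifiedBGA.path k m wn ((Γ.ρ)^[ℓ] g) ℓb)
  /-- `μ(aₙ, …, a₂, a₁ b) = (-1)^|b| b` for a disc sequence `a₁, …, aₙ` and a path `b` with
  `a₁ b ≠ 0` -/
  | first (L : List (Γ.H × ℕ)) (g h : Γ.H) (ℓ ℓb : ℕ) (hL : κ.IsDiscSequence ((g, ℓ) :: L))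
      (hg : (Γ.ρ)^[ℓb] h = g) (hb : ℓb + ℓ ≤ Γ.maxLength m h) :
      SpecialValue arrowDeg wn
        (ModifiedBGA.path k m wn h (ℓb + ℓ) ::
          L.map (fun a => ModifiedBGA.path k m wn a.1 a.2))
        ((pathDeg arrowDeg h ℓb).negOnePow • ModifiedBGA.path k m wn h ℓb)
  /-- `μ(aₙ, …, a_{r+1}, a_r (b a_r)^*, b a_r, a_{r-1}, …, a₂) = (-1)^∘ a₁^*` for a disc sequence
  `a₁, …, aₙ`, an index `1 < r ≤ n` and a path `b` with `b a_r ≠ 0`, where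
  `∘ = |a₁| + ⋯ + |a_{r-1}| + |b a_r| + ω(δ₂) + ⋯ + ω(δ_r)`, and where `a_i` starts at `δ_i`. The path
  `a^*` is the one for which `a a^*` is a path of maximal length -/
  | middle (L₁ L₂ : List (Γ.H × ℕ)) (g₁ g : Γ.H) (ℓ₁ ℓ ℓb : ℕ)
      (hL : κ.IsDiscSequence ((g₁, ℓ₁) :: L₁ ++ (g, ℓ) :: L₂))
      (hb : ℓ + ℓb ≤ Γ.maxLength m g) :
      SpecialValue arrowDeg wn
        (L₁.map (fun a => ModifiedBGA.path k m wn a.1 a.2) ++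
          ModifiedBGA.path k m wn g (ℓ + ℓb) ::
          ModifiedBGA.path k m wn ((Γ.ρ)^[ℓ + ℓb] g) (Γ.maxLength m g - ℓb) ::
          L₂.map (fun a => ModifiedBGA.path k m wn a.1 a.2))
        ((pathDeg arrowDeg g₁ ℓ₁ + (L₁.map fun a => pathDeg arrowDeg a.1 a.2).sum +
            pathDeg arrowDeg g (ℓ + ℓb) + (L₁.map fun a => wn (Γ.edge a.1)).sum +
            wn (Γ.edge g)).negOnePow •
          ModifiedBGA.path k m wn ((Γ.ρ)^[ℓ₁] g₁) (Γ.maxLength m g₁ - ℓ₁))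

variable {κ} {η : LineField κ.punctures} (𝔤 : κ.Grading η)

/-- The Brauer graph category of the graded arc system `(κ, 𝔤)` and the multiplicity function `m`. The
degrees of arrows, winding numbers and operations are subject to their
defining properties, which determine the operations completely. -/
structure BrauerGraphCategory where
  /-- the degrees of the arrows of the quiver of `Γ` -/
  arrowDeg : Γ.H → ℤ
  arrowDeg_spec : ∀ h, 𝔤.IsArrowDegree h (arrowDeg h)
  /-- the winding numbers of the arcs, with respect to some choice of directions -/
  winding : Γ.Edge → ℤ
  winding_spec : ∀ γ, ∃ h, Γ.edge h = γ ∧ 𝔤.HasWinding h (winding γ)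
  /-- the operations -/
  μ : ∀ {γ δ : Γ.Edge}, (Γ.brauerQuiver k m arrowDeg winding).Seq γ δ →
    ModifiedBGA.homSpace k m winding γ δ
  multilinear : GradedQuiver.IsMultilinear μ
  μ_nil : ∀ γ, μ (.nil γ) = 0
  μ_single : ∀ {γ δ} (a : (Γ.brauerQuiver k m arrowDeg winding).HomogHom γ δ), μ (.single a) = 0
  /-- `μ²(b, a) = (-1)^|a| b a` -/
  μ_pair : ∀ {γ δ ε} (a : (Γ.brauerQuiver k m arrowDeg winding).HomogHom γ δ)
    (b : (Γ.brauerQuiver k m arrowDeg winding).HomogHom δ ε),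
    (μ (.pair a b) : Γ.ModifiedBGA k m winding) =
      a.deg.negOnePow • ((b.val : Γ.ModifiedBGA k m winding) * a.val)
  /-- the special higher operations -/
  μ_special : ∀ {γ δ} (p : (Γ.brauerQuiver k m arrowDeg winding).Seq γ δ)
    (v : Γ.ModifiedBGA k m winding), 3 ≤ p.length →
    SpecialValue k m κ arrowDeg winding (entries p) v →
      (μ p : Γ.ModifiedBGA k m winding) = v
  /-- higher operations vanish on all other sequences of paths, i.e. those which are not, up to
  signs of their entries, among the special ones -/
  μ_other : ∀ {γ δ} (p : (Γ.brauerQuiver k m arrowDeg winding).Seq γ δ), 3 ≤ p.length →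
    (∀ x ∈ entries p, ∃ (h : Γ.H) (ℓ : ℕ), ℓ ≤ Γ.maxLength m h ∧
      x = ModifiedBGA.path k m winding h ℓ) →
    (¬ ∃ L v, List.Forall₂ (fun x y => x = y ∨ x = -y) (entries p) L ∧
      SpecialValue k m κ arrowDeg winding L v) → μ p = 0

/-- The data of the `A_∞`-category. -/
def BrauerGraphCategory.data (𝔹 : BrauerGraphCategory k m 𝔤) : AInfData.{u, v, max u v} k where
  toGradedQuiver := Γ.brauerQuiver k m 𝔹.arrowDeg 𝔹.winding
  one γ := ⟨ModifiedBGA.e k m 𝔹.winding γ,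
    ModifiedBGA.e_mul_e k m 𝔹.winding γ, ModifiedBGA.e_mul_e k m 𝔹.winding γ⟩
  μ := 𝔹.μ

end RibbonGraph

end

/-! Everything that could make the Brauer graph category complicated vanishes for this surface and
this grading. An immersed disc bounded by arcs would have to spill into one of the collars of the
boundary. Inside a collar its image is open and closed, so it would run along a whole collar line
and reach a boundary point, where no disc with invertible derivative can go. If it stays on the
graph instead, an open set would lie in a finite union of smooth curves, which has Hausdorff
dimension at most one. So there are no disc sequences (`IsFilling.not_hasMarkedDisc`), and no
operations with three or more arguments. The angles of the grading lie in the single interval from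
`-π` to `0`, so all degrees and winding numbers are zero (`hasDegree_eq_zero`, `winding_eq_zero`).
Existence of the degrees still requires actual crossings with small circles, which
`exists_first_crossing` supplies.

What remains is `B` itself: `e_δ B e_γ` in degree zero with multiplication. Left multiplication
identifies this space with the maps from `P_γ` to `P_δ` (`homEquiv`), which gives the strict
isomorphism. The structure of the `P_γ` comes from the filtration by path length. Its positive part
is nilpotent, and each corner `e_γ B e_γ` is local, with a character as residue map
(`exists_mul_eq_e`).

For twisted complexes only a `LinearModel` is used: a category in degree zero, fully faithful in a
linear category `C`. A twisted complex becomes the biproduct of its summands with an endomorphism of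
square zero, and morphisms become matrices. Up to signs this is a dg category, so the
`A_∞`-relations reduce to square zero, Leibniz and associativity (`DGModel.rel`). Grouping summands
by their shifts turns homogeneous matrices into cochains of the Hom complex of cochain complexes
(`cochain_injective`, `cochain_surjective`, `δ_cochain`). Hence closed morphisms modulo boundaries
are chain maps modulo homotopy (`homotopy_iff`), and the functor to the homotopy category is fully
faithful. It is exact by an explicit comparison with the mapping cone (`isIso_coneLift`). It reaches
every perfect complex because finitely generated projectives are sums of the `P_γ`
(`exists_equiv_pi`), and ordering summands by degree makes any differential strictly triangular
(`exists_complex_iso`). -/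

noncomputable section

/-! ## Paths in modified Brauer graph algebras -/

namespace PathAlgebra

variable (k : Type u) [Field k] {Q₀ : Type v} {Q₁ : Type v} [Fintype Q₀] (src tgt : Q₁ → Q₀)

/-- The projection from the free algebra. -/
def ofFree : FreeAlgebra k (Q₀ ⊕ Q₁) →ₐ[k] PathAlgebra k src tgt :=
  RingQuot.mkAlgHom k (PathAlgebraRel k src tgt)

variable {k src tgt}

lemma ofFree_surjective : Function.Surjective (ofFree k src tgt) :=
  RingQuot.mkAlgHom_surjective k _

lemma ofFree_rel {x y : FreeAlgebra k (Q₀ ⊕ Q₁)} (h : PathAlgebraRel k src tgt x y) :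
    ofFree k src tgt x = ofFree k src tgt y := RingQuot.mkAlgHom_rel k h

lemma ofFree_vertex (i : Q₀) :
    ofFree k src tgt (.ι k (.inl i)) = vertex k src tgt i := rfl

lemma ofFree_arrow (a : Q₁) :
    ofFree k src tgt (.ι k (.inr a)) = arrow k src tgt a := rfl

lemma vertex_mul_vertex_of_ne {i j : Q₀} (h : i ≠ j) :
    vertex k src tgt i * vertex k src tgt j = 0 := by
  rw [← ofFree_vertex, ← ofFree_vertex, ← map_mul, ofFree_rel (.orth i j h), map_zero]

lemma sum_vertex : ∑ i, vertex k src tgt i = 1 := by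
  simp only [← ofFree_vertex]
  rw [← map_sum, ofFree_rel .one, map_one]

lemma vertex_mul_arrow (a : Q₁) :
    vertex k src tgt (tgt a) * arrow k src tgt a = arrow k src tgt a := by
  rw [← ofFree_vertex, ← ofFree_arrow, ← map_mul, ofFree_rel (.tgt a)]

lemma arrow_mul_vertex (a : Q₁) :
    arrow k src tgt a * vertex k src tgt (src a) = arrow k src tgt a := by
  rw [← ofFree_vertex, ← ofFree_arrow, ← map_mul, ofFree_rel (.src a)]

end PathAlgebra

namespace RibbonGraph

variable {k : Type u} [Field k] {Γ : RibbonGraph.{v}}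

lemma edge_surjective : Function.Surjective Γ.edge := Quotient.mk_surjective

lemma edge_eq_iff {g h : Γ.H} : Γ.edge g = Γ.edge h ↔ h = g ∨ h = Γ.ι g :=
  ⟨fun e => Quotient.exact e, fun e => Quotient.sound e⟩

lemma edge_ι (h : Γ.H) : Γ.edge (Γ.ι h) = Γ.edge h :=
  (edge_eq_iff.2 (Or.inr rfl)).symm

lemma val_eq_of_s_eq {g h : Γ.H} (hs : Γ.s g = Γ.s h) : Γ.val g = Γ.val h := by
  rw [val, val, hs]

lemma val_pos (h : Γ.H) : 0 < Γ.val h :=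
  have : Nonempty {h' : Γ.H // Γ.s h' = Γ.s h} := ⟨⟨h, rfl⟩⟩
  Nat.card_pos

lemma maxLength_pos (m : Γ.V → ℕ+) (h : Γ.H) : 0 < Γ.maxLength m h :=
  Nat.mul_pos (m _).pos (val_pos h)

/-- The fibre of `s` through `h` is the orbit of `h` under the powers of `ρ`: one inclusion is
`sameCycle`, the other is invariance of `s` under `ρ`. -/
lemma val_eq_minimalPeriod (h : Γ.H) : Γ.val h = Function.minimalPeriod Γ.ρ h := by
  have := Fintype.ofFinite (MulAction.orbit (Subgroup.zpowers Γ.ρ) h)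
  have h1 := MulAction.minimalPeriod_eq_card Γ.ρ h
  rw [← Nat.card_eq_fintype_card] at h1
  refine Eq.trans (Nat.card_congr (Equiv.subtypeEquivRight fun g => ?_)) h1.symm
  constructor
  · intro hg
    obtain ⟨i, hi⟩ := Γ.sameCycle h g hg.symm
    exact ⟨⟨Γ.ρ ^ i, i, rfl⟩, hi⟩
  · rintro ⟨⟨_, i, rfl⟩, rfl⟩
    change Γ.s ((Γ.ρ ^ i) h) = Γ.s h
    induction i using Int.induction_on with
    | zero => rfl
    | succ i ih => rwa [add_comm, zpow_add, zpow_one, Equiv.Perm.mul_apply, Γ.s_ρ]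
    | pred i ih =>
      rwa [← Γ.s_ρ, ← Equiv.Perm.mul_apply, ← zpow_one_add, add_sub_cancel]

lemma iterate_val (h : Γ.H) : Γ.ρ^[Γ.val h] h = h := by
  rw [val_eq_minimalPeriod]
  exact Function.isPeriodicPt_minimalPeriod _ _

lemma iterate_val_mul (h : Γ.H) (n : ℕ) : Γ.ρ^[n * Γ.val h] h = h := by
  rw [mul_comm, Function.iterate_mul]
  exact Function.iterate_fixed (iterate_val h) n

lemma iterate_maxLength (m : Γ.V → ℕ+) (h : Γ.H) : Γ.ρ^[Γ.maxLength m h] h = h :=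
  iterate_val_mul h _

/-- An upper bound for the lengths of the paths around all vertices. -/
def lengthBound (m : Γ.V → ℕ+) : ℕ :=
  letI := Fintype.ofFinite Γ.H
  ∑ h, Γ.maxLength m h

namespace ModifiedBGA

variable (k) (m : Γ.V → ℕ+) (wn : Γ.Edge → ℤ)

lemma proj_surjective : Function.Surjective (proj (Γ := Γ) k m wn) :=
  RingQuot.mkAlgHom_surjective k _

lemma e_mul_e_of_ne {γ δ : Γ.Edge} (h : γ ≠ δ) : e k m wn γ * e k m wn δ = 0 := by
  rw [e, e, ← map_mul, PathAlgebra.vertex_mul_vertex_of_ne h, map_zero]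

lemma sum_e : ∑ γ, e (Γ := Γ) k m wn γ = 1 := by
  simp only [e]
  rw [← map_sum, PathAlgebra.sum_vertex, map_one]

/-- The class of the arrow `α_h`. -/
def α (h : Γ.H) : Γ.ModifiedBGA k m wn := proj k m wn (Γ.arrow k h)

lemma e_mul_α (h : Γ.H) : e k m wn (Γ.edge (Γ.ρ h)) * α k m wn h = α k m wn h := by
  rw [e, α, ← map_mul, arrow,
    PathAlgebra.vertex_mul_arrow (tgt := fun h : Γ.H => Γ.edge (Γ.ρ h))]

lemma α_mul_e (h : Γ.H) : α k m wn h * e k m wn (Γ.edge h) = α k m wn h := by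
  rw [e, α, ← map_mul, arrow, PathAlgebra.arrow_mul_vertex]

lemma path_zero (h : Γ.H) : path k m wn h 0 = e k m wn (Γ.edge h) := rfl

lemma path_succ (h : Γ.H) (ℓ : ℕ) :
    path k m wn h (ℓ + 1) = α k m wn (Γ.ρ^[ℓ] h) * path k m wn h ℓ := rfl

lemma path_one (h : Γ.H) : path k m wn h 1 = α k m wn h := α_mul_e k m wn h

lemma e_mul_path (h : Γ.H) (ℓ : ℕ) :
    e k m wn (Γ.edge (Γ.ρ^[ℓ] h)) * path k m wn h ℓ = path k m wn h ℓ := by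
  cases ℓ with
  | zero => exact e_mul_e k m wn _
  | succ ℓ => rw [path_succ, ← mul_assoc, Function.iterate_succ_apply', e_mul_α]

lemma path_mul_e (h : Γ.H) (ℓ : ℕ) :
    path k m wn h ℓ * e k m wn (Γ.edge h) = path k m wn h ℓ := by
  induction ℓ with
  | zero => exact e_mul_e k m wn _
  | succ ℓ ih => rw [path_succ, mul_assoc, ih]

lemma e_mul_path_of_ne {γ : Γ.Edge} (h : Γ.H) (ℓ : ℕ) (hγ : γ ≠ Γ.edge (Γ.ρ^[ℓ] h)) :
    e k m wn γ * path k m wn h ℓ = 0 := by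
  rw [← e_mul_path, ← mul_assoc, e_mul_e_of_ne k m wn hγ, zero_mul]

lemma path_mul_e_of_ne {γ : Γ.Edge} (h : Γ.H) (ℓ : ℕ) (hγ : γ ≠ Γ.edge h) :
    path k m wn h ℓ * e k m wn γ = 0 := by
  rw [← path_mul_e, mul_assoc, e_mul_e_of_ne k m wn hγ.symm, mul_zero]

lemma path_mul_path (h : Γ.H) (a b : ℕ) :
    path k m wn (Γ.ρ^[b] h) a * path k m wn h b = path k m wn h (a + b) := by
  induction a with
  | zero => rw [zero_add, path_zero, e_mul_path]
  | succ a ih =>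
    rw [path_succ, mul_assoc, ih, ← Function.iterate_add_apply, Nat.add_right_comm, path_succ]

/-- Two different causes: composable arrows are killed by a defining relation, the others by
orthogonality of the idempotents between them. -/
lemma α_mul_α_of_ne {h g : Γ.H} (hg : h ≠ Γ.ρ g) : α k m wn h * α k m wn g = 0 := by
  by_cases he : Γ.edge h = Γ.edge (Γ.ρ g)
  · have := RingQuot.mkAlgHom_rel k
      (BrauerRel.zero (k := k) (m := m) (wn := wn) h g he (by rwa [Ne, Equiv.symm_apply_eq]))
    rwa [map_zero, map_mul] at this
  · rw [← α_mul_e, ← e_mul_α k m wn g, mul_assoc, ← mul_assoc (e k m wn _),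
      e_mul_e_of_ne k m wn he, zero_mul, mul_zero]

lemma α_mul_path_of_ne {h g : Γ.H} {b : ℕ} (hb : 0 < b) (hg : h ≠ Γ.ρ^[b] g) :
    α k m wn h * path k m wn g b = 0 := by
  obtain ⟨b, rfl⟩ := Nat.exists_eq_succ_of_ne_zero hb.ne'
  rw [Function.iterate_succ_apply'] at hg
  rw [Nat.succ_eq_add_one, path_succ, ← mul_assoc, α_mul_α_of_ne k m wn hg, zero_mul]

lemma path_mul_path_of_ne {h g : Γ.H} {a b : ℕ} (ha : 0 < a) (hb : 0 < b)
    (hg : h ≠ Γ.ρ^[b] g) : path k m wn h a * path k m wn g b = 0 := by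
  obtain ⟨a, rfl⟩ := Nat.exists_eq_succ_of_ne_zero ha.ne'
  have h1 := path_mul_path k m wn h a 1
  rw [path_one] at h1
  rw [Nat.succ_eq_add_one, ← h1, mul_assoc, α_mul_path_of_ne k m wn hb hg, mul_zero]

/-- The cycles in the relations are listed backwards along `ρ⁻¹`, while `path` grows forwards along
`ρ`; this translates between the two. The idempotent matters only for `n = 0`, where the empty
product is `1`. -/
lemma prod_α_mul_e (g : Γ.H) (n : ℕ) :
    ((List.range n).map fun i => α k m wn (Γ.ρ.symm^[i] (Γ.ρ.symm (Γ.ρ^[n] g)))).prod *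
      e k m wn (Γ.edge g) = path k m wn g n := by
  induction n with
  | zero => simp [path_zero]
  | succ n ih =>
    rw [List.range_succ_eq_map, List.map_cons, List.prod_cons, List.map_map, mul_assoc, path_succ,
      ← ih]
    simp only [Function.comp_def, Function.iterate_succ_apply', Function.iterate_zero, id,
      Equiv.symm_apply_apply, Nat.succ_eq_add_one]
    congr 6
    funext i
    rw [← Function.iterate_succ_apply' Γ.ρ.symm, ← Function.iterate_succ_apply Γ.ρ.symm]

lemma proj_cyc_mul_e (h : Γ.H) :
    proj k m wn (Γ.cyc k (Γ.ρ.symm h)) * e k m wn (Γ.edge h) = path k m wn h (Γ.val h) := by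
  rw [← prod_α_mul_e, iterate_val, cyc, map_list_prod, List.map_map,
    val_eq_of_s_eq (g := Γ.ρ.symm h) (h := h) (by rw [← Γ.s_ρ, Equiv.apply_symm_apply])]
  rfl

lemma proj_cyc_pow_mul_e (h : Γ.H) (n : ℕ) :
    proj k m wn (Γ.cyc k (Γ.ρ.symm h)) ^ n * e k m wn (Γ.edge h) =
      path k m wn h (n * Γ.val h) := by
  induction n with
  | zero => rw [pow_zero, one_mul, zero_mul, path_zero]
  | succ n ih =>
    have h1 := e_mul_path k m wn h (Γ.val h)
    rw [iterate_val] at h1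
    have h2 := path_mul_path k m wn h (n * Γ.val h) (Γ.val h)
    rw [iterate_val] at h2
    rw [pow_succ, mul_assoc, proj_cyc_mul_e, ← h1, ← mul_assoc, ih, h2, Nat.succ_mul]

/-- The two maximal paths which start at an edge agree up to sign. -/
lemma path_maxLength (h : Γ.H) :
    path k m wn h (Γ.maxLength m h) =
      (wn (Γ.edge h)).negOnePow • path k m wn (Γ.ι h) (Γ.maxLength m (Γ.ι h)) := by
  have h1 : proj k m wn (Γ.cyc k (Γ.ρ.symm h)) ^ (m (Γ.s h) : ℕ) =
      (wn (Γ.edge h)).negOnePow •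
        proj k m wn (Γ.cyc k (Γ.ρ.symm (Γ.ι h))) ^ (m (Γ.s (Γ.ι h)) : ℕ) := by
    have := RingQuot.mkAlgHom_rel k (BrauerRel.cycle (k := k) (m := m) (wn := wn) h)
    -- The sign is an integer unit and not a scalar of `k`, so the two signs are treated separately
    -- to move it through the projection.
    rcases Int.units_eq_one_or (wn (Γ.edge h)).negOnePow with hw | hw <;> rw [hw] at this ⊢
    · rw [one_smul] at this ⊢
      rwa [map_pow, map_pow] at this
    · rw [Units.neg_smul, one_smul] at this ⊢
      rwa [map_neg, map_pow, map_pow] at this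
  rw [maxLength, maxLength, ← proj_cyc_pow_mul_e, ← proj_cyc_pow_mul_e, h1, edge_ι,
    smul_mul_assoc]

/-- Up to sign the maximal path from `h` equals the one from `ι h`. The next arrow `α_h` does not
continue a path around the vertex of `ι h` which ends at `ι h`, because `ι` has no fixed points. -/
lemma path_maxLength_succ (h : Γ.H) : path k m wn h (Γ.maxLength m h + 1) = 0 := by
  rw [path_succ, iterate_maxLength, path_maxLength, mul_smul_comm,
    α_mul_path_of_ne k m wn (maxLength_pos m _), smul_zero]
  rw [iterate_maxLength]
  exact (Γ.ι_ne h).symm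

lemma path_eq_zero {h : Γ.H} {ℓ : ℕ} (hℓ : Γ.maxLength m h < ℓ) : path k m wn h ℓ = 0 := by
  obtain ⟨a, rfl⟩ := Nat.exists_eq_add_of_lt hℓ
  rw [show Γ.maxLength m h + a + 1 = a + (Γ.maxLength m h + 1) by ring, ← path_mul_path,
    path_maxLength_succ, mul_zero]

/-- The span of the paths of length at least `n`. -/
def pathSpan (n : ℕ) : Submodule k (Γ.ModifiedBGA k m wn) :=
  Submodule.span k {x | ∃ h ℓ, n ≤ ℓ ∧ x = path k m wn h ℓ}

variable {k m wn}

lemma path_mem_pathSpan {n ℓ : ℕ} (hn : n ≤ ℓ) (h : Γ.H) :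
    path k m wn h ℓ ∈ pathSpan k m wn n := Submodule.subset_span ⟨h, ℓ, hn, rfl⟩

/-- The spans form a multiplicative filtration since a product of two paths is zero or a path whose
length is the sum of the lengths. -/
lemma mul_mem_pathSpan {a b : ℕ} {x y : Γ.ModifiedBGA k m wn} (hx : x ∈ pathSpan k m wn a)
    (hy : y ∈ pathSpan k m wn b) : x * y ∈ pathSpan k m wn (a + b) := by
  have key : pathSpan k m wn a * pathSpan k m wn b ≤ pathSpan k m wn (a + b) := by
    rw [pathSpan, pathSpan, Submodule.span_mul_span, Submodule.span_le]
    rintro _ ⟨_, ⟨h, ℓ, hℓ, rfl⟩, _, ⟨g, n, hn, rfl⟩, rfl⟩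
    change path k m wn h ℓ * path k m wn g n ∈ pathSpan k m wn (a + b)
    -- A trivial path remembers only its edge and not the half-edge, so the criterion for a nonzero
    -- product differs when a length is zero.
    rcases Nat.eq_zero_or_pos ℓ with rfl | hℓ0
    · obtain rfl : a = 0 := by omega
      rw [path_zero, zero_add]
      by_cases hh : Γ.edge h = Γ.edge (Γ.ρ^[n] g)
      · rw [hh, e_mul_path]
        exact path_mem_pathSpan hn _
      · rw [e_mul_path_of_ne k m wn _ _ hh]
        exact zero_mem _
    rcases Nat.eq_zero_or_pos n with rfl | hn0
    · obtain rfl : b = 0 := by omega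
      rw [path_zero, add_zero]
      by_cases hh : Γ.edge g = Γ.edge h
      · rw [hh, path_mul_e]
        exact path_mem_pathSpan hℓ _
      · rw [path_mul_e_of_ne k m wn _ _ hh]
        exact zero_mem _
    by_cases hh : h = Γ.ρ^[n] g
    · rw [hh, path_mul_path]
      exact path_mem_pathSpan (by omega) _
    · rw [path_mul_path_of_ne k m wn hℓ0 hn0 hh]
      exact zero_mem _
  exact key (Submodule.mul_mem_mul hx hy)

lemma e_mem_pathSpan (γ : Γ.Edge) : e k m wn γ ∈ pathSpan k m wn 0 := by
  obtain ⟨h, rfl⟩ := edge_surjective γ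
  exact path_mem_pathSpan (ℓ := 0) le_rfl h

lemma one_mem_pathSpan : (1 : Γ.ModifiedBGA k m wn) ∈ pathSpan k m wn 0 := by
  rw [← sum_e]
  exact sum_mem fun γ _ => e_mem_pathSpan γ

/-- The algebra is spanned by the paths. -/
lemma pathSpan_zero : pathSpan k m wn 0 = ⊤ := by
  rw [eq_top_iff]
  rintro x -
  obtain ⟨x, rfl⟩ := proj_surjective k m wn x
  obtain ⟨x, rfl⟩ := PathAlgebra.ofFree_surjective x
  rw [← AlgHom.comp_apply]
  induction x using FreeAlgebra.induction with
  | grade0 r =>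
    rw [AlgHom.commutes, Algebra.algebraMap_eq_smul_one]
    exact Submodule.smul_mem _ _ one_mem_pathSpan
  | grade1 i =>
    rcases i with γ | h
    · rw [AlgHom.comp_apply, PathAlgebra.ofFree_vertex]
      have : e k m wn γ ∈ pathSpan k m wn 0 := e_mem_pathSpan γ
      rwa [e] at this
    · rw [AlgHom.comp_apply, PathAlgebra.ofFree_arrow]
      have : α k m wn h ∈ pathSpan k m wn 0 := by
        rw [← path_one]
        exact path_mem_pathSpan (Nat.zero_le _) h
      rwa [α, arrow] at this
  | mul a b ha hb =>
    rw [map_mul]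
    exact mul_mem_pathSpan (a := 0) (b := 0) ha hb
  | add a b ha hb =>
    rw [map_add]
    exact add_mem ha hb

lemma mem_pathSpan_zero (x : Γ.ModifiedBGA k m wn) : x ∈ pathSpan k m wn 0 := by
  rw [pathSpan_zero]
  exact Submodule.mem_top

/-- Nilpotency of the ideal of arrows. It makes geometric series finite in the corner rings and
Nakayama's lemma elementary. -/
lemma pathSpan_eq_bot {n : ℕ} (hn : lengthBound m < n) : pathSpan k m wn n = ⊥ := by
  rw [pathSpan, Submodule.span_eq_bot]
  rintro _ ⟨h, ℓ, hℓ, rfl⟩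
  let := Fintype.ofFinite Γ.H
  refine path_eq_zero k m wn (lt_of_le_of_lt ?_ (hn.trans_le hℓ))
  exact Finset.single_le_sum (f := fun h => Γ.maxLength m h) (fun _ _ => Nat.zero_le _)
    (Finset.mem_univ h)

instance : Module.Finite k (Γ.ModifiedBGA k m wn) := by
  refine ⟨(Submodule.fg_def).2 ⟨Set.range fun p : Γ.H × Fin (lengthBound m + 1) =>
    path k m wn p.1 p.2, Set.finite_range _, ?_⟩⟩
  rw [eq_top_iff, ← pathSpan_zero, pathSpan, Submodule.span_le]
  rintro _ ⟨h, ℓ, -, rfl⟩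
  by_cases hℓ : ℓ < lengthBound m + 1
  · exact Submodule.subset_span ⟨(h, ⟨ℓ, hℓ⟩), rfl⟩
  · have h1 : path k m wn h ℓ ∈ pathSpan k m wn ℓ := path_mem_pathSpan le_rfl h
    rw [pathSpan_eq_bot (by omega), Submodule.mem_bot] at h1
    rw [h1]
    exact zero_mem _

/-! ### The characters of the algebra and the corner rings -/

variable (k m wn) in
open Classical in
/-- The character of the path algebra which is supported at the edge `γ`. -/
def pathCharacter (γ : Γ.Edge) : Γ.QuiverAlgebra k →ₐ[k] k :=
  RingQuot.liftAlgHom k ⟨FreeAlgebra.lift k (Sum.elim (fun δ => if δ = γ then 1 else 0) 0), by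
    intro x y hxy
    cases hxy with
    | idem i => simp
    | orth i j h =>
      simp only [map_mul, FreeAlgebra.lift_ι_apply, Sum.elim_inl, map_zero]
      grind
    | one => simp
    | tgt a => simp
    | src a => simp⟩

open Classical in
lemma pathCharacter_vertex (γ δ : Γ.Edge) :
    pathCharacter k γ (PathAlgebra.vertex k _ _ δ) = if δ = γ then 1 else 0 := by
  rw [pathCharacter, PathAlgebra.vertex]
  erw [RingQuot.liftAlgHom_mkAlgHom_apply]
  simp

lemma pathCharacter_arrow (γ : Γ.Edge) (h : Γ.H) : pathCharacter k γ (Γ.arrow k h) = 0 := by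
  rw [pathCharacter, arrow, PathAlgebra.arrow]
  erw [RingQuot.liftAlgHom_mkAlgHom_apply]
  simp

/-- A valency is positive, so the product contains at least one arrow. -/
lemma pathCharacter_cyc (γ : Γ.Edge) (h : Γ.H) : pathCharacter k γ (Γ.cyc k h) = 0 := by
  obtain ⟨n, hn⟩ := Nat.exists_eq_succ_of_ne_zero (val_pos h).ne'
  rw [cyc, map_list_prod, List.map_map, hn, List.range_succ_eq_map, List.map_cons, List.prod_cons]
  simp [pathCharacter_arrow]

variable (k m wn) in
/-- The character of the algebra which is supported at the edge `γ`. -/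
def character (γ : Γ.Edge) : Γ.ModifiedBGA k m wn →ₐ[k] k :=
  RingQuot.liftAlgHom k ⟨pathCharacter k γ, by
    intro x y hxy
    cases hxy with
    | zero h g hc hg => rw [map_mul, pathCharacter_arrow, zero_mul, map_zero]
    | cycle h =>
      -- Both sides of the relation go to zero, as the multiplicities are at least one.
      rw [map_pow, pathCharacter_cyc, zero_pow (m _).ne_zero]
      rcases Int.units_eq_one_or (wn (Γ.edge h)).negOnePow with hw | hw <;> rw [hw]
      · rw [one_smul, map_pow, pathCharacter_cyc, zero_pow (m _).ne_zero]
      · rw [Units.neg_smul, one_smul, map_neg, map_pow, pathCharacter_cyc,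
          zero_pow (m _).ne_zero, neg_zero]⟩

lemma character_proj (γ : Γ.Edge) (x : Γ.QuiverAlgebra k) :
    character k m wn γ (proj k m wn x) = pathCharacter k γ x :=
  RingQuot.liftAlgHom_mkAlgHom_apply ..

lemma character_e_self (γ : Γ.Edge) : character k m wn γ (e k m wn γ) = 1 := by
  rw [e, character_proj, pathCharacter_vertex, if_pos rfl]

lemma character_e_of_ne {γ δ : Γ.Edge} (h : δ ≠ γ) : character k m wn γ (e k m wn δ) = 0 := by
  rw [e, character_proj, pathCharacter_vertex, if_neg h]

lemma e_ne_zero (γ : Γ.Edge) : e k m wn γ ≠ 0 := by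
  intro h
  have := character_e_self (k := k) (m := m) (wn := wn) γ
  rw [h, map_zero] at this
  exact zero_ne_one this

lemma character_α (γ : Γ.Edge) (h : Γ.H) : character k m wn γ (α k m wn h) = 0 := by
  rw [α, character_proj, pathCharacter_arrow]

lemma character_path (γ : Γ.Edge) (h : Γ.H) {ℓ : ℕ} (hℓ : 0 < ℓ) :
    character k m wn γ (path k m wn h ℓ) = 0 := by
  obtain ⟨ℓ, rfl⟩ := Nat.exists_eq_succ_of_ne_zero hℓ.ne'
  rw [Nat.succ_eq_add_one, path_succ, map_mul, character_α, zero_mul]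

/-- Every element is a combination of idempotents up to paths of positive length. -/
lemma sub_sum_character_mem (x : Γ.ModifiedBGA k m wn) :
    x - ∑ γ, character k m wn γ x • e k m wn γ ∈ pathSpan k m wn 1 := by
  have hx : x ∈ pathSpan k m wn 0 := mem_pathSpan_zero x
  induction hx using Submodule.span_induction with
  | mem x hx =>
    obtain ⟨h, ℓ, -, rfl⟩ := hx
    rcases Nat.eq_zero_or_pos ℓ with rfl | hℓ
    · rw [path_zero, Finset.sum_eq_single (Γ.edge h), character_e_self, one_smul, sub_self]
      · exact zero_mem _
      · intro γ _ hγ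
        rw [character_e_of_ne hγ.symm, zero_smul]
      · exact fun h => absurd (Finset.mem_univ _) h
    · simp only [character_path _ h hℓ, zero_smul, Finset.sum_const_zero, sub_zero]
      exact path_mem_pathSpan hℓ h
  | zero => simp
  | add x y _ _ hx hy =>
    simp only [map_add, add_smul, Finset.sum_add_distrib]
    rw [add_sub_add_comm]
    exact add_mem hx hy
  | smul c x _ hx =>
    simp only [map_smul, smul_eq_mul, mul_smul, ← Finset.smul_sum]
    rw [← smul_sub]
    exact Submodule.smul_mem _ _ hx

/-- The characters jointly detect the ideal of arrows, which will play the role of the radical. -/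
lemma mem_pathSpan_one {x : Γ.ModifiedBGA k m wn} (hx : ∀ γ, character k m wn γ x = 0) :
    x ∈ pathSpan k m wn 1 := by
  have := sub_sum_character_mem x
  simpa [hx] using this

lemma pow_mem_pathSpan {x : Γ.ModifiedBGA k m wn} (hx : x ∈ pathSpan k m wn 1) (n : ℕ) :
    x ^ n ∈ pathSpan k m wn n := by
  induction n with
  | zero => rw [pow_zero]; exact one_mem_pathSpan
  | succ n ih => rw [pow_succ]; exact mul_mem_pathSpan ih hx

/-- The corner rings are local: an element with nonzero character is invertible. -/
lemma exists_mul_eq_e {γ : Γ.Edge} {x : Γ.ModifiedBGA k m wn} (hx1 : e k m wn γ * x = x)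
    (hx2 : x * e k m wn γ = x) (hx : character k m wn γ x ≠ 0) :
    ∃ y, e k m wn γ * y = y ∧ y * e k m wn γ = y ∧ x * y = e k m wn γ ∧
      y * x = e k m wn γ := by
  set c := character k m wn γ x
  set E := e k m wn γ
  have hE : E * E = E := e_mul_e k m wn γ
  -- After normalization `x` differs from the unit `E` of the corner by an element with vanishing
  -- characters, hence by a nilpotent one.
  have hn : E - c⁻¹ • x ∈ pathSpan k m wn 1 := by
    refine mem_pathSpan_one fun δ => ?_
    by_cases hδ : γ = δ
    · subst hδ
      rw [map_sub, map_smul, character_e_self]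
      change 1 - c⁻¹ • c = 0
      rw [smul_eq_mul, inv_mul_cancel₀ hx, sub_self]
    · rw [← hx1, map_sub, map_smul, map_mul, character_e_of_ne hδ, zero_mul, smul_zero, sub_zero]
  have hnil : (E - c⁻¹ • x) ^ (lengthBound m + 1) = 0 := by
    have := pow_mem_pathSpan hn (lengthBound m + 1)
    rwa [pathSpan_eq_bot (Nat.lt_succ_self _), Submodule.mem_bot] at this
  set n := E - c⁻¹ • x
  have hEn : E * n = n := by rw [mul_sub, hE, mul_smul_comm, hx1]
  have hnE : n * E = n := by rw [sub_mul, hE, smul_mul_assoc, hx2]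
  have hxn : x = c • (E * (1 - n)) := by
    rw [mul_sub, mul_one, hEn, sub_sub_cancel, smul_smul, mul_inv_cancel₀ hx, one_smul]
  have hxn' : x = c • ((1 - n) * E) := by
    rw [sub_mul, one_mul, hnE, sub_sub_cancel, smul_smul, mul_inv_cancel₀ hx, one_smul]
  -- The finite geometric series inverts `1 - n` in the whole algebra; compressing it by `E` on both
  -- sides gives the inverse in the corner.
  set S := ∑ i ∈ Finset.range (lengthBound m + 1), n ^ i with hS
  have h1 : (1 - n) * S = 1 := by rw [mul_neg_geom_sum, hnil, sub_zero]
  have h2 : S * (1 - n) = 1 := by rw [geom_sum_mul_neg, hnil, sub_zero]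
  refine ⟨c⁻¹ • (E * S * E), ?_, ?_, ?_, ?_⟩
  · rw [mul_smul_comm, ← mul_assoc, ← mul_assoc, hE]
  · rw [smul_mul_assoc, mul_assoc, hE]
  · rw [mul_smul_comm, ← mul_assoc, ← mul_assoc, hx2, hxn, smul_mul_assoc, smul_mul_assoc,
      smul_smul, inv_mul_cancel₀ hx, one_smul, mul_assoc E, h1, mul_one, hE]
  · rw [smul_mul_assoc, mul_assoc, hx1, hxn', mul_smul_comm, smul_smul, inv_mul_cancel₀ hx,
      one_smul, mul_assoc, ← mul_assoc S, h2, one_mul, hE]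

/-- `e_δ B e_γ` is spanned by the paths from `γ` to `δ`. -/
lemma homSpace_le_span (γ δ : Γ.Edge) :
    homSpace k m wn γ δ ≤ Submodule.span k {x | ∃ (h : Γ.H) (ℓ : ℕ), ℓ ≤ Γ.maxLength m h ∧
      Γ.edge h = γ ∧ Γ.edge (Γ.ρ^[ℓ] h) = δ ∧ x = path k m wn h ℓ} := by
  rintro x ⟨hx1, hx2⟩
  have hx : x ∈ pathSpan k m wn 0 := mem_pathSpan_zero x
  rw [← hx2, ← hx1]
  clear hx1 hx2
  induction hx using Submodule.span_induction with
  | mem x hx =>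
    obtain ⟨h, ℓ, -, rfl⟩ := hx
    by_cases h1 : δ = Γ.edge (Γ.ρ^[ℓ] h)
    · rw [h1, e_mul_path]
      by_cases h2 : γ = Γ.edge h
      · rw [h2, path_mul_e]
        by_cases h3 : ℓ ≤ Γ.maxLength m h
        · exact Submodule.subset_span ⟨h, ℓ, h3, rfl, rfl, rfl⟩
        · rw [path_eq_zero k m wn (not_le.1 h3)]
          exact zero_mem _
      · rw [path_mul_e_of_ne k m wn _ _ h2]
        exact zero_mem _
    · rw [e_mul_path_of_ne k m wn _ _ h1, zero_mul]
      exact zero_mem _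
  | zero => simp
  | add x y _ _ hx hy =>
    rw [mul_add, add_mul]
    exact add_mem hx hy
  | smul c x _ hx =>
    rw [mul_smul_comm, smul_mul_assoc]
    exact Submodule.smul_mem _ _ hx

end ModifiedBGA

end RibbonGraph

/-! ## The indecomposable projective modules -/

namespace RibbonGraph.ModifiedBGA

variable {k : Type u} [Field k] {Γ : RibbonGraph.{v}} {m : Γ.V → ℕ+} {wn : Γ.Edge → ℤ}

lemma mem_P {γ : Γ.Edge} {x : Γ.ModifiedBGA k m wn} : x ∈ P k m wn γ ↔ e k m wn γ * x = x := by
  rw [P, Submodule.mem_span_singleton]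
  constructor
  · rintro ⟨a, rfl⟩
    rw [← MulOpposite.op_unop a, op_smul_eq_mul, ← mul_assoc, e_mul_e]
  · intro h
    exact ⟨MulOpposite.op x, by rw [op_smul_eq_mul, h]⟩

lemma e_mem_P (γ : Γ.Edge) : e k m wn γ ∈ P k m wn γ := mem_P.2 (e_mul_e k m wn γ)

variable (k m wn) in
/-- The generator `e_γ` of `P_γ`. -/
def gen (γ : Γ.Edge) : P k m wn γ := ⟨e k m wn γ, e_mem_P γ⟩

lemma op_smul_gen {γ : Γ.Edge} (x : P k m wn γ) :
    MulOpposite.op (x : Γ.ModifiedBGA k m wn) • gen k m wn γ = x :=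
  Subtype.ext (mem_P.1 x.2)

lemma mul_mem_P {γ : Γ.Edge} {x : Γ.ModifiedBGA k m wn} (hx : x ∈ P k m wn γ)
    (y : Γ.ModifiedBGA k m wn) : x * y ∈ P k m wn γ :=
  Submodule.smul_mem _ (MulOpposite.op y) hx

variable (k m wn) in
/-- Left multiplication by `e_γ`, as a projection to `P_γ`. -/
def toP (γ : Γ.Edge) : Γ.ModifiedBGA k m wn →ₗ[(Γ.ModifiedBGA k m wn)ᵐᵒᵖ] P k m wn γ where
  toFun x := ⟨e k m wn γ * x, mul_mem_P (e_mem_P γ) x⟩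
  map_add' x y := Subtype.ext (mul_add _ _ _)
  map_smul' a x := Subtype.ext (by
    rw [← MulOpposite.op_unop a]
    exact (mul_assoc _ _ _).symm)

lemma iSup_P : ⨆ γ, P (Γ := Γ) k m wn γ = ⊤ := by
  rw [eq_top_iff]
  rintro x -
  rw [← one_mul x, ← sum_e, Finset.sum_mul]
  exact sum_mem fun γ _ => Submodule.mem_iSup_of_mem γ (mul_mem_P (e_mem_P γ) x)

lemma iSupIndep_P : iSupIndep (P (Γ := Γ) k m wn) := by
  intro γ
  rw [Submodule.disjoint_def]
  intro x hx hx'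
  have h1 : ⨆ δ, ⨆ (_ : δ ≠ γ), P k m wn δ ≤ LinearMap.ker (toP k m wn γ) := by
    refine iSup₂_le fun δ hδ y hy => Subtype.ext ?_
    change e k m wn γ * y = 0
    rw [← mem_P.1 hy, ← mul_assoc, e_mul_e_of_ne k m wn hδ.symm, zero_mul]
  have h2 := congrArg Subtype.val (h1 hx')
  rw [← mem_P.1 hx]
  exact h2

instance (γ : Γ.Edge) : Module.Finite (Γ.ModifiedBGA k m wn)ᵐᵒᵖ (P k m wn γ) :=
  Module.Finite.of_surjective (LinearMap.toSpanSingleton _ _ (gen k m wn γ)) fun x =>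
    ⟨_, op_smul_gen x⟩

instance projective_P (γ : Γ.Edge) :
    Module.Projective (Γ.ModifiedBGA k m wn)ᵐᵒᵖ (P k m wn γ) := by
  let i : P k m wn γ →ₗ[(Γ.ModifiedBGA k m wn)ᵐᵒᵖ] (Γ.ModifiedBGA k m wn)ᵐᵒᵖ :=
    { toFun := fun x => MulOpposite.op x.1
      map_add' := fun x y => rfl
      map_smul' := fun a x => rfl }
  refine Module.Projective.of_split i (LinearMap.toSpanSingleton _ _ (gen k m wn γ)) ?_
  ext x
  exact congrArg Subtype.val (op_smul_gen x)

/-- Every `x` in `P_γ` equals `e_γ x`, so a homomorphism of right modules is left multiplication by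
the image of `e_γ`. This is where reading products from right to left fits with right modules. -/
lemma linearMap_apply {γ δ : Γ.Edge}
    (f : P k m wn γ →ₗ[(Γ.ModifiedBGA k m wn)ᵐᵒᵖ] P k m wn δ) (x : P k m wn γ) :
    (f x : Γ.ModifiedBGA k m wn) = f (gen k m wn γ) * x := by
  conv_lhs => rw [← op_smul_gen x, map_smul]
  rfl

lemma gen_mem_homSpace {γ δ : Γ.Edge}
    (f : P k m wn γ →ₗ[(Γ.ModifiedBGA k m wn)ᵐᵒᵖ] P k m wn δ) :
    (f (gen k m wn γ) : Γ.ModifiedBGA k m wn) ∈ homSpace k m wn γ δ :=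
  ⟨mem_P.1 (f _).2, (linearMap_apply f (gen k m wn γ)).symm⟩

variable (k m wn) in
/-- Morphisms between the modules `P_γ` are left multiplications. -/
def homEquiv (γ δ : Γ.Edge) : homSpace k m wn γ δ ≃ₗ[k]
    (P k m wn γ →ₗ[(Γ.ModifiedBGA k m wn)ᵐᵒᵖ] P k m wn δ) where
  toFun a :=
    { toFun := fun x => ⟨a.1 * x.1, mem_P.2 (by rw [← mul_assoc, a.2.1])⟩
      map_add' := fun x y => Subtype.ext (mul_add _ _ _)
      map_smul' := fun r x => Subtype.ext (by
        rw [← MulOpposite.op_unop r]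
        exact (mul_assoc _ _ _).symm) }
  map_add' a b := LinearMap.ext fun x => Subtype.ext (add_mul _ _ _)
  map_smul' c a := LinearMap.ext fun x => Subtype.ext (smul_mul_assoc _ _ _)
  invFun f := ⟨_, gen_mem_homSpace f⟩
  left_inv a := Subtype.ext a.2.2
  right_inv f := LinearMap.ext fun x => Subtype.ext (linearMap_apply f x).symm

lemma homEquiv_apply {γ δ : Γ.Edge} (a : homSpace k m wn γ δ) (x : P k m wn γ) :
    (homEquiv k m wn γ δ a x : Γ.ModifiedBGA k m wn) = a.1 * x.1 := rfl

/-- The compression `x e_γ` is a unit of the local ring `e_γ B e_γ`. Multiplying `x` on the right by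
an inverse produces the generator `e_γ` inside the submodule. -/
lemma eq_top_of_character_ne_zero {γ : Γ.Edge}
    {p : Submodule (Γ.ModifiedBGA k m wn)ᵐᵒᵖ (P k m wn γ)} {x : P k m wn γ} (hx : x ∈ p)
    (hx0 : character k m wn γ x ≠ 0) : p = ⊤ := by
  obtain ⟨y, -, -, hy, -⟩ := exists_mul_eq_e (k := k) (m := m) (wn := wn) (γ := γ)
    (x := x * e k m wn γ)
    (by rw [← mul_assoc, mem_P.1 x.2]) (by rw [mul_assoc, e_mul_e])
    (by rwa [map_mul, character_e_self, mul_one])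
  have h1 : gen k m wn γ ∈ p := by
    have := p.smul_mem (MulOpposite.op (e k m wn γ * y)) hx
    convert this using 1
    refine Subtype.ext ?_
    change e k m wn γ = x * (e k m wn γ * y)
    rw [← mul_assoc, hy]
  rw [eq_top_iff]
  rintro z -
  rw [← op_smul_gen z]
  exact p.smul_mem _ h1

/-- Split the generator along a decomposition. The characters of the two parts add up to `1`, so one
part is not in the kernel and already generates all of `P_γ`. -/
lemma isIndecomposableModule_P (γ : Γ.Edge) :
    IsIndecomposableModule (Γ.ModifiedBGA k m wn)ᵐᵒᵖ (P k m wn γ) := by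
  refine ⟨⟨gen k m wn γ, 0, fun h => e_ne_zero γ (congrArg Subtype.val h)⟩, fun p q hpq => ?_⟩
  obtain ⟨a, ha, b, hb, hab⟩ := Submodule.mem_sup.1
    (show gen k m wn γ ∈ p ⊔ q from hpq.sup_eq_top ▸ Submodule.mem_top)
  have h1 : character k m wn γ a + character k m wn γ b = 1 := by
    rw [← map_add, ← character_e_self (m := m) (wn := wn) γ]
    exact congrArg (character k m wn γ) (congrArg Subtype.val hab)
  by_cases h0 : character k m wn γ a = 0
  · left
    have : q = ⊤ := eq_top_of_character_ne_zero hb (by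
      rw [h0, zero_add] at h1
      rw [h1]
      exact one_ne_zero)
    have h2 := hpq.inf_eq_bot
    rwa [this, inf_top_eq] at h2
  · right
    have : p = ⊤ := eq_top_of_character_ne_zero ha h0
    have h2 := hpq.inf_eq_bot
    rwa [this, top_inf_eq] at h2

/-- An isomorphism and its inverse would write `e_γ` as a product with a factor in `e_δ B`. The
character at `γ` vanishes on that factor but is `1` on `e_γ`. -/
lemma isEmpty_P_equiv {γ δ : Γ.Edge} (h : γ ≠ δ) :
    IsEmpty (P k m wn γ ≃ₗ[(Γ.ModifiedBGA k m wn)ᵐᵒᵖ] P k m wn δ) := by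
  refine ⟨fun f => ?_⟩
  have h1 := linearMap_apply f.symm.toLinearMap (f (gen k m wn γ))
  have h2 := congrArg (character k m wn γ) h1
  have h3 : character k m wn γ (f (gen k m wn γ)).1 = 0 := by
    rw [← mem_P.1 (f (gen k m wn γ)).2, map_mul, character_e_of_ne h.symm, zero_mul]
  rw [map_mul, h3, mul_zero, LinearEquiv.coe_coe, LinearEquiv.symm_apply_apply] at h2
  exact one_ne_zero ((character_e_self γ).symm.trans h2)

/-! ### Finitely generated projective modules -/

section Projective

variable {Q : Type w} [AddCommGroup Q] [Module (Γ.ModifiedBGA k m wn)ᵐᵒᵖ Q]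

/-- The elements `∑ qᵢ xᵢ` with `xᵢ` a combination of paths of length at least `n`. -/
def radSpan (Q : Type w) [AddCommGroup Q] [Module (Γ.ModifiedBGA k m wn)ᵐᵒᵖ Q] (n : ℕ) :
    AddSubgroup Q :=
  AddSubgroup.closure {q | ∃ (q' : Q), ∃ x ∈ pathSpan k m wn n, q = MulOpposite.op x • q'}

lemma op_smul_mem_radSpan {a b : ℕ} {q : Q} (hq : q ∈ radSpan (k := k) (m := m) (wn := wn) Q a)
    {x : Γ.ModifiedBGA k m wn} (hx : x ∈ pathSpan k m wn b) :
    MulOpposite.op x • q ∈ radSpan (k := k) (m := m) (wn := wn) Q (a + b) := by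
  induction hq using AddSubgroup.closure_induction with
  | mem q hq =>
    obtain ⟨q', y, hy, rfl⟩ := hq
    refine AddSubgroup.subset_closure ⟨q', y * x, mul_mem_pathSpan hy hx, ?_⟩
    rw [smul_smul, MulOpposite.op_mul]
  | zero => rw [smul_zero]; exact zero_mem _
  | add q q' _ _ h h' => rw [smul_add]; exact add_mem h h'
  | neg q _ h => rw [smul_neg]; exact neg_mem h

/-- Nakayama's lemma for the ideal generated by the arrows. -/
lemma subsingleton_of_radSpan_eq_top
    (h : radSpan (k := k) (m := m) (wn := wn) Q 1 = ⊤) : Subsingleton Q := by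
  -- With `I` the ideal of arrows, `Q = Q I` iterates to `Q = Q Iⁿ`, which is zero for large `n`; no
  -- finiteness of `Q` is needed.
  have key : ∀ n, radSpan (k := k) (m := m) (wn := wn) Q n = ⊤ := by
    intro n
    induction n with
    | zero =>
      rw [eq_top_iff]
      rintro q -
      exact AddSubgroup.subset_closure ⟨q, 1, mem_pathSpan_zero 1, by simp⟩
    | succ n ih =>
      rw [eq_top_iff, ← h, radSpan, AddSubgroup.closure_le]
      rintro _ ⟨q, x, hx, rfl⟩
      exact op_smul_mem_radSpan (ih ▸ AddSubgroup.mem_top q) hx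
  have h0 : radSpan (k := k) (m := m) (wn := wn) Q (lengthBound m + 1) = ⊥ := by
    rw [radSpan, AddSubgroup.closure_eq_bot_iff]
    rintro _ ⟨q, x, hx, rfl⟩
    rw [pathSpan_eq_bot (Nat.lt_succ_self _), Submodule.mem_bot] at hx
    rw [hx, MulOpposite.op_zero, zero_smul]
    rfl
  rw [key] at h0
  exact AddSubgroup.subsingleton_iff.1 (subsingleton_of_bot_eq_top h0.symm)

variable (Q) in
/-- Every nonzero finitely generated projective module has a direct summand `P_γ`. -/
lemma exists_surjective_toP [Nontrivial Q] [Module.Projective (Γ.ModifiedBGA k m wn)ᵐᵒᵖ Q] :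
    ∃ (γ : Γ.Edge) (f : P k m wn γ →ₗ[(Γ.ModifiedBGA k m wn)ᵐᵒᵖ] Q)
      (g : Q →ₗ[(Γ.ModifiedBGA k m wn)ᵐᵒᵖ] P k m wn γ), g ∘ₗ f = LinearMap.id := by
  obtain ⟨q, hq⟩ : ∃ q, q ∉ radSpan (k := k) (m := m) (wn := wn) Q 1 := by
    by_contra! h
    exact not_subsingleton Q (subsingleton_of_radSpan_eq_top (eq_top_iff.2 fun q _ => h q))
  obtain ⟨γ, hγ⟩ : ∃ γ, MulOpposite.op (e k m wn γ) • q ∉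
      radSpan (k := k) (m := m) (wn := wn) Q 1 := by
    by_contra! h
    refine hq ?_
    rw [← one_smul (Γ.ModifiedBGA k m wn)ᵐᵒᵖ q, ← MulOpposite.op_one, ← sum_e,
      Finset.op_sum, Finset.sum_smul]
    exact sum_mem fun γ _ => h γ
  set q' := MulOpposite.op (e k m wn γ) • q with hq'
  have heq : MulOpposite.op (e k m wn γ) • q' = q' := by
    rw [hq', smul_smul, ← MulOpposite.op_mul, e_mul_e]
  obtain ⟨s, hs⟩ := Module.Projective.out (R := (Γ.ModifiedBGA k m wn)ᵐᵒᵖ) (P := Q)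
  -- `s` splits the free module on the elements of `Q`. If all coordinates of `q'` were in the ideal
  -- of arrows, then `q'`, as a combination of elements of `Q` with these coefficients, would be in
  -- its multiples.
  obtain ⟨p, hp⟩ : ∃ p, MulOpposite.unop (s q' p) ∉ pathSpan k m wn 1 := by
    by_contra! h
    refine hγ ?_
    rw [← hs q', Finsupp.linearCombination_apply]
    exact sum_mem fun p _ => AddSubgroup.subset_closure ⟨p, _, h p, rfl⟩
  let φ : Q →ₗ[(Γ.ModifiedBGA k m wn)ᵐᵒᵖ] Γ.ModifiedBGA k m wn :=
    { toFun := fun x => MulOpposite.unop (s x p)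
      map_add' := fun x y => by simp
      map_smul' := fun a x => by
        rw [map_smul]
        rfl }
  have hb : φ q' * e k m wn γ = φ q' := by
    conv_rhs => rw [← heq, map_smul]
    rfl
  obtain ⟨δ, hδ⟩ : ∃ δ, character k m wn δ (φ q') ≠ 0 := by
    by_contra! h
    exact hp (mem_pathSpan_one h)
  -- `φ q'` ends with the factor `e_γ` on the right, so only the character at `γ` can be nonzero on
  -- it.
  obtain rfl : γ = δ := by
    by_contra h
    rw [← hb, map_mul, character_e_of_ne h, mul_zero] at hδ
    exact hδ rfl
  -- `e_γ φ(q')` is a unit of the corner ring. Composing the coordinate `φ` with left multiplication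
  -- by its inverse `y` retracts the map `x ↦ q' x` from `P_γ`.
  obtain ⟨y, hy1, hy2, -, hy3⟩ := exists_mul_eq_e (k := k) (m := m) (wn := wn) (γ := γ)
    (x := e k m wn γ * φ q') (by rw [← mul_assoc, e_mul_e]) (by rw [mul_assoc, hb])
    (by rwa [map_mul, character_e_self, one_mul])
  let f : P k m wn γ →ₗ[(Γ.ModifiedBGA k m wn)ᵐᵒᵖ] Q :=
    { toFun := fun x => MulOpposite.op x.1 • q'
      map_add' := fun x y => add_smul (MulOpposite.op x.1) (MulOpposite.op y.1) q'
      map_smul' := fun a x => mul_smul a (MulOpposite.op x.1) q' }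
  refine ⟨γ, f, (homEquiv k m wn γ γ ⟨y, hy1, hy2⟩) ∘ₗ toP k m wn γ ∘ₗ φ, ?_⟩
  have hgen : f (gen k m wn γ) = q' := heq
  refine LinearMap.ext fun x => Subtype.ext ?_
  rw [linearMap_apply, LinearMap.comp_apply, hgen, LinearMap.comp_apply, homEquiv_apply]
  change y * (e k m wn γ * φ q') * x.1 = x.1
  rw [hy3, mem_P.1 x.2]

/-- Every finitely generated projective module is a direct sum of modules `P_γ`. -/
lemma exists_equiv_pi (n : ℕ) (Q : Type w) [AddCommGroup Q]
    [Module (Γ.ModifiedBGA k m wn)ᵐᵒᵖ Q] [Module k Q]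
    [IsScalarTower k (Γ.ModifiedBGA k m wn)ᵐᵒᵖ Q] [Module.Finite k Q]
    [Module.Projective (Γ.ModifiedBGA k m wn)ᵐᵒᵖ Q] (hn : Module.finrank k Q ≤ n) :
    ∃ (I : Type) (_ : Fintype I) (γ : I → Γ.Edge),
      Nonempty (Q ≃ₗ[(Γ.ModifiedBGA k m wn)ᵐᵒᵖ] ∀ i, P k m wn (γ i)) := by
  -- The induction is on a bound for the dimension over `k`; splitting off some `P_γ` lowers it
  -- because `e_γ` is nonzero.
  induction n generalizing Q with
  | zero =>
    have : Subsingleton Q := Module.finrank_zero_iff.1 (Nat.le_zero.1 hn)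
    exact ⟨Empty, inferInstance, Empty.elim, ⟨LinearEquiv.ofSubsingleton _ _⟩⟩
  | succ n ih =>
    rcases subsingleton_or_nontrivial Q with hQ | hQ
    · exact ⟨Empty, inferInstance, Empty.elim, ⟨LinearEquiv.ofSubsingleton _ _⟩⟩
    obtain ⟨γ, f, g, hgf⟩ := exists_surjective_toP (k := k) (m := m) (wn := wn) Q
    have hgf' : ∀ x, g (f x) = x := fun x => LinearMap.congr_fun hgf x
    -- The projection to the complement of the image of `f`; it shows that the kernel is again
    -- projective.
    let r : Q →ₗ[(Γ.ModifiedBGA k m wn)ᵐᵒᵖ] LinearMap.ker g :=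
      (LinearMap.id - f ∘ₗ g).codRestrict _ fun x => by simp [hgf']
    have hr : r ∘ₗ (LinearMap.ker g).subtype = LinearMap.id := by
      refine LinearMap.ext fun x => Subtype.ext ?_
      have : g x = 0 := x.2
      simp [r, this]
    have : Module.Projective (Γ.ModifiedBGA k m wn)ᵐᵒᵖ (LinearMap.ker g) :=
      Module.Projective.of_split _ _ hr
    have hlt : Module.finrank k (LinearMap.ker g) < Module.finrank k Q := by
      refine Submodule.finrank_lt (s := (LinearMap.ker g).restrictScalars k) fun h => ?_
      have h1 : f (gen k m wn γ) ∈ (LinearMap.ker g).restrictScalars k := h ▸ Submodule.mem_top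
      have h2 : g (f (gen k m wn γ)) = 0 := h1
      rw [hgf'] at h2
      exact e_ne_zero γ (congrArg Subtype.val h2)
    have : Module.Finite k (LinearMap.ker g) :=
      inferInstanceAs (Module.Finite k ((LinearMap.ker g).restrictScalars k))
    obtain ⟨I, _, γ', ⟨E⟩⟩ := ih (LinearMap.ker g) (by omega)
    refine ⟨Option I, inferInstance, fun o => o.elim γ γ', ⟨?_⟩⟩
    let E1 : Q ≃ₗ[(Γ.ModifiedBGA k m wn)ᵐᵒᵖ] P k m wn γ × LinearMap.ker g :=
      { g.prod r with
        invFun := fun x => f x.1 + x.2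
        left_inv := fun x => by simp [r]
        right_inv := fun x => by
          have h1 : r x.2 = x.2 := LinearMap.congr_fun hr x.2
          have h2 : g x.2 = 0 := x.2.2
          have h3 : r (f x.1) = 0 := Subtype.ext (by simp [r, hgf'])
          refine Prod.ext ?_ ?_
          · simp [hgf', h2]
          · simp [h1, h3] }
    exact E1.trans (((LinearEquiv.refl _ _).prodCongr E).trans
      (LinearEquiv.piOptionEquivProd _
        (M := fun o : Option I => P k m wn (o.elim γ γ'))).symm)

end Projective

end RibbonGraph.ModifiedBGA

/-! ## Immersed discs in the ribbon surface -/

section Immersions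

open Topology

variable {M : Type w} [TopologicalSpace M] [ChartedSpace (EuclideanHalfSpace 2) M]

/-- A nontrivial kernel would make `L 1` a real eigenvector of `J`, impossible as the square of a
real eigenvalue cannot be `-1`. This turns the orientation condition for discs and charts into
immersivity. -/
lemma injective_of_quarterTurn {E : Type*} [AddCommGroup E] [Module ℝ E] (L : ℂ →ₗ[ℝ] E)
    (J : E →ₗ[ℝ] E) (hJ : ∀ v, J (J v) = -v) (h1 : L 1 ≠ 0) {a b : ℝ} (hb : 0 < b)
    (hI : L Complex.I = a • L 1 + b • J (L 1)) : Function.Injective L := by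
  rw [← LinearMap.ker_eq_bot, LinearMap.ker_eq_bot']
  intro z hz
  have hz' : z = z.re • (1 : ℂ) + z.im • Complex.I := by
    simp [Complex.re_add_im]
  rw [hz', map_add, map_smul, map_smul, hI, smul_add, smul_smul, smul_smul, ← add_assoc,
    ← add_smul] at hz
  have h2 : z.im = 0 := by
    by_contra h
    set c := z.im * b with hc
    have hc0 : c ≠ 0 := mul_ne_zero h hb.ne'
    set d := z.re + z.im * a
    have h3 : J (L 1) = (-(c⁻¹ * d)) • L 1 := by
      have : c⁻¹ • (d • L 1 + c • J (L 1)) = 0 := by rw [hz, smul_zero]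
      rw [smul_add, smul_smul, smul_smul, inv_mul_cancel₀ hc0, one_smul] at this
      rw [neg_smul]
      exact eq_neg_of_add_eq_zero_right this
    have h4 := hJ (L 1)
    rw [h3, map_smul, h3, smul_smul, neg_mul_neg, eq_neg_iff_add_eq_zero] at h4
    have h5 : (c⁻¹ * d * (c⁻¹ * d) + 1) • L 1 = 0 := by rw [add_smul, one_smul, h4]
    rcases smul_eq_zero.1 h5 with h6 | h6
    · nlinarith [mul_self_nonneg (c⁻¹ * d)]
    · exact h1 h6
  rw [h2, zero_mul, zero_mul, zero_smul, add_zero, add_zero] at hz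
  have h3 : z.re = 0 := (smul_eq_zero.1 hz).resolve_right h1
  exact Complex.ext h3 h2

lemma contDiffAt_extChartAt_comp {f : ℂ → M} {z : ℂ}
    (hf : ContMDiffAt 𝓘(ℝ, ℂ) (𝓡∂ 2) ∞ f z) :
    ContDiffAt ℝ ∞ (fun w => extChartAt (𝓡∂ 2) (f z) (f w)) z := by
  have := (contMDiffAt_iff.1 hf).2
  simpa [Function.comp_def, contDiffWithinAt_univ, chartAt_self_eq] using this

/-- An injective derivative between real planes is surjective, so the map is open at `z`. The
neighbourhoods on the right are those of the whole plane and not of the half-plane, which is what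
excludes boundary points. -/
lemma map_nhds_extChartAt_comp {f : ℂ → M} {z : ℂ} (hf : ContMDiffAt 𝓘(ℝ, ℂ) (𝓡∂ 2) ∞ f z)
    (hinj : Function.Injective (mfderiv 𝓘(ℝ, ℂ) (𝓡∂ 2) f z)) :
    Filter.map (fun w => extChartAt (𝓡∂ 2) (f z) (f w)) (𝓝 z) =
      𝓝 (extChartAt (𝓡∂ 2) (f z) (f z)) := by
  have hF := contDiffAt_extChartAt_comp hf
  have hd : mfderiv 𝓘(ℝ, ℂ) (𝓡∂ 2) f z =
      fderiv ℝ (fun w => extChartAt (𝓡∂ 2) (f z) (f w)) z := by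
    rw [(hf.mdifferentiableAt (by simp)).mfderiv]
    simp [writtenInExtChartAt, Function.comp_def, chartAt_self_eq]
    rfl
  have hs : Function.Surjective (fderiv ℝ (fun w => extChartAt (𝓡∂ 2) (f z) (f w)) z) := by
    rw [hd] at hinj
    exact (LinearMap.injective_iff_surjective_of_finrank_eq_finrank
      (f := (fderiv ℝ (fun w => extChartAt (𝓡∂ 2) (f z) (f w)) z).toLinearMap) (by simp)).1 hinj
  exact (hF.hasStrictFDerivAt (by simp)).map_nhds_eq_of_surj
    (LinearMap.range_eq_top.2 hs)

lemma image_mem_nhds_of_injective_mfderiv {f : ℂ → M} {z : ℂ}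
    (hf : ContMDiffAt 𝓘(ℝ, ℂ) (𝓡∂ 2) ∞ f z)
    (hinj : Function.Injective (mfderiv 𝓘(ℝ, ℂ) (𝓡∂ 2) f z)) {U : Set ℂ} (hU : U ∈ 𝓝 z) :
    f '' U ∈ 𝓝 (f z) := by
  have hs : f ⁻¹' (extChartAt (𝓡∂ 2) (f z)).source ∈ 𝓝 z :=
    hf.continuousAt.preimage_mem_nhds (extChartAt_source_mem_nhds _)
  have h1 : (fun w => extChartAt (𝓡∂ 2) (f z) (f w)) '' (U ∩ f ⁻¹' (extChartAt (𝓡∂ 2) (f z)).source)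
      ∈ 𝓝 (extChartAt (𝓡∂ 2) (f z) (f z)) := by
    rw [← map_nhds_extChartAt_comp hf hinj]
    exact Filter.image_mem_map (Filter.inter_mem hU hs)
  filter_upwards [(continuousAt_extChartAt (I := 𝓡∂ 2) (f z)).preimage_mem_nhds h1,
    extChartAt_source_mem_nhds (I := 𝓡∂ 2) (f z)] with y hy hy'
  obtain ⟨w, ⟨hw, hw'⟩, hwy⟩ := hy
  exact ⟨w, hw, (extChartAt (𝓡∂ 2) (f z)).injOn hw' hy' hwy⟩

/-- In the chart at `f z` the image is a full planar neighbourhood, yet it lies in the half-plane;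
so the point is not on the edge of the half-plane. -/
lemma mem_interior_of_injective_mfderiv {f : ℂ → M} {z : ℂ}
    (hf : ContMDiffAt 𝓘(ℝ, ℂ) (𝓡∂ 2) ∞ f z)
    (hinj : Function.Injective (mfderiv 𝓘(ℝ, ℂ) (𝓡∂ 2) f z)) :
    f z ∈ (𝓡∂ 2).interior M := by
  change (𝓡∂ 2).IsInteriorPoint (f z)
  rw [ModelWithCorners.isInteriorPoint_iff, mem_interior_iff_mem_nhds,
    ← map_nhds_extChartAt_comp hf hinj, Filter.mem_map]
  filter_upwards [hf.continuousAt.preimage_mem_nhds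
    (extChartAt_source_mem_nhds (I := 𝓡∂ 2) (f z))] with w hw
  exact (extChartAt (𝓡∂ 2) (f z)).map_source hw

/-- A smooth arc has dimension at most one in every chart. -/
lemma dimH_extChartAt_image_le {γ : ℝ → M}
    (hγ : ContMDiffOn 𝓘(ℝ, ℝ) (𝓡∂ 2) ∞ γ (Set.Icc 0 1)) (x : M)
    [IsManifold (𝓡∂ 2) ∞ M] :
    dimH (extChartAt (𝓡∂ 2) x '' (γ '' Set.Icc 0 1 ∩ (extChartAt (𝓡∂ 2) x).source)) ≤ 1 := by
  have h0 : extChartAt (𝓡∂ 2) x '' (γ '' Set.Icc 0 1 ∩ (extChartAt (𝓡∂ 2) x).source) =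
      (fun t => extChartAt (𝓡∂ 2) x (γ t)) ''
        (Set.Icc 0 1 ∩ γ ⁻¹' (extChartAt (𝓡∂ 2) x).source) := by
    rw [← Set.image_inter_preimage, Set.image_image]
  rw [h0]
  have h1 : dimH ((fun t => extChartAt (𝓡∂ 2) x (γ t)) ''
      (Set.Icc 0 1 ∩ γ ⁻¹' (extChartAt (𝓡∂ 2) x).source)) ≤
      dimH (Set.Icc (0 : ℝ) 1 ∩ γ ⁻¹' (extChartAt (𝓡∂ 2) x).source) := by
    -- A continuously differentiable curve is locally Lipschitz, and such maps do not raise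
    -- Hausdorff dimension.
    refine dimH_image_le_of_locally_lipschitzOn fun t ht => ?_
    have h2 : ContMDiffWithinAt 𝓘(ℝ, ℝ) 𝓘(ℝ, EuclideanSpace ℝ (Fin 2)) ∞
        (fun t => extChartAt (𝓡∂ 2) x (γ t)) (Set.Icc 0 1) t := by
      have h3 := contMDiffAt_extChartAt' (I := 𝓡∂ 2) (n := ∞) (x := x) (x' := γ t) (by
        rw [← extChartAt_source (𝓡∂ 2)]
        exact ht.2)
      exact ContMDiffAt.comp_contMDiffWithinAt t h3 (hγ t ht.1)
    have h3 : ContDiffWithinAt ℝ 1 (fun t => extChartAt (𝓡∂ 2) x (γ t)) (Set.Icc 0 1) t :=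
      (contMDiffWithinAt_iff_contDiffWithinAt.1 h2).of_le (by simp)
    obtain ⟨K, s, hs, hK⟩ := h3.exists_lipschitzOnWith (convex_Icc 0 1)
    exact ⟨K, s, nhdsWithin_mono _ Set.inter_subset_left hs, hK⟩
  refine h1.trans ((dimH_mono (Set.subset_univ _)).trans ?_)
  rw [Real.dimH_univ]

end Immersions

/-! ### Absence of marked discs in a filled surface -/

namespace ArcSystem

open Topology

variable {M : Type w} [TopologicalSpace M] [ChartedSpace (EuclideanHalfSpace 2) M]
  [IsManifold (𝓡∂ 2) ∞ M] {J : QuarterTurn M} {Γ : RibbonGraph.{v}} (κ : ArcSystem J Γ)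

lemma arc_mem_interior (h : Γ.H) {t : ℝ} (ht : t ∈ Set.Icc (0 : ℝ) 1) :
    κ.arc h t ∈ (𝓡∂ 2).interior M := by
  rcases eq_or_lt_of_le ht.1 with h0 | h0
  · rw [← h0, κ.start]
    exact κ.vertex_interior _
  rcases eq_or_lt_of_le ht.2 with h1 | h1
  · have := κ.reverse h 0 (by simp)
    rw [sub_zero, κ.start] at this
    rw [h1, ← this]
    exact κ.vertex_interior _
  · exact (κ.arc_interior h t ⟨h0, h1⟩).1

lemma carrier_subset_interior : κ.carrier ⊆ (𝓡∂ 2).interior M := by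
  intro x hx
  obtain ⟨h, t, ht, rfl⟩ := Set.mem_iUnion.1 hx
  exact κ.arc_mem_interior h ht

/-- The graph is nowhere dense. -/
lemma carrier_notMem_nhds {x : M} (hx : x ∈ (𝓡∂ 2).interior M) : κ.carrier ∉ 𝓝 x := by
  intro h
  have hx' : Set.range (𝓡∂ 2) ∈ 𝓝 (extChartAt (𝓡∂ 2) x x) := range_mem_nhds_isInteriorPoint hx
  have h1 : extChartAt (𝓡∂ 2) x '' (κ.carrier ∩ (extChartAt (𝓡∂ 2) x).source) ∈
      𝓝 (extChartAt (𝓡∂ 2) x x) := by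
    have h2 : (extChartAt (𝓡∂ 2) x).target ∈ 𝓝 (extChartAt (𝓡∂ 2) x x) := by
      have := extChartAt_target_mem_nhdsWithin (I := 𝓡∂ 2) x
      rwa [nhdsWithin_eq_nhds.2 hx'] at this
    have h3 := (continuousAt_extChartAt_symm (I := 𝓡∂ 2) x).preimage_mem_nhds
      (t := κ.carrier) (by rwa [extChartAt_to_inv])
    filter_upwards [h2, h3] with y hy hy'
    exact ⟨_, ⟨hy', (extChartAt (𝓡∂ 2) x).map_target hy⟩, (extChartAt (𝓡∂ 2) x).right_inv hy⟩
  -- A neighbourhood in the plane has Hausdorff dimension two, whereas finitely many arcs together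
  -- have dimension at most one.
  have h2 := Real.dimH_of_mem_nhds h1
  rw [carrier, Set.iUnion_inter, Set.image_iUnion, dimH_iUnion] at h2
  have h3 : ⨆ h, dimH (extChartAt (𝓡∂ 2) x ''
      (κ.arc h '' Set.Icc 0 1 ∩ (extChartAt (𝓡∂ 2) x).source)) ≤ 1 :=
    iSup_le fun h => dimH_extChartAt_image_le (κ.smooth h) x
  rw [h2] at h3
  simp at h3

variable {κ} in
/-- The complement of a filling graph contains no discs. -/
lemma IsFilling.not_hasMarkedDisc [T2Space M] (hκ : κ.IsFilling) {n : ℕ}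
    (g : Fin n → Γ.H) : ¬ κ.HasMarkedDisc n g := by
  rintro ⟨f, φ, hφ, hφn, hf, -, hfs, hfi, hfb⟩
  have hmarked : ∀ z ∈ Metric.ball (0 : ℂ) 1, ∀ j < n, z ≠ Complex.exp (-(φ j * Complex.I)) := by
    rintro z hz j - rfl
    rw [mem_ball_zero_iff, ← neg_mul, ← Complex.ofReal_neg, Complex.norm_exp_ofReal_mul_I] at hz
    exact lt_irrefl _ hz
  have hnhds : ∀ z ∈ Metric.ball (0 : ℂ) 1, Metric.closedBall (0 : ℂ) 1 ∈ 𝓝 z := fun z hz =>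
    Filter.mem_of_superset (Metric.isOpen_ball.mem_nhds hz) Metric.ball_subset_closedBall
  have hsm : ∀ z ∈ Metric.ball (0 : ℂ) 1, ContMDiffAt 𝓘(ℝ, ℂ) (𝓡∂ 2) ∞ f z := by
    intro z hz
    refine (hfs z ⟨Metric.ball_subset_closedBall hz, ?_⟩).contMDiffAt ?_
    · rintro ⟨j, hj, h⟩
      exact hmarked z hz j hj h
    · have hfin : {z : ℂ | ∃ j < n, z = Complex.exp (-(φ j * Complex.I))}.Finite := by
        refine ((Set.finite_Iio n).image fun j : ℕ => Complex.exp (-(φ j * Complex.I))).subset ?_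
        rintro _ ⟨j, hj, rfl⟩
        exact ⟨j, hj, rfl⟩
      refine Filter.inter_mem (hnhds z hz) (hfin.isClosed.isOpen_compl.mem_nhds ?_)
      rintro ⟨j, hj, h⟩
      exact hmarked z hz j hj h
  have hinj : ∀ z ∈ Metric.ball (0 : ℂ) 1,
      Function.Injective (mfderiv 𝓘(ℝ, ℂ) (𝓡∂ 2) f z) := by
    intro z hz
    obtain ⟨h1, a, b, hb, hI⟩ := hfi z (Metric.ball_subset_closedBall hz) (hmarked z hz)
    rw [mfderivWithin_of_mem_nhds (hnhds z hz)] at h1 hI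
    exact injective_of_quarterTurn
      (mfderiv 𝓘(ℝ, ℂ) (𝓡∂ 2) f z).toLinearMap
      (J.J (f z)).toLinearMap (J.J_J _) h1 hb hI
  have hbd : ∀ z ∈ Metric.closedBall (0 : ℂ) 1, z ∉ Metric.ball (0 : ℂ) 1 → f z ∈ κ.carrier := by
    intro z hz hz'
    have hz1 : ‖z‖ = 1 := le_antisymm (by simpa using hz) (by simpa using hz')
    obtain ⟨t, ht, rfl⟩ : ∃ t ∈ Set.Ico (φ 0) (φ n), z = Complex.exp (-(t * Complex.I)) := by
      -- The boundary is parametrized clockwise, so the parameter is minus the argument, reduced to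
      -- the period which starts at `φ 0`.
      refine ⟨toIcoMod Real.two_pi_pos (φ 0) (-z.arg), ?_, ?_⟩
      · rw [hφn]
        exact toIcoMod_mem_Ico _ _ _
      · rw [toIcoMod]
        have h2 : -(((-z.arg - toIcoDiv Real.two_pi_pos (φ 0) (-z.arg) • (2 * Real.pi) : ℝ) : ℂ) *
            Complex.I) = z.arg * Complex.I +
              (toIcoDiv Real.two_pi_pos (φ 0) (-z.arg) : ℤ) * (2 * Real.pi * Complex.I) := by
          push_cast [zsmul_eq_mul]
          ring
        rw [h2, Complex.exp_add, Complex.exp_int_mul_two_pi_mul_I, mul_one]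
        have h3 := Complex.norm_mul_exp_arg_mul_I z
        rw [hz1, Complex.ofReal_one, one_mul] at h3
        exact h3.symm
    obtain ⟨j, hj, htj⟩ : ∃ j < n, t ∈ Set.Icc (φ j) (φ (j + 1)) := by
      have key : ∀ N ≤ n, t < φ N → ∃ j < n, t ∈ Set.Icc (φ j) (φ (j + 1)) := by
        intro N hN htN
        induction N with
        | zero => exact absurd ht.1 (not_le.2 htN)
        | succ N ih =>
          by_cases h : t < φ N
          · exact ih (by omega) h
          · exact ⟨N, by omega, not_lt.1 h, htN.le⟩
      exact key n le_rfl ht.2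
    obtain ⟨τ, -, hτ, hτ0, hτ1, hτf⟩ := hfb ⟨j, hj⟩
    have hle : φ j ≤ φ (j + 1) := (hφ j hj).le
    rw [hτf t htj]
    refine Set.mem_iUnion.2 ⟨_, τ t, ⟨?_, ?_⟩, rfl⟩
    · rw [← hτ0]
      exact hτ.monotoneOn (Set.left_mem_Icc.2 hle) htj htj.1
    · rw [← hτ1]
      exact hτ.monotoneOn htj (Set.right_mem_Icc.2 hle) htj.2
  have hint : ∀ z ∈ Metric.closedBall (0 : ℂ) 1, f z ∈ (𝓡∂ 2).interior M := by
    intro z hz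
    by_cases hz' : z ∈ Metric.ball (0 : ℂ) 1
    · exact mem_interior_of_injective_mfderiv (hsm z hz') (hinj z hz')
    · exact κ.carrier_subset_interior (hbd z hz hz')
  -- Suppose that some point of the disc leaves the graph. The part of the image off the graph is
  -- then followed along one line of the collar.
  have hcar : ∀ z ∈ Metric.closedBall (0 : ℂ) 1, f z ∈ κ.carrier := by
    by_contra! hne
    obtain ⟨z₀, hz₀, hz₀'⟩ := hne
    obtain ⟨Φ, hΦ⟩ := hκ
    let W : Set (κ.carrierᶜ : Set M) := {x | (x : M) ∈ f '' Metric.closedBall 0 1}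
    have hWc : IsClosed W :=
      ((isCompact_closedBall (0 : ℂ) 1).image_of_continuousOn hf).isClosed.preimage
        continuous_subtype_val
    -- A point of the image off the graph comes from the open disc, where `f` is an open map,
    -- because the unit circle goes into the graph.
    have hWo : IsOpen W := by
      rw [isOpen_iff_mem_nhds]
      rintro ⟨x, hx⟩ ⟨z, hz, rfl⟩
      have hz' : z ∈ Metric.ball (0 : ℂ) 1 := by
        by_contra h
        exact hx (hbd z hz h)
      exact continuous_subtype_val.continuousAt.preimage_mem_nhds
        (image_mem_nhds_of_injective_mfderiv (hsm z hz') (hinj z hz') (hnhds z hz'))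
    let b := (Φ ⟨f z₀, hz₀'⟩).1
    let s := (Φ ⟨f z₀, hz₀'⟩).2
    -- The collar line through `f z₀`. It is connected and `W` is open and closed, so `W` contains
    -- its end point `b` on the boundary, although the disc maps to the interior.
    let ψ : Set.Ico (0 : ℝ) 1 → (κ.carrierᶜ : Set M) := fun t => Φ.symm (b, t)
    have hψ : Continuous ψ := Φ.symm.continuous.comp (by fun_prop)
    have : PreconnectedSpace (Set.Ico (0 : ℝ) 1) :=
      Subtype.preconnectedSpace isPreconnected_Ico
    have h1 : ψ ⁻¹' W = Set.univ := by
      refine IsClopen.eq_univ ⟨hWc.preimage hψ, hWo.preimage hψ⟩ ⟨s, ?_⟩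
      change Φ.symm (Φ ⟨f z₀, hz₀'⟩) ∈ W
      rw [Φ.symm_apply_apply]
      exact ⟨z₀, hz₀, rfl⟩
    have hb : (b : M) ∈ κ.carrierᶜ := fun h => by
      have := κ.carrier_subset_interior h
      rw [← ModelWithCorners.compl_boundary] at this
      exact this b.2
    have h2 : ψ ⟨0, by norm_num⟩ ∈ W := by
      have : (⟨0, by norm_num⟩ : Set.Ico (0 : ℝ) 1) ∈ ψ ⁻¹' W := h1 ▸ Set.mem_univ _
      exact this
    have h3 : ψ ⟨0, by norm_num⟩ = ⟨b, hb⟩ := by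
      change Φ.symm (b, _) = _
      rw [Homeomorph.symm_apply_eq, hΦ ⟨b, hb⟩ b.2]
    rw [h3] at h2
    obtain ⟨z, hz, hzb⟩ := h2
    have h4 := hint z hz
    rw [hzb, ← ModelWithCorners.compl_boundary] at h4
    exact h4 b.2
  have h0 : (0 : ℂ) ∈ Metric.ball (0 : ℂ) 1 := by simp
  -- The disc now lies inside the graph, but its image is a neighbourhood of `f 0`.
  refine κ.carrier_notMem_nhds (hint 0 (Metric.ball_subset_closedBall h0))
    (Filter.mem_of_superset
      (image_mem_nhds_of_injective_mfderiv (hsm 0 h0) (hinj 0 h0) (hnhds 0 h0)) ?_)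
  rintro _ ⟨z, hz, rfl⟩
  exact hcar z hz

variable {κ} in
lemma IsFilling.not_isDiscSequence [T2Space M] (hκ : κ.IsFilling) (L : List (Γ.H × ℕ)) :
    ¬ κ.IsDiscSequence L := by
  rintro ⟨n, g, ℓ, -, -, hg, -⟩
  exact hκ.not_hasMarkedDisc g hg

end ArcSystem

/-! ## Degrees and winding numbers -/

section Angles

variable {M : Type w} [TopologicalSpace M] [ChartedSpace (EuclideanHalfSpace 2) M]
  [IsManifold (𝓡∂ 2) ∞ M]

lemma QuarterTurn.rot_neg_rot (J : QuarterTurn M) (x : M) (θ : ℝ)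
    (v : TangentSpace (𝓡∂ 2) x) : J.rot x (-θ) (J.rot x θ v) = v := by
  simp only [QuarterTurn.rot, Real.cos_neg, Real.sin_neg, map_add, map_smul, J.J_J, smul_add,
    smul_smul, smul_neg, neg_smul, neg_mul, neg_neg]
  have h := Real.cos_sq_add_sin_sq θ
  have h2 : (Real.cos θ * Real.cos θ) • v + (Real.sin θ * Real.sin θ) • v = v := by
    rw [← add_smul, ← sq, ← sq, h, one_smul]
  rw [mul_comm (Real.sin θ) (Real.cos θ)]
  refine Eq.trans ?_ h2
  module

lemma QuarterTurn.rot_smul (J : QuarterTurn M) (x : M) (θ c : ℝ)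
    (v : TangentSpace (𝓡∂ 2) x) : J.rot x θ (c • v) = c • J.rot x θ v := by
  simp only [QuarterTurn.rot, map_smul, smul_add]
  rw [smul_comm, smul_comm (Real.sin θ)]

end Angles

namespace ArcSystem

open Topology

variable {M : Type w} [TopologicalSpace M] [ChartedSpace (EuclideanHalfSpace 2) M]
  [IsManifold (𝓡∂ 2) ∞ M] {J : QuarterTurn M} {Γ : RibbonGraph.{v}} {κ : ArcSystem J Γ}
  {η : LineField κ.punctures} {𝔤 : κ.Grading η}

/-- The rotation by the opposite of the grading takes the arc to the line field. -/
lemma Grading.rot_neg_mem (𝔤 : κ.Grading η) (h : Γ.H) {t : ℝ} (ht : t ∈ Set.Ioo (0 : ℝ) 1) :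
    J.rot _ (-𝔤.angle h t) (velocity (κ.arc h) t) ∈ η.line (κ.arc h t) := by
  obtain ⟨U, -, hxU, X, -, hX⟩ := η.smooth (κ.arc h t) (κ.arc_interior h t ht).2
  obtain ⟨hX0, hXl⟩ := hX _ hxU
  have hmem : X (κ.arc h t) ∈ η.line (κ.arc h t) := by
    rw [hXl]
    exact Submodule.mem_span_singleton_self _
  obtain ⟨c, hc⟩ := Submodule.mem_span_singleton.1 (𝔤.rot_mem h t ht _ hmem)
  -- The grading only says that rotation takes the line field into the tangent line. As rotations
  -- are injective the line is hit, so the relation can be inverted.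
  have hc0 : c ≠ 0 := by
    rintro rfl
    have := J.rot_neg_rot _ (𝔤.angle h t) (X (κ.arc h t))
    rw [← hc, zero_smul] at this
    refine hX0 ?_
    rw [← this]
    simp [QuarterTurn.rot]
  have h1 : velocity (κ.arc h) t = c⁻¹ • J.rot _ (𝔤.angle h t) (X (κ.arc h t)) := by
    rw [← hc, smul_smul, inv_mul_cancel₀ hc0, one_smul]
  rw [h1, J.rot_smul, J.rot_neg_rot]
  exact Submodule.smul_mem _ _ hmem

/-- The angle lies in `(-π, 0)` and the crossing angle in `(0, π)`. Their sum is a multiple of `π`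
in `(-π, π)`, so both intersections with the leaf have degree zero. -/
lemma Grading.IsShortestClockwise.hasDegree_eq_zero (h𝔤 : 𝔤.IsShortestClockwise) {h g : Γ.H}
    {d : ℤ} (hd : 𝔤.HasDegree h g d) : d = 0 := by
  obtain ⟨-, -, D, r, a, b, s₁, s₂, c₁, c₂, n₁, n₂, -, -, -, -, hs₁, hs₂, -, -, -, -, hc₁, hc₂, -,
    -, h₁, h₂, rfl⟩ := hd
  have key : ∀ (h : Γ.H) (s c : ℝ) (n : ℤ), s ∈ Set.Ioo (0 : ℝ) 1 → c ∈ Set.Ioo 0 Real.pi →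
      𝔤.angle h s + c = n * Real.pi → n = 0 := by
    intro h s c n hs hc hn
    have h1 := h𝔤 h s hs
    have h2 : (n : ℝ) * Real.pi < 1 * Real.pi := by rw [← hn]; linarith [h1.2, hc.2]
    have h3 : (-1 : ℝ) * Real.pi < n * Real.pi := by rw [← hn]; linarith [h1.1, hc.1]
    have h4 := lt_of_mul_lt_mul_right h2 Real.pi_pos.le
    have h5 := lt_of_mul_lt_mul_right h3 Real.pi_pos.le
    have h6 : n < 1 := by exact_mod_cast h4
    have h7 : -1 < n := by exact_mod_cast h5
    omega
  rw [key h s₁ c₁ n₁ hs₁ hc₁ h₁, key g s₂ c₂ n₂ hs₂ hc₂ h₂, sub_zero]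

/-- All arrows have degree zero. -/
lemma Grading.IsShortestClockwise.arrowDegree_eq_zero (h𝔤 : 𝔤.IsShortestClockwise) {h : Γ.H}
    {d : ℤ} (hd : 𝔤.IsArrowDegree h d) : d = 0 := by
  rcases hd with ⟨-, hd⟩ | hd
  · exact hd
  · exact h𝔤.hasDegree_eq_zero hd

lemma Grading.IsShortestClockwise.floor_eq (h𝔤 : 𝔤.IsShortestClockwise) (h : Γ.H) {t : ℝ}
    (ht : t ∈ Set.Ioo (0 : ℝ) 1) : ⌊𝔤.angle h t / Real.pi⌋ = -1 := by
  have h1 := h𝔤 h t ht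
  rw [Int.floor_eq_iff]
  constructor
  · rw [le_div_iff₀ Real.pi_pos]
    push_cast
    linarith [h1.1]
  · rw [div_lt_iff₀ Real.pi_pos]
    push_cast
    linarith [h1.2]

/-- All winding numbers are zero. -/
lemma Grading.IsShortestClockwise.winding_eq_zero (h𝔤 : 𝔤.IsShortestClockwise) {h : Γ.H} {n : ℤ}
    (hn : 𝔤.HasWinding h n) : n = 0 := by
  obtain ⟨ε, h0, h1, hε⟩ := hn
  obtain ⟨-, -, h2⟩ := hε (ε / 2) (1 - ε / 2) (by linarith) (by linarith) (by linarith)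
    (by linarith)
  rw [← h2, h𝔤.floor_eq h ⟨by linarith, by linarith⟩, h𝔤.floor_eq h ⟨by linarith, by linarith⟩,
    sub_self]

lemma Grading.IsShortestClockwise.hasWinding (h𝔤 : 𝔤.IsShortestClockwise)
    (hη : κ.IsRibbonLineField η) (h : Γ.H) : 𝔤.HasWinding h 0 := by
  -- Any number below `1 / 2` would do, since the arcs are transverse to the line field along their
  -- whole interior.
  refine ⟨1 / 4, by norm_num, by norm_num, fun t u h0 ht hu h1 => ?_⟩
  have ht' : t ∈ Set.Ioo (0 : ℝ) 1 := ⟨h0, by linarith⟩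
  have hu' : u ∈ Set.Ioo (0 : ℝ) 1 := ⟨by linarith, h1⟩
  exact ⟨hη.2 h t ht', hη.2 h u hu', by rw [h𝔤.floor_eq h ht', h𝔤.floor_eq h hu', sub_self]⟩

/-- The image of a smaller disc is a neighbourhood of the puncture. -/
lemma _root_.PolarDisc.image_closedBall_mem_nhds {S : Set M} {η : LineField S} {p : M}
    (D : PolarDisc J η p) {r : ℝ} (hr : 0 < r) :
    D.ψ '' Metric.closedBall 0 r ∈ 𝓝 p := by
  have h0 : (0 : ℂ) ∈ Metric.ball (0 : ℂ) D.R := by simpa using D.R_pos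
  obtain ⟨h1, a, b, hb, hI⟩ := D.oriented 0 h0
  have := image_mem_nhds_of_injective_mfderiv
    (D.smooth.contMDiffAt (Metric.isOpen_ball.mem_nhds h0))
    (injective_of_quarterTurn (mfderiv 𝓘(ℝ, ℂ) (𝓡∂ 2) D.ψ 0).toLinearMap
      (J.J (D.ψ 0)).toLinearMap (J.J_J _) h1 hb hI)
    (Metric.closedBall_mem_nhds 0 hr)
  rwa [D.center] at this

/-- An arc which starts at the center of a polar disc meets all small circles, for the first time
after a short time. -/
lemma exists_first_crossing [T2Space M] (h : Γ.H)
    (D : PolarDisc J η (κ.vertex (Γ.s h))) : ∃ r₀, 0 < r₀ ∧ r₀ < D.R ∧ ∀ r, 0 < r → r < r₀ →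
      ∃ s ∈ Set.Ioo (0 : ℝ) (1 / 2), ∃ a : ℝ,
        κ.arc h s = D.ψ (r * Complex.exp (a * Complex.I)) ∧
        κ.arc h '' Set.Ico 0 s ⊆ D.ψ '' Metric.ball 0 r := by
  set R' := D.R / 2 with hR'
  have hR0 : 0 < R' := half_pos D.R_pos
  have hsub : Metric.closedBall (0 : ℂ) R' ⊆ Metric.ball 0 D.R :=
    Metric.closedBall_subset_ball (half_lt_self D.R_pos)
  have hcont : ContinuousOn D.ψ (Metric.closedBall 0 R') := D.smooth.continuousOn.mono hsub
  have hinj : Set.InjOn D.ψ (Metric.closedBall 0 R') := D.injOn.mono hsub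
  let N : M → ℂ := Function.invFunOn D.ψ (Metric.closedBall 0 R')
  have hN1 : ∀ x ∈ D.ψ '' Metric.closedBall 0 R', N x ∈ Metric.closedBall (0 : ℂ) R' := fun x hx =>
    Function.invFunOn_mem hx
  have hN2 : ∀ x ∈ D.ψ '' Metric.closedBall 0 R', D.ψ (N x) = x := fun x hx =>
    Function.invFunOn_eq hx
  -- A continuous injection of a compact ball into a Hausdorff space is a closed map, so its inverse
  -- is continuous.
  have hN : ContinuousOn N (D.ψ '' Metric.closedBall 0 R') := by
    rw [continuousOn_iff_isClosed]
    intro t ht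
    refine ⟨D.ψ '' (t ∩ Metric.closedBall 0 R'), ?_, ?_⟩
    · refine (IsCompact.image_of_continuousOn ?_
        (hcont.mono Set.inter_subset_right)).isClosed
      exact (isCompact_closedBall 0 R').inter_left ht
    · ext x
      constructor
      · rintro ⟨h1, h2⟩
        exact ⟨⟨N x, ⟨h1, hN1 x h2⟩, hN2 x h2⟩, h2⟩
      · rintro ⟨⟨z, ⟨hz, hz'⟩, rfl⟩, h2⟩
        refine ⟨?_, h2⟩
        rw [Set.mem_preimage, hinj (hN1 _ h2) hz' (hN2 _ h2)]
        exact hz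
  -- Times below `1 / 2` guarantee that the two ends of a loop are not taken at the same point of
  -- the arc.
  obtain ⟨t₀, ht₀, ht₁, htK⟩ : ∃ t₀ : ℝ, 0 < t₀ ∧ t₀ < 1 / 2 ∧
      ∀ t ∈ Set.Icc 0 t₀, κ.arc h t ∈ D.ψ '' Metric.closedBall 0 R' := by
    have h1 : κ.arc h ⁻¹' (D.ψ '' Metric.closedBall 0 R') ∈ 𝓝[Set.Icc 0 1] (0 : ℝ) := by
      refine (κ.smooth h).continuousOn 0 (by simp) ?_
      rw [κ.start]
      exact D.image_closedBall_mem_nhds hR0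
    rw [nhdsWithin_Icc_eq_nhdsGE zero_lt_one] at h1
    obtain ⟨u, hu, hu'⟩ := (mem_nhdsGE_iff_exists_Icc_subset).1 h1
    refine ⟨min u (1 / 4), lt_min hu (by norm_num), (min_le_right _ _).trans_lt (by norm_num),
      fun t ht => hu' ⟨ht.1, ht.2.trans (min_le_left _ _)⟩⟩
  let ν : ℝ → ℝ := fun t => ‖N (κ.arc h t)‖
  have hν : ContinuousOn ν (Set.Icc 0 t₀) :=
    (hN.comp ((κ.smooth h).continuousOn.mono (Set.Icc_subset_Icc_right (by linarith))) htK).norm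
  have hν0 : ν 0 = 0 := by
    have h0 : (0 : ℂ) ∈ Metric.closedBall (0 : ℂ) R' := by simpa using hR0.le
    have h1 : N (κ.arc h 0) = 0 := by
      have h2 := htK 0 ⟨le_rfl, ht₀.le⟩
      refine hinj (hN1 _ h2) h0 ?_
      rw [hN2 _ h2, D.center, κ.start]
    simp [ν, h1]
  have hνt : 0 < ν t₀ := by
    refine norm_pos_iff.2 fun h1 => ?_
    have h2 := hN2 _ (htK t₀ ⟨ht₀.le, le_rfl⟩)
    rw [h1, D.center] at h2
    exact (κ.arc_interior h t₀ ⟨ht₀, by linarith⟩).2 ⟨_, h2⟩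
  refine ⟨min (ν t₀) R', lt_min hνt hR0, (min_le_right _ _).trans_lt (half_lt_self D.R_pos),
    fun r hr hr' => ?_⟩
  -- The times at radius `r` form a nonempty closed set by the intermediate value theorem; its
  -- infimum is the first crossing.
  let Z : Set ℝ := Set.Icc 0 t₀ ∩ ν ⁻¹' {r}
  have hZc : IsClosed Z := hν.preimage_isClosed_of_isClosed isClosed_Icc isClosed_singleton
  have hZb : BddBelow Z := ⟨0, fun t ht => ht.1.1⟩
  have hZn : Z.Nonempty := by
    obtain ⟨t, ht, htr⟩ := intermediate_value_Icc ht₀.le hν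
      (show r ∈ Set.Icc (ν 0) (ν t₀) from
        ⟨hν0.trans_le hr.le, (hr'.trans_le (min_le_left _ _)).le⟩)
    exact ⟨t, ht, htr⟩
  obtain ⟨⟨hs0, hs1⟩, hsr⟩ := hZc.csInf_mem hZn hZb
  set s := sInf Z
  have hs0' : 0 < s := by
    refine lt_of_le_of_ne hs0 fun h1 => ?_
    rw [← h1] at hsr
    exact hr.ne (hν0.symm.trans hsr)
  refine ⟨s, ⟨hs0', by linarith⟩, (N (κ.arc h s)).arg, ?_, ?_⟩
  · have h1 := Complex.norm_mul_exp_arg_mul_I (N (κ.arc h s))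
    have h2 : ‖N (κ.arc h s)‖ = r := hsr
    rw [h2] at h1
    rw [h1, hN2 _ (htK s ⟨hs0, hs1⟩)]
  · rintro _ ⟨t, ⟨ht0, hts⟩, rfl⟩
    have htK' := htK t ⟨ht0, hts.le.trans hs1⟩
    refine ⟨N (κ.arc h t), ?_, hN2 _ htK'⟩
    rw [mem_ball_zero_iff]
    -- Leaving the disc of radius `r` before time `s` would force an earlier crossing, against
    -- minimality.
    by_contra hlt
    obtain ⟨t', ht', ht'r⟩ := intermediate_value_Icc ht0
      (hν.mono (Set.Icc_subset_Icc_right (hts.le.trans hs1)))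
      (show r ∈ Set.Icc (ν 0) (ν t) from ⟨hν0.trans_le hr.le, not_lt.1 hlt⟩)
    have : s ≤ t' := csInf_le hZb ⟨⟨ht'.1, (ht'.2.trans hts.le).trans hs1⟩, ht'r⟩
    linarith [ht'.2]

/-- Uniqueness of degrees alone would leave the category possibly nonexistent. Here a circle small
enough for both arcs is chosen and its first crossings provide the leaf segment. -/
lemma Grading.IsShortestClockwise.hasDegree [T2Space M] (h𝔤 : 𝔤.IsShortestClockwise)
    (hη : κ.IsRibbonLineField η) {h g : Γ.H} (hne : h ≠ g) (hs : Γ.s h = Γ.s g) :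
    𝔤.HasDegree h g 0 := by
  obtain ⟨D⟩ := hη.1 (Γ.s h)
  obtain ⟨r₁, hr₁, hr₁', H₁⟩ := exists_first_crossing h D
  obtain ⟨r₂, hr₂, hr₂', H₂⟩ : ∃ r₀, 0 < r₀ ∧ r₀ < D.R ∧ ∀ r, 0 < r → r < r₀ →
      ∃ s ∈ Set.Ioo (0 : ℝ) (1 / 2), ∃ a : ℝ,
        κ.arc g s = D.ψ (r * Complex.exp (a * Complex.I)) ∧
        κ.arc g '' Set.Ico 0 s ⊆ D.ψ '' Metric.ball 0 r := by
    have := exists_first_crossing (κ := κ) (η := η) g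
    rw [← hs] at this
    exact this D
  have hm : 0 < min r₁ r₂ := lt_min hr₁ hr₂
  set r := min r₁ r₂ / 2
  have hr0 : 0 < r := half_pos hm
  have hrlt : r < min r₁ r₂ := half_lt_self hm
  obtain ⟨s₁, hs₁, a, ha, hs₁'⟩ := H₁ r hr0 (hrlt.trans_le (min_le_left _ _))
  obtain ⟨s₂, hs₂, b', hb', hs₂'⟩ := H₂ r hr0 (hrlt.trans_le (min_le_right _ _))
  have hI₁ : s₁ ∈ Set.Ioo (0 : ℝ) 1 := ⟨hs₁.1, by linarith [hs₁.2]⟩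
  have hI₂ : s₂ ∈ Set.Ioo (0 : ℝ) 1 := ⟨hs₂.1, by linarith [hs₂.2]⟩
  set b := toIcoMod Real.two_pi_pos a b' with hbdef
  have hbI := toIcoMod_mem_Ico Real.two_pi_pos a b'
  have hbexp : Complex.exp (b * Complex.I) = Complex.exp (b' * Complex.I) := by
    have h2 : (b : ℂ) * Complex.I = b' * Complex.I +
        ((-toIcoDiv Real.two_pi_pos a b' : ℤ) : ℂ) * (2 * Real.pi * Complex.I) := by
      rw [hbdef, toIcoMod]
      push_cast [zsmul_eq_mul]
      ring
    rw [h2, Complex.exp_add, Complex.exp_int_mul_two_pi_mul_I, mul_one]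
  -- Equal angles would mean a common point of the two arcs. By `disjoint` this happens only for the
  -- same half-edge, or for the reversed one with parameters adding up to `1`, and both parameters
  -- are below `1 / 2`.
  have hab : a < b := by
    refine lt_of_le_of_ne hbI.1 fun heq => ?_
    have h1 : κ.arc h s₁ = κ.arc g s₂ := by
      rw [ha, hb', ← hbexp, ← heq]
    rcases κ.disjoint g h s₁ hI₁ s₂ hI₂ h1 with ⟨h2, -⟩ | ⟨-, h2⟩
    · exact hne h2.symm
    · linarith [hs₁.2, hs₂.2]
  have hg₁ := h𝔤 h s₁ hI₁
  have hg₂ := h𝔤 g s₂ hI₂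
  -- The counter-clockwise angle from an arc back to the line field is the opposite of its grading,
  -- which is in `(0, π)`; so both intersection degrees are zero.
  exact ⟨hne, hs, D, r, a, b, s₁, s₂, -𝔤.angle h s₁, -𝔤.angle g s₂, 0, 0, hr0,
    hrlt.trans ((min_le_left _ _).trans_lt hr₁'), hab, hbI.2, hI₁, hI₂, ha, by rw [hb', hbexp],
    hs₁', hs₂', ⟨by linarith [hg₁.2], by linarith [hg₁.1]⟩,
    ⟨by linarith [hg₂.2], by linarith [hg₂.1]⟩, 𝔤.rot_neg_mem h hI₁, 𝔤.rot_neg_mem g hI₂,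
    by simp, by simp, by simp⟩

lemma Grading.IsShortestClockwise.isArrowDegree [T2Space M] (h𝔤 : 𝔤.IsShortestClockwise)
    (hη : κ.IsRibbonLineField η) (h : Γ.H) : 𝔤.IsArrowDegree h 0 := by
  by_cases hh : Γ.ρ h = h
  · exact Or.inl ⟨hh, rfl⟩
  · exact Or.inr (h𝔤.hasDegree hη (Ne.symm hh) (Γ.s_ρ h).symm)

end ArcSystem

/-! ## `A_∞`-categories without higher operations -/

namespace GradedQuiver.Seq

variable {k : Type u} [Field k] {G : GradedQuiver.{u, w₁, w₂} k}

lemma length_nil (X : G.Ob) : (nil X : G.Seq X X).length = 0 := by simp only [length]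

lemma length_cons {X Y Z : G.Ob} (p : G.Seq X Y) (a : G.HomogHom Y Z) :
    (p.cons a).length = p.length + 1 := by simp only [length]

lemma length_comp {X Y Z : G.Ob} (p : G.Seq X Y) (q : G.Seq Y Z) :
    (p.comp q).length = p.length + q.length := by
  induction q with
  | nil => rw [comp, length_nil, add_zero]
  | cons q a ih => rw [comp, length_cons, length_cons, ih, add_assoc]

lemma length_add_length_of_mem_splits {X Y : G.Ob} (p : G.Seq X Y)
    {d : Σ Z : G.Ob, G.Seq X Z × G.Seq Z Y} (hd : d ∈ p.splits) :
    d.2.1.length + d.2.2.length = p.length := by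
  induction p with
  | nil =>
    obtain rfl : d = _ := List.mem_singleton.1 (by simpa only [splits] using hd)
    simp only [length_nil]
  | cons p a ih =>
    simp only [splits, List.mem_append, List.mem_map, List.mem_singleton] at hd
    rcases hd with ⟨d', hd', rfl⟩ | rfl
    · rw [length_cons, length_cons, ← ih hd', add_assoc]
    · simp only [length_nil, add_zero]

lemma exists_eq_pair {X Y : G.Ob} (p : G.Seq X Y) (hp : p.length = 2) :
    ∃ (Z : G.Ob) (a : G.HomogHom X Z) (b : G.HomogHom Z Y), p = pair a b := by
  cases p with
  | nil => simp [length_nil] at hp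
  | cons p b =>
    cases p with
    | nil => simp [length_nil, length_cons] at hp
    | cons p a =>
      cases p with
      | nil => exact ⟨_, a, b, rfl⟩
      | cons p c => simp [length_cons] at hp

end GradedQuiver.Seq

lemma GradedQuiver.IsMultilinear.zero_entry {k : Type u} [Field k]
    {G : GradedQuiver.{u, w₁, w₂} k} {μ : ∀ {X Y : G.Ob}, G.Seq X Y → G.Hom X Y}
    (h : GradedQuiver.IsMultilinear μ) {X Y Z W : G.Ob} (p : G.Seq X Y) (a : G.HomogHom Y Z)
    (q : G.Seq Z W) (ha : a.val = 0) : μ ((p.cons a).comp q) = 0 := by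
  obtain ⟨d, a, hd⟩ := a
  subst ha
  simpa using h.smul p d 0 (0 : G.Hom Y Z) hd q

/-- A faithful representation of `A_∞`-data by the dg category of the objects of `D` with a
differential `δ`, up to the signs which relate dg and `A_∞`-categories. -/
structure AInfData.DGModel {k : Type u} [Field k] (A : AInfData.{u, w₁, w₂} k) (D : Type v)
    [Category.{w} D] [Preadditive D] [Linear k D] where
  obj : A.Ob → D
  map : ∀ {X Y : A.Ob}, A.Hom X Y →ₗ[k] (obj X ⟶ obj Y)
  map_injective : ∀ {X Y : A.Ob}, Function.Injective (map : A.Hom X Y →ₗ[k] (obj X ⟶ obj Y))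
  δ : ∀ X, obj X ⟶ obj X
  δ_δ : ∀ X, δ X ≫ δ X = 0
  map_one : ∀ X, map (A.one X) = 𝟙 (obj X)
  one_mem : ∀ X, A.one X ∈ A.gr X X 0
  internal : ∀ X Y, DirectSum.IsInternal (A.gr X Y)
  mem : ∀ {X Y : A.Ob} (p : A.Seq X Y), A.μ p ∈ A.gr X Y (p.deg + 2 - p.length)
  μ_nil : ∀ X, A.μ (.nil X) = 0
  μ_single : ∀ {X Y : A.Ob} (a : A.HomogHom X Y),
    map (A.μ (.single a)) = a.deg.negOnePow • (map a.val ≫ δ Y) - δ X ≫ map a.val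
  μ_pair : ∀ {X Y Z : A.Ob} (a : A.HomogHom X Y) (b : A.HomogHom Y Z),
    map (A.μ (.pair a b)) = a.deg.negOnePow • (map a.val ≫ map b.val)
  μ_long : ∀ {X Y : A.Ob} (p : A.Seq X Y), 3 ≤ p.length → A.μ p = 0

namespace AInfData.DGModel

open GradedQuiver

variable {k : Type u} [Field k] {A : AInfData.{u, w₁, w₂} k} {D : Type v}
    [Category.{w} D] [Preadditive D] [Linear k D] (R : A.DGModel D)

-- Multilinearity needs no separate hypothesis: operations on one or two arguments are faithfully
-- represented by linear expressions in each entry, and the longer ones vanish.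
include R in
lemma isMultilinear : GradedQuiver.IsMultilinear A.μ := by
  constructor
  · intro X Y Z W p d a b ha hb q
    cases p with
    | nil =>
      cases q with
      | nil =>
        apply R.map_injective
        erw [map_add, R.μ_single, R.μ_single, R.μ_single]
        simp only [map_add, Preadditive.add_comp, Preadditive.comp_add, smul_add]
        abel
      | cons q c =>
        cases q with
        | nil =>
          apply R.map_injective
          erw [map_add, R.μ_pair, R.μ_pair, R.μ_pair]
          simp only [map_add, Preadditive.add_comp, smul_add]
        | cons q e =>
          rw [R.μ_long, R.μ_long, R.μ_long, add_zero] <;>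
          · simp only [Seq.length_comp, Seq.length_cons]
            omega
    | cons p c =>
      by_cases hl : p.length + q.length = 0
      · cases p with
        | nil =>
          cases q with
          | nil =>
            apply R.map_injective
            erw [map_add, R.μ_pair, R.μ_pair, R.μ_pair]
            simp only [map_add, Preadditive.comp_add, smul_add]
          | cons q e => simp [Seq.length_cons] at hl
        | cons p e => simp [Seq.length_cons] at hl
      · rw [R.μ_long, R.μ_long, R.μ_long, add_zero] <;>
        · simp only [Seq.length_comp, Seq.length_cons]
          omega
  · intro X Y Z W p d r a ha q
    cases p with
    | nil =>
      cases q with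
      | nil =>
        apply R.map_injective
        erw [map_smul, R.μ_single, R.μ_single]
        simp only [map_smul, Linear.smul_comp, Linear.comp_smul, smul_sub]
        rw [smul_comm]
      | cons q c =>
        cases q with
        | nil =>
          apply R.map_injective
          erw [map_smul, R.μ_pair, R.μ_pair]
          simp only [map_smul, Linear.smul_comp]
          rw [smul_comm]
        | cons q e =>
          rw [R.μ_long, R.μ_long, smul_zero] <;>
          · simp only [Seq.length_comp, Seq.length_cons]
            omega
    | cons p c =>
      by_cases hl : p.length + q.length = 0
      · cases p with
        | nil =>
          cases q with
          | nil =>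
            apply R.map_injective
            erw [map_smul, R.μ_pair, R.μ_pair]
            simp only [map_smul, Linear.comp_smul]
            rw [smul_comm]
          | cons q e => simp [Seq.length_cons] at hl
        | cons p e => simp [Seq.length_cons] at hl
      · rw [R.μ_long, R.μ_long, smul_zero] <;>
        · simp only [Seq.length_comp, Seq.length_cons]
          omega

-- From length four on, the inner or the outer operation has at least three arguments, so every term
-- is zero. In lengths one, two and three the relation is, up to signs, square zero, the Leibniz
-- rule and associativity.
include R in
lemma rel {X Y : A.Ob} (p : A.Seq X Y) :
    (p.splits.map fun d => (d.2.2.splits.map fun e =>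
      if e.2.1.length = 0 then 0 else
        d.2.1.redDeg.negOnePow •
          A.μ ((d.2.1.cons ⟨_, A.μ e.2.1, R.mem e.2.1⟩).comp e.2.2)).sum).sum = 0 := by
  have hm := R.isMultilinear
  have hδ : ∀ {X Y : A.Ob} (f : R.obj X ⟶ R.obj Y), R.δ X ≫ R.δ X ≫ f = 0 := fun f => by
    rw [← Category.assoc, R.δ_δ, Limits.zero_comp]
  have h1 : ∀ n : ℤ, (n + 2 - 1).negOnePow = -n.negOnePow := fun n => by
    rw [show n + 2 - 1 = n + 1 by ring, Int.negOnePow_succ]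
  have h2 : ∀ n : ℤ, (n - 1).negOnePow = -n.negOnePow := fun n => by
    rw [Int.negOnePow_sub, Int.negOnePow_one, mul_neg_one]
  have h3 : ∀ {X Y Z W : A.Ob} (a : A.HomogHom X Y) (b : A.HomogHom Y Z) (c : A.HomogHom Z W),
      A.μ ((((Seq.nil X).cons a).cons b).cons c) = 0 := fun a b c => R.μ_long _ (by
    simp only [Seq.length_cons, Seq.length_nil]
    omega)
  by_cases hp : 4 ≤ p.length
  · refine List.sum_eq_zero fun x hx => ?_
    obtain ⟨d, hd, rfl⟩ := List.mem_map.1 hx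
    refine List.sum_eq_zero fun y hy => ?_
    obtain ⟨e, he, rfl⟩ := List.mem_map.1 hy
    have hl := Seq.length_add_length_of_mem_splits _ hd
    have hl' := Seq.length_add_length_of_mem_splits _ he
    split_ifs with h0
    · rfl
    · by_cases hl3 : 3 ≤ e.2.1.length
      · rw [hm.zero_entry _ _ _ (R.μ_long _ hl3), smul_zero]
      · rw [R.μ_long, smul_zero]
        rw [Seq.length_comp, Seq.length_cons]
        omega
  · cases p with
    | nil => simp [Seq.splits, Seq.length]
    | cons p c =>
      cases p with
      | nil =>
        apply R.map_injective
        simp [Seq.splits, Seq.length, Seq.redDeg, Seq.comp, R.μ_single, Seq.deg, h1, hδ, R.δ_δ]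
      | cons p b =>
        cases p with
        | nil =>
          apply R.map_injective
          simp [Seq.splits, Seq.length, Seq.redDeg, Seq.comp, R.μ_single, R.μ_pair, Seq.deg, h1,
            h2, Int.negOnePow_add]
          rcases Int.units_eq_one_or b.deg.negOnePow with hb | hb <;>
          rcases Int.units_eq_one_or c.deg.negOnePow with hc | hc <;>
            simp [hb, hc] <;> abel
        | cons p a =>
          cases p with
          | nil =>
            apply R.map_injective
            simp [Seq.splits, Seq.length, Seq.redDeg, Seq.comp, R.μ_single, R.μ_pair, Seq.deg,
              h2, h3, Int.negOnePow_add]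
            rcases Int.units_eq_one_or a.deg.negOnePow with ha | ha <;>
            rcases Int.units_eq_one_or b.deg.negOnePow with hb | hb <;> simp [ha, hb]
          | cons p e => simp [Seq.length_cons] at hp

include R in
lemma isAInf : A.IsAInf where
  internal := R.internal
  mem := R.mem
  multilinear := R.isMultilinear
  nil := R.μ_nil
  rel := R.rel
  one_mem := R.one_mem
  one_d X := by
    apply R.map_injective
    rw [R.μ_single, R.map_one]
    simp
  one_right a := by
    apply R.map_injective
    rw [R.μ_pair, R.map_one]
    simp
  one_left a := by
    apply R.map_injective
    rw [Units.smul_def, map_zsmul, ← Units.smul_def, R.μ_pair, R.map_one, smul_smul,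
      Int.units_mul_self]
    simp
  one_higher p q h := R.μ_long _ (by
    rw [Seq.length_comp, Seq.length_cons]
    omega)

end AInfData.DGModel

/-! ## Twisted complexes over a linear category -/

open Limits

/-- Meant for matrix spaces: each entry lives in a single degree `e i`, and several entries may
share a degree. Finitely many entry projections then replace one projection for each integer. -/
lemma DirectSum.isInternal_of_components {k : Type u} [Field k] {V : Type v} [AddCommGroup V]
    [Module k V] (gr : ℤ → Submodule k V) {I : Type w} [Fintype I] (e : I → ℤ) (c : I → V →ₗ[k] V)
    (hsum : ∀ x, ∑ i, c i x = x) (hmem : ∀ i x, c i x ∈ gr (e i))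
    (hzero : ∀ i d, d ≠ e i → ∀ x ∈ gr d, c i x = 0) : DirectSum.IsInternal gr := by
  classical
  refine ⟨?_, fun x => ?_⟩
  · rw [injective_iff_map_eq_zero]
    intro x hx
    have h1 : ∀ i, c i (x (e i)) = 0 := by
      intro i
      have h2 := congrArg (c i) hx
      rw [map_zero, DirectSum.coeAddMonoidHom_eq_dfinsuppSum, DFinsupp.sum, map_sum,
        Finset.sum_eq_single (e i)] at h2
      · exact h2
      · intro d _ hd
        exact hzero i d hd _ (x d).2
      · intro h
        rw [DFinsupp.notMem_support_iff.1 h]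
        simp
    refine DFinsupp.ext fun d => Subtype.ext ?_
    rw [← hsum (x d)]
    refine Finset.sum_eq_zero fun i _ => ?_
    by_cases hd : d = e i
    · subst hd
      exact h1 i
    · exact hzero i d hd _ (x d).2
  · refine ⟨∑ i, DirectSum.of (fun d => gr d) (e i) ⟨c i x, hmem i x⟩, ?_⟩
    rw [map_sum]
    simpa using hsum x

/-- A fully faithful representation of `A_∞`-data in degree zero without higher operations
in a linear category. -/
structure AInfData.LinearModel {k : Type u} [Field k] (A : AInfData.{u, w₁, w₂} k) (C : Type v)
    [Category.{w} C] [Preadditive C] [Linear k C] where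
  obj : A.Ob → C
  map : ∀ {X Y : A.Ob}, A.Hom X Y ≃ₗ[k] (obj X ⟶ obj Y)
  gr_zero : ∀ X Y, A.gr X Y 0 = ⊤
  gr_ne : ∀ X Y (d : ℤ), d ≠ 0 → A.gr X Y d = ⊥
  map_one : ∀ X, map (A.one X) = 𝟙 (obj X)
  map_pair : ∀ {X Y Z : A.Ob} (a : A.HomogHom X Y) (b : A.HomogHom Y Z),
    map (A.μ (.pair a b)) = map a.val ≫ map b.val
  μ_eq_zero : ∀ {X Y : A.Ob} (p : A.Seq X Y), p.length ≠ 2 → A.μ p = 0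

namespace AInfData.LinearModel

open GradedQuiver

variable {k : Type u} [Field k] {A : AInfData.{u, w₁, w₂} k} {C : Type v}
    [Category.{w} C] [Preadditive C] [Linear k C] (R : A.LinearModel C)

include R in
lemma eq_zero_of_mem {X Y : A.Ob} {d : ℤ} {a : A.Hom X Y} (ha : a ∈ A.gr X Y d) (hd : d ≠ 0) :
    a = 0 := by
  rwa [R.gr_ne X Y d hd, Submodule.mem_bot] at ha

include R in
lemma mem_gr_zero {X Y : A.Ob} (a : A.Hom X Y) : a ∈ A.gr X Y 0 := by
  rw [R.gr_zero]
  exact Submodule.mem_top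

/-- The representation, as a representation with trivial differentials. -/
def toDGModel : A.DGModel C where
  obj := R.obj
  map := R.map.toLinearMap
  map_injective := fun h => R.map.injective h
  δ _ := 0
  δ_δ _ := zero_comp
  map_one := R.map_one
  one_mem X := R.mem_gr_zero _
  internal X Y := DirectSum.isInternal_of_components (A.gr X Y) (I := Unit) (fun _ => 0)
    (fun _ => LinearMap.id) (by simp) (fun _ x => R.mem_gr_zero x)
    (fun _ d hd x hx => R.eq_zero_of_mem hx hd)
  mem p := by
    by_cases hp : p.length = 2
    · obtain ⟨Z, a, b, rfl⟩ := p.exists_eq_pair hp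
      -- If an entry has nonzero degree it is zero, and so is the product; otherwise the target
      -- degree is zero and imposes no condition.
      by_cases ha : a.deg = 0
      · by_cases hb : b.deg = 0
        · rw [hp, show (Seq.pair a b).deg + 2 - ((2 : ℕ) : ℤ) = 0 by simp [Seq.deg, ha, hb]]
          exact R.mem_gr_zero _
        · have : A.μ (.pair a b) = 0 := R.map.injective (by
            rw [R.map_pair, R.eq_zero_of_mem b.mem hb, map_zero, comp_zero, map_zero])
          rw [this]
          exact zero_mem _
      · have : A.μ (.pair a b) = 0 := R.map.injective (by
          rw [R.map_pair, R.eq_zero_of_mem a.mem ha, map_zero, zero_comp, map_zero])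
        rw [this]
        exact zero_mem _
    · rw [R.μ_eq_zero p hp]
      exact zero_mem _
  μ_nil X := R.μ_eq_zero _ (by simp [Seq.length_nil])
  μ_single a := by
    rw [R.μ_eq_zero _ (by simp [Seq.length_nil, Seq.length_cons])]
    simp
  μ_pair a b := by
    change R.map _ = _ • (R.map _ ≫ R.map _)
    rw [R.map_pair]
    by_cases ha : a.deg = 0
    · rw [ha, Int.negOnePow_zero, one_smul]
    · rw [R.eq_zero_of_mem a.mem ha, map_zero, zero_comp, smul_zero]
  μ_long p hp := R.μ_eq_zero p (by omega)

end AInfData.LinearModel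

/-! ### Sums over chains of differentials -/

namespace AInfData.PreTw

open GradedQuiver

variable {k : Type u} [Field k] {A : AInfData.{u, w₁, w₂} k} (E : A.PreTw) {N : Type w}
  [AddCommMonoid N]

lemma _root_.List.sum_map_flatMap {α β : Type*} (l : List α) (f : α → List β) (G : β → N) :
    ((l.flatMap f).map G).sum = (l.map fun x => ((f x).map G).sum).sum := by
  induction l with
  | nil => rfl
  | cons a l ih => simp [ih]

lemma length_of_mem_chainsOfLength (σ : ℤ) (n : ℕ) (i j : E.ι)
    {c : ℤ × A.Seq (E.ob i) (E.ob j)} (hc : c ∈ E.chainsOfLength σ n i j) : c.2.length = n := by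
  induction n generalizing j with
  | zero =>
    rw [chainsOfLength] at hc
    split_ifs at hc with h
    · subst h
      obtain rfl : c = _ := List.mem_singleton.1 hc
      exact Seq.length_nil _
    · simp at hc
  | succ n ih =>
    rw [chainsOfLength] at hc
    obtain ⟨l, -, hl⟩ := List.mem_flatMap.1 hc
    obtain ⟨c', hc', rfl⟩ := List.mem_map.1 hl
    rw [Seq.length_cons, ih l hc']

lemma sum_chainsOfLength_zero (σ : ℤ) (i j : E.ι) (G : ℤ × A.Seq (E.ob i) (E.ob j) → N) :
    ((E.chainsOfLength σ 0 i j).map G).sum =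
      if h : i = j then G (0, .nilOfEq (congrArg E.ob h)) else 0 := by
  rw [chainsOfLength]
  split_ifs <;> simp

lemma sum_chainsOfLength_succ (σ : ℤ) (n : ℕ) (i j : E.ι)
    (G : ℤ × A.Seq (E.ob i) (E.ob j) → N) :
    ((E.chainsOfLength σ (n + 1) i j).map G).sum =
      ∑ l, if l < j then ((E.chainsOfLength σ n i l).map fun c =>
        G (c.1 + (σ - E.shift l) * (E.shift j - E.shift l),
          c.2.cons ⟨_, E.δ l j, E.δ_mem l j⟩)).sum else 0 := by
  rw [chainsOfLength, List.sum_map_flatMap, Finset.sum_map_toList, Finset.sum_filter]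
  simp only [List.map_map, Function.comp_def]

lemma sum_chainsOfLength_one (σ : ℤ) (i j : E.ι) (G : ℤ × A.Seq (E.ob i) (E.ob j) → N) :
    ((E.chainsOfLength σ 1 i j).map G).sum =
      if i < j then G ((σ - E.shift i) * (E.shift j - E.shift i),
        .single ⟨_, E.δ i j, E.δ_mem i j⟩) else 0 := by
  rw [sum_chainsOfLength_succ, Finset.sum_eq_single i]
  · rw [sum_chainsOfLength_zero, dif_pos rfl]
    simp only [zero_add]
    rfl
  · intro l _ hl
    rw [sum_chainsOfLength_zero, dif_neg hl.symm, ite_self]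
  · exact fun h => absurd (Finset.mem_univ i) h

lemma sum_chains_eq_sum_range (σ : ℤ) (i j : E.ι) (G : ℤ × A.Seq (E.ob i) (E.ob j) → N) :
    ((E.chains σ i j).map G).sum =
      ∑ n ∈ Finset.range (Fintype.card E.ι + 1), ((E.chainsOfLength σ n i j).map G).sum := by
  rw [chains, List.sum_map_flatMap, Finset.sum_range, ← List.sum_ofFn, List.ofFn_eq_map,
    ← List.map_coe_finRange_eq_range, List.map_map]
  rfl

lemma sum_chainsOfLength_eq_zero (σ : ℤ) (n : ℕ) (i j : E.ι)
    (G : ℤ × A.Seq (E.ob i) (E.ob j) → N) (hG : ∀ c, c.2.length = n → G c = 0) :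
    ((E.chainsOfLength σ n i j).map G).sum = 0 := by
  refine List.sum_eq_zero fun x hx => ?_
  obtain ⟨c, hc, rfl⟩ := List.mem_map.1 hx
  exact hG c (E.length_of_mem_chainsOfLength σ n i j hc)

/-- For a category with only binary products, at most one `δ` can be inserted at a given place. This
leaves the empty chain and a single `δ`. -/
lemma sum_chains (σ : ℤ) (i j : E.ι) (G : ℤ × A.Seq (E.ob i) (E.ob j) → N)
    (hG : ∀ c, 2 ≤ c.2.length → G c = 0) :
    ((E.chains σ i j).map G).sum =
      (if h : i = j then G (0, .nilOfEq (congrArg E.ob h)) else 0) +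
      if i < j then G ((σ - E.shift i) * (E.shift j - E.shift i),
        .single ⟨_, E.δ i j, E.δ_mem i j⟩) else 0 := by
  -- With at least one index, both lengths `0` and `1` occur in the range over which chains are
  -- listed.
  have : Nonempty E.ι := ⟨i⟩
  obtain ⟨n, hn⟩ := Nat.exists_eq_succ_of_ne_zero (Fintype.card_ne_zero (α := E.ι))
  rw [sum_chains_eq_sum_range, hn, Finset.sum_range_succ', Finset.sum_range_succ',
    Finset.sum_eq_zero fun n _ => E.sum_chainsOfLength_eq_zero σ _ i j G
      fun c hc => hG c (by omega), zero_add, zero_add, sum_chainsOfLength_one,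
      sum_chainsOfLength_zero, add_comm]

/-- For the `δ`s inserted before a morphism, where the end of the chain is summed over;
`sum_chains_right` serves for those inserted after it. -/
lemma sum_chains_left (σ : ℤ) (i : E.ι) (G : ∀ j, ℤ × A.Seq (E.ob i) (E.ob j) → N)
    (hG : ∀ j c, 2 ≤ c.2.length → G j c = 0) :
    ∑ j, ((E.chains σ i j).map (G j)).sum =
      G i (0, .nil _) + ∑ j, if i < j then G j ((σ - E.shift i) * (E.shift j - E.shift i),
        .single ⟨_, E.δ i j, E.δ_mem i j⟩) else 0 := by
  simp only [fun j => E.sum_chains σ i j (G j) (hG j), Finset.sum_add_distrib]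
  congr 1
  rw [Finset.sum_eq_single i]
  · rw [dif_pos rfl]
    rfl
  · exact fun l _ hl => dif_neg hl.symm
  · exact fun h => absurd (Finset.mem_univ i) h

lemma sum_chains_right (σ : ℤ) (j : E.ι) (G : ∀ i, ℤ × A.Seq (E.ob i) (E.ob j) → N)
    (hG : ∀ i c, 2 ≤ c.2.length → G i c = 0) :
    ∑ i, ((E.chains σ i j).map (G i)).sum =
      G j (0, .nil _) + ∑ i, if i < j then G i ((σ - E.shift i) * (E.shift j - E.shift i),
        .single ⟨_, E.δ i j, E.δ_mem i j⟩) else 0 := by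
  simp only [fun i => E.sum_chains σ i j (G i) (hG i), Finset.sum_add_distrib]
  congr 1
  rw [Finset.sum_eq_single j]
  · rw [dif_pos rfl]
    rfl
  · exact fun l _ hl => dif_neg hl
  · exact fun h => absurd (Finset.mem_univ j) h

end AInfData.PreTw

/-! ### Operations on twisted complexes over a category in degree zero -/

namespace AInfData.LinearModel

open GradedQuiver

variable {k : Type u} [Field k] {A : AInfData.{u, w₁, w₂} k} {C : Type v}
    [Category.{w} C] [Preadditive C] [Linear k C] (R : A.LinearModel C)

/-- The contribution of a sequence to the operations of twisted complexes. -/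
def ev {X Y : A.Ob} (c : ℤ × A.Seq X Y) : R.obj X ⟶ R.obj Y :=
  c.1.negOnePow • R.map (A.μ c.2)

lemma ev_eq_zero {X Y : A.Ob} (c : ℤ × A.Seq X Y) (hc : c.2.length ≠ 2) : R.ev c = 0 := by
  rw [ev, R.μ_eq_zero _ hc, map_zero, smul_zero]

lemma ev_pair {X Y Z : A.Ob} (n : ℤ) (a : A.HomogHom X Y) (b : A.HomogHom Y Z) :
    R.ev (n, .pair a b) = n.negOnePow • (R.map a.val ≫ R.map b.val) := by
  rw [ev, R.map_pair]

lemma map_sum_negOnePow {X Y : A.Ob} (l : List (ℤ × A.Seq X Y)) :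
    R.map ((l.map fun c => c.1.negOnePow • A.μ c.2).sum) = (l.map R.ev).sum := by
  rw [map_list_sum, List.map_map]
  congr 2
  funext c
  simp only [Function.comp_apply, Units.smul_def, map_zsmul, ev]

/-- The Maurer-Cartan equation says that `δ` is a differential. -/
lemma mc_iff (E : A.PreTw) :
    E.MC ↔ ∀ i j, ∑ l, R.map (E.δ i l) ≫ R.map (E.δ l j) = 0 := by
  refine forall₂_congr fun i j => ?_
  rw [← R.map.map_eq_zero_iff, R.map_sum_negOnePow, PreTw.sum_chains_eq_sum_range]
  have h1 : ∑ n ∈ Finset.range (Fintype.card E.ι + 1),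
      ((E.chainsOfLength (E.shift i) n i j).map R.ev).sum =
      ((E.chainsOfLength (E.shift i) 2 i j).map R.ev).sum := by
    -- Only products of two `δ`s survive. If there is at most one index, length two is missing from
    -- the range, but then there are no strictly increasing chains of that length either.
    refine Finset.sum_eq_single 2
      (fun n _ hn => E.sum_chainsOfLength_eq_zero _ n i j _ fun c hc => R.ev_eq_zero c (hc ▸ hn))
      fun h => ?_
    have hc : Fintype.card E.ι ≤ 1 := by
      rw [Finset.mem_range] at h
      omega
    have := Fintype.card_le_one_iff_subsingleton.1 hc
    rw [PreTw.sum_chainsOfLength_succ]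
    exact Finset.sum_eq_zero fun l _ => if_neg fun h => h.ne (Subsingleton.elim _ _)
  have h2 : ((E.chainsOfLength (E.shift i) 2 i j).map R.ev).sum =
      -∑ l, R.map (E.δ i l) ≫ R.map (E.δ l j) := by
    rw [PreTw.sum_chainsOfLength_succ, ← Finset.sum_neg_distrib]
    refine Finset.sum_congr rfl fun l _ => ?_
    rw [PreTw.sum_chainsOfLength_one]
    split_ifs with h h'
    · rw [ev_pair]
      -- A nonzero entry of `δ` lowers the shift by exactly one, since the morphisms of `A` have
      -- degree zero. The sign exponent is then always `-1`.
      by_cases h3 : E.shift l - E.shift i + 1 = 0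
      · by_cases h4 : E.shift j - E.shift l + 1 = 0
        · rw [show (E.shift i - E.shift i) * (E.shift l - E.shift i) +
            (E.shift i - E.shift l) * (E.shift j - E.shift l) = -1 by
              rw [show E.shift i - E.shift l = 1 by omega,
                show E.shift j - E.shift l = -1 by omega]
              ring]
          simp
        · simp [R.eq_zero_of_mem (E.δ_mem l j) h4]
      · simp [R.eq_zero_of_mem (E.δ_mem i l) h3]
    · rw [E.δ_strict i l h', map_zero, zero_comp, neg_zero]
    · rw [E.δ_strict l j h, map_zero, comp_zero, neg_zero]
  rw [h1, h2, neg_eq_zero]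

/-- The contributions to operations with one argument. -/
lemma sum_twExpand_single {N : Type*} [AddCommMonoid N] {E F : A.twQuiver.Ob}
    (f : A.twQuiver.HomogHom E F) (i : E.1.ι) (j : F.1.ι)
    (K : ℤ × A.Seq (E.1.ob i) (F.1.ob j) → N) (hK : ∀ c, 3 ≤ c.2.length → K c = 0) :
    ((twExpand (.single f) i j).map K).sum =
      K (0, .single (twComponent f i j)) +
      (∑ l, if l < j then K ((E.1.shift i - F.1.shift l) * (F.1.shift j - F.1.shift l),
        .pair (twComponent f i l) ⟨_, F.1.δ l j, F.1.δ_mem l j⟩) else 0) +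
      ∑ m, if i < m then K ((E.1.shift i - E.1.shift m) * ((twComponent f m j).deg - 1),
        .pair ⟨_, E.1.δ i m, E.1.δ_mem i m⟩ (twComponent f m j)) else 0 := by
  rw [twExpand, List.sum_map_flatMap, Finset.sum_map_toList]
  simp only [List.sum_map_flatMap, Finset.sum_map_toList]
  rw [Finset.sum_comm]
  simp only [List.map_map, Function.comp_def, twExpand]
  have hl : ∀ (n : ℤ) {X Y Z W : A.Ob} (p : A.Seq X Y) (a : A.HomogHom Y Z) (q : A.Seq Z W),
      ((n, (p.cons a).comp q) : ℤ × A.Seq X W).2.length = p.length + 1 + q.length := by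
    intro n X Y Z W p a q
    rw [Seq.length_comp, Seq.length_cons]
  -- The functional `K` kills sequences of three or more morphisms, so a `δ` occurs on at most one
  -- side of `f`. Keeping `K` arbitrary lets the same computation serve as the inner part of the
  -- binary operation.
  have h1 := fun l : F.1.ι => E.1.sum_chains_left (E.1.shift i) i
    (fun m q => ((F.1.chains (E.1.shift i) l j).map fun c =>
      K (q.1 + (E.1.shift i - E.1.shift m) * ((twComponent f m l).deg - 1) + c.1,
        (q.2.cons (twComponent f m l)).comp c.2)).sum) (fun m q hq =>
          List.sum_eq_zero fun x hx => by
            obtain ⟨c, -, rfl⟩ := List.mem_map.1 hx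
            exact hK _ (by rw [hl]; omega))
  rw [Finset.sum_congr rfl fun l _ => h1 l, Finset.sum_add_distrib]
  congr 1
  · rw [F.1.sum_chains_right]
    · simp [Seq.comp]
    · intro l c hc
      exact hK _ (by rw [hl]; omega)
  · rw [Finset.sum_comm]
    refine Finset.sum_congr rfl fun m _ => ?_
    split_ifs with him
    · rw [F.1.sum_chains_right]
      · rw [Finset.sum_eq_zero, add_zero]
        · simp [Seq.comp]
        · intro l _
          split_ifs
          · exact hK _ (by simp [Seq.length_comp, Seq.length_cons, Seq.length_nil])
          · rfl
      · intro l c hc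
        exact hK _ (by rw [hl]; omega)
    · exact Finset.sum_const_zero

lemma le_length_of_mem_twExpand {E F : A.twQuiver.Ob} (p : A.twQuiver.Seq E F) (i : E.1.ι)
    (j : F.1.ι) {c : ℤ × A.Seq (E.1.ob i) (F.1.ob j)} (hc : c ∈ twExpand p i j) :
    p.length ≤ c.2.length := by
  induction p with
  | nil => rw [Seq.length_nil]; exact Nat.zero_le _
  | cons p f ih =>
    rw [twExpand] at hc
    obtain ⟨m, -, hc⟩ := List.mem_flatMap.1 hc
    obtain ⟨l, -, hc⟩ := List.mem_flatMap.1 hc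
    obtain ⟨q, hq, hc⟩ := List.mem_flatMap.1 hc
    obtain ⟨c, hc, rfl⟩ := List.mem_map.1 hc
    rw [Seq.length_comp, Seq.length_cons, Seq.length_cons]
    have := ih m hq
    omega

/-- The operations of the category of twisted complexes. -/
def _root_.AInfData.twμ {E F : A.twQuiver.Ob} (p : A.twQuiver.Seq E F) : A.twQuiver.Hom E F :=
  A.tw.μ p

/-- The entries that contribute have prescribed differences of shifts. This replaces the Koszul
exponents, which depend on the summands, by the sign of the degree of `f` and a constant sign. -/
lemma map_tw_single {E F : A.twQuiver.Ob} (f : A.twQuiver.HomogHom E F) (i : E.1.ι) (j : F.1.ι) :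
    R.map (twμ (.single f) i j) =
      f.deg.negOnePow • (∑ l, R.map (f.val i l) ≫ R.map (F.1.δ l j)) -
        ∑ m, R.map (E.1.δ i m) ≫ R.map (f.val m j) := by
  change R.map (((twExpand (.single f) i j).map fun c => c.1.negOnePow • A.μ c.2).sum) = _
  rw [R.map_sum_negOnePow, sum_twExpand_single f i j R.ev fun c hc => R.ev_eq_zero c (by omega),
    R.ev_eq_zero _ (by simp [Seq.length_cons, Seq.length_nil]), zero_add, sub_eq_add_neg,
    Finset.smul_sum, ← Finset.sum_neg_distrib]
  congr 1
  · refine Finset.sum_congr rfl fun l _ => ?_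
    split_ifs with h
    · rw [ev_pair]
      change _ • (R.map (f.val i l) ≫ R.map (F.1.δ l j)) = _
      by_cases h3 : f.deg + F.1.shift l - E.1.shift i = 0
      · by_cases h4 : F.1.shift j - F.1.shift l + 1 = 0
        · rw [show E.1.shift i - F.1.shift l = f.deg by omega,
            show F.1.shift j - F.1.shift l = -1 by omega, mul_neg_one, Int.negOnePow_neg]
        · simp [R.eq_zero_of_mem (F.1.δ_mem l j) h4]
      · simp [R.eq_zero_of_mem (mem_twGr.1 f.mem i l) h3]
    · rw [F.1.δ_strict l j h, map_zero, comp_zero, smul_zero]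
  · refine Finset.sum_congr rfl fun m _ => ?_
    split_ifs with h
    · rw [ev_pair]
      change _ • (R.map (E.1.δ i m) ≫ R.map (f.val m j)) = _
      by_cases h3 : f.deg + F.1.shift j - E.1.shift m = 0
      · by_cases h4 : E.1.shift m - E.1.shift i + 1 = 0
        · rw [show (twComponent f m j).deg = 0 from h3,
            show E.1.shift i - E.1.shift m = 1 by omega]
          simp
        · simp [R.eq_zero_of_mem (E.1.δ_mem i m) h4]
      · simp [R.eq_zero_of_mem (mem_twGr.1 f.mem m j) h3]
    · rw [E.1.δ_strict i m h, map_zero, zero_comp, neg_zero]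

lemma map_tw_pair {E F G : A.twQuiver.Ob} (f : A.twQuiver.HomogHom E F)
    (g : A.twQuiver.HomogHom F G) (i : E.1.ι) (j : G.1.ι) :
    R.map (twμ (.pair f g) i j) =
      f.deg.negOnePow • ∑ l, R.map (f.val i l) ≫ R.map (g.val l j) := by
  change R.map (((twExpand (.pair f g) i j).map fun c => c.1.negOnePow • A.μ c.2).sum) = _
  rw [R.map_sum_negOnePow, twExpand, List.sum_map_flatMap, Finset.sum_map_toList,
    Finset.smul_sum]
  refine Finset.sum_congr rfl fun m _ => ?_
  simp only [List.sum_map_flatMap, Finset.sum_map_toList, List.map_map, Function.comp_def]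
  have hl : ∀ (n : ℤ) {X Y Z W : A.Ob} (p : A.Seq X Y) (a : A.HomogHom Y Z) (q : A.Seq Z W),
      ((n, (p.cons a).comp q) : ℤ × A.Seq X W).2.length = p.length + 1 + q.length := by
    intro n X Y Z W p a q
    rw [Seq.length_comp, Seq.length_cons]
  -- Here the functional appends `g` and its trailing `δ`s to a sequence. It vanishes once two
  -- morphisms are already present, so no `δ` can be inserted at all.
  have h1 := fun l : G.1.ι => sum_twExpand_single f i m
    (fun q => ((G.1.chains (E.1.shift i) l j).map fun c =>
      R.ev (q.1 + (E.1.shift i - F.1.shift m) * ((twComponent g m l).deg - 1) + c.1,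
        (q.2.cons (twComponent g m l)).comp c.2)).sum) (fun q hq =>
          List.sum_eq_zero fun x hx => by
            obtain ⟨c, -, rfl⟩ := List.mem_map.1 hx
            exact R.ev_eq_zero _ (by rw [hl]; omega))
  have h2 : ∀ (l : G.1.ι) (q : ℤ × A.Seq (E.1.ob i) (F.1.ob m)), 2 ≤ q.2.length →
      ((G.1.chains (E.1.shift i) l j).map fun c =>
        R.ev (q.1 + (E.1.shift i - F.1.shift m) * ((twComponent g m l).deg - 1) + c.1,
          (q.2.cons (twComponent g m l)).comp c.2)).sum = 0 := fun l q hq =>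
    List.sum_eq_zero fun x hx => by
      obtain ⟨c, -, rfl⟩ := List.mem_map.1 hx
      exact R.ev_eq_zero _ (by rw [hl]; omega)
  rw [Finset.sum_congr rfl fun l _ => h1 l]
  have h3 : ∀ {X Y Z : A.Ob} (a : A.HomogHom X Y) (b : A.HomogHom Y Z),
      2 ≤ (Seq.pair a b).length := fun a b => by
    simp only [Seq.length_cons, Seq.length_nil]
    omega
  rw [Finset.sum_congr rfl fun l _ => by
    rw [Finset.sum_eq_zero (s := Finset.univ) fun l' _ => by
        split_ifs
        · exact h2 l _ (h3 _ _)
        · rfl,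
      Finset.sum_eq_zero (s := Finset.univ) fun m' _ => by
        split_ifs
        · exact h2 l _ (h3 _ _)
        · rfl, add_zero, add_zero]]
  rw [G.1.sum_chains_right]
  · rw [Finset.sum_eq_zero, add_zero]
    · rw [Seq.comp, ev_pair]
      change _ • (R.map (f.val i m) ≫ R.map (g.val m j)) = _
      -- For nonzero entries the exponent becomes `-f.deg`, which gives the sign of `f.deg`.
      by_cases h4 : f.deg + F.1.shift m - E.1.shift i = 0
      · by_cases h5 : g.deg + G.1.shift j - F.1.shift m = 0
        · rw [show (twComponent g m j).deg = 0 from h5,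
            show E.1.shift i - F.1.shift m = f.deg by omega]
          simp
        · simp [R.eq_zero_of_mem (mem_twGr.1 g.mem m j) h5]
      · simp [R.eq_zero_of_mem (mem_twGr.1 f.mem i m) h4]
    · intro l _
      split_ifs
      · exact R.ev_eq_zero _ (by simp [Seq.length_comp, Seq.length_cons, Seq.length_nil])
      · rfl
  · intro l c hc
    exact R.ev_eq_zero _ (by
      rw [hl]
      simp only [Seq.length_cons, Seq.length_nil]
      omega)

include R in
lemma tw_long {E F : A.twQuiver.Ob} (p : A.twQuiver.Seq E F) (hp : 3 ≤ p.length) :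
    twμ p = 0 := by
  funext i j
  refine List.sum_eq_zero fun x hx => ?_
  obtain ⟨c, hc, rfl⟩ := List.mem_map.1 hx
  have := le_length_of_mem_twExpand p i j hc
  rw [R.μ_eq_zero _ (by omega), smul_zero]

/-- Without arguments only chains of `δ`s are summed, so absence of curvature is the Maurer-Cartan
equation itself. -/
lemma tw_nil (E : A.twQuiver.Ob) : twμ (.nil E) = 0 := by
  funext i j
  change ((twExpand (.nil E) i j).map fun c => c.1.negOnePow • A.μ c.2).sum = 0
  rw [twExpand]
  exact E.2 i j

-- Because `A` lives in degree zero, the entry from summand `i` to summand `j` is homogeneous of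
-- degree `k_i - l_j` only, in terms of their shifts.
include R in
lemma twGr_isInternal (E F : A.twQuiver.Ob) : DirectSum.IsInternal (A.twQuiver.gr E F) := by
  classical
  refine DirectSum.isInternal_of_components _ (I := E.1.ι × F.1.ι)
    (fun p => E.1.shift p.1 - F.1.shift p.2)
    (fun p => LinearMap.single k _ p.1 ∘ₗ LinearMap.single k _ p.2 ∘ₗ LinearMap.proj p.2 ∘ₗ
      LinearMap.proj p.1) ?_ ?_ ?_
  · intro f
    rw [Fintype.sum_prod_type]
    change ∑ x, ∑ y, LinearMap.single k (fun i => ∀ j, A.Hom (E.1.ob i) (F.1.ob j)) x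
      (LinearMap.single k (fun j => A.Hom (E.1.ob x) (F.1.ob j)) y (f x y)) = f
    have h : ∀ x, ∑ y, LinearMap.single k (fun j => A.Hom (E.1.ob x) (F.1.ob j)) y (f x y) =
      f x := fun x => Finset.univ_sum_single (f x)
    simp only [← map_sum, h]
    exact Finset.univ_sum_single f
  · intro p f
    rw [mem_twGr]
    intro i j
    change (Pi.single (M := fun i => ∀ j, A.Hom (E.1.ob i) (F.1.ob j)) p.1
      (Pi.single (M := fun j => A.Hom (E.1.ob p.1) (F.1.ob j)) p.2 (f p.1 p.2))) i j ∈ _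
    by_cases hi : i = p.1
    · subst hi
      rw [Pi.single_eq_same]
      by_cases hj : j = p.2
      · subst hj
        rw [Pi.single_eq_same, sub_add_cancel, sub_self]
        exact R.mem_gr_zero _
      · rw [Pi.single_eq_of_ne hj]
        exact zero_mem _
    · rw [Pi.single_eq_of_ne hi]
      exact zero_mem _
  · intro p d hd f hf
    have := R.eq_zero_of_mem (mem_twGr.1 hf p.1 p.2) (by omega)
    simp [this]

include R in
lemma mem_gr_of_ne_zero {X Y : A.Ob} {d : ℤ} {a : A.Hom X Y} (h : d ≠ 0 → a = 0) :
    a ∈ A.gr X Y d := by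
  by_cases hd : d = 0
  · subst hd
    exact R.mem_gr_zero a
  · rw [h hd]
    exact zero_mem _

include R in
lemma unitMatrix_mem (E : A.twQuiver.Ob) :
    (A.unitMatrix E.1.ob : A.twQuiver.Hom E E) ∈ A.twQuiver.gr E E 0 := by
  refine mem_twGr.2 fun i j => R.mem_gr_of_ne_zero fun hd => ?_
  rw [unitMatrix, dif_neg]
  rintro rfl
  omega

include R in
lemma twμ_mem {E F : A.twQuiver.Ob} (p : A.twQuiver.Seq E F) :
    twμ p ∈ A.twQuiver.gr E F (p.deg + 2 - p.length) := by
  cases p with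
  | nil =>
    rw [tw_nil]
    exact zero_mem _
  | cons p g =>
    cases p with
    | nil =>
      refine mem_twGr.2 fun i j => R.mem_gr_of_ne_zero fun hd => R.map.injective ?_
      have hd' : g.deg + 1 + F.1.shift j - E.1.shift i ≠ 0 := by
        simp only [Seq.deg, Seq.length] at hd
        push_cast at hd
        omega
      rw [R.map_tw_single, map_zero, Finset.sum_eq_zero, Finset.sum_eq_zero, smul_zero, sub_zero]
      · intro m _
        by_cases h1 : E.1.shift m - E.1.shift i + 1 = 0
        · rw [R.eq_zero_of_mem (mem_twGr.1 g.mem m j) (by omega), map_zero, comp_zero]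
        · rw [R.eq_zero_of_mem (E.1.δ_mem i m) h1, map_zero, zero_comp]
      · intro l _
        by_cases h1 : F.1.shift j - F.1.shift l + 1 = 0
        · rw [R.eq_zero_of_mem (mem_twGr.1 g.mem i l) (by omega), map_zero, zero_comp]
        · rw [R.eq_zero_of_mem (F.1.δ_mem l j) h1, map_zero, comp_zero]
    | cons p f =>
      cases p with
      | nil =>
        refine mem_twGr.2 fun i j => R.mem_gr_of_ne_zero fun hd => R.map.injective ?_
        have hd' : f.deg + g.deg + F.1.shift j - E.1.shift i ≠ 0 := by
          simp only [Seq.deg, Seq.length] at hd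
          push_cast at hd
          omega
        rw [R.map_tw_pair, map_zero, Finset.sum_eq_zero, smul_zero]
        intro l _
        by_cases h1 : f.deg + PreTw.shift _ l - E.1.shift i = 0
        · rw [R.eq_zero_of_mem (mem_twGr.1 g.mem l j) (by omega), map_zero, comp_zero]
        · rw [R.eq_zero_of_mem (mem_twGr.1 f.mem i l) h1, map_zero, zero_comp]
      | cons p e =>
        rw [R.tw_long _ (by simp only [Seq.length_cons]; omega)]
        exact zero_mem _

/-! ### Twisted complexes as biproducts with a differential -/

variable [HasFiniteBiproducts C]

/-- The sum of the summands of a twisted complex. -/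
abbrev total (E : A.PreTw) : C := ⨁ fun i => R.obj (E.ob i)

/-- The morphism between the total objects with given components. -/
def matrix {E F : A.PreTw} :
    (∀ i j, A.Hom (E.ob i) (F.ob j)) ≃ₗ[k] (R.total E ⟶ R.total F) where
  toFun f := biproduct.matrix fun i j => R.map (f i j)
  map_add' f g := by
    refine biproduct.hom_ext' _ _ fun i => biproduct.hom_ext _ _ fun j => ?_
    simp
  map_smul' c f := by
    refine biproduct.hom_ext' _ _ fun i => biproduct.hom_ext _ _ fun j => ?_
    simp
  invFun m i j := R.map.symm (biproduct.components m i j)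
  left_inv f := by
    funext i j
    simp
  right_inv m := by
    simp

lemma ι_matrix_π {E F : A.PreTw} (f : ∀ i j, A.Hom (E.ob i) (F.ob j)) (i : E.ι) (j : F.ι) :
    biproduct.ι (fun i => R.obj (E.ob i)) i ≫ R.matrix f ≫ biproduct.π _ j = R.map (f i j) := by
  simp [matrix]

lemma matrix_comp {E F G : A.PreTw} (f : ∀ i j, A.Hom (E.ob i) (F.ob j))
    (g : ∀ i j, A.Hom (F.ob i) (G.ob j)) (i : E.ι) (j : G.ι) :
    biproduct.ι (fun i => R.obj (E.ob i)) i ≫ (R.matrix f ≫ R.matrix g) ≫ biproduct.π _ j =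
      ∑ l, R.map (f i l) ≫ R.map (g l j) := by
  simp [matrix, biproduct.lift_desc]

lemma matrix_unitMatrix (E : A.PreTw) : R.matrix (A.unitMatrix E.ob) = 𝟙 (R.total E) := by
  classical
  refine biproduct.hom_ext' _ _ fun i => biproduct.hom_ext _ _ fun j => ?_
  rw [Category.assoc, ι_matrix_π, Category.comp_id, unitMatrix]
  split_ifs with h
  · subst h
    rw [biproduct.ι_π_self]
    exact R.map_one _
  · rw [biproduct.ι_π_ne _ h, map_zero]

lemma matrix_δ_comp (E : A.twQuiver.Ob) : R.matrix E.1.δ ≫ R.matrix E.1.δ = 0 := by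
  refine biproduct.hom_ext' _ _ fun i => biproduct.hom_ext _ _ fun j => ?_
  rw [Category.assoc, matrix_comp, (R.mc_iff E.1).1 E.2 i j]
  simp

lemma matrix_tw_single {E F : A.twQuiver.Ob} (f : A.twQuiver.HomogHom E F) :
    R.matrix (twμ (.single f)) =
      f.deg.negOnePow • (R.matrix f.val ≫ R.matrix F.1.δ) - R.matrix E.1.δ ≫ R.matrix f.val := by
  refine biproduct.hom_ext' _ _ fun i => biproduct.hom_ext _ _ fun j => ?_
  rw [Category.assoc, ι_matrix_π, map_tw_single, ← matrix_comp, ← matrix_comp]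
  simp [Units.smul_def]

lemma matrix_tw_pair {E F G : A.twQuiver.Ob} (f : A.twQuiver.HomogHom E F)
    (g : A.twQuiver.HomogHom F G) :
    R.matrix (twμ (.pair f g)) = f.deg.negOnePow • (R.matrix f.val ≫ R.matrix g.val) := by
  refine biproduct.hom_ext' _ _ fun i => biproduct.hom_ext _ _ fun j => ?_
  rw [Category.assoc, ι_matrix_π, map_tw_pair, ← matrix_comp]
  simp [Units.smul_def]

/-- Twisted complexes form a dg category. -/
def twDGModel : A.tw.DGModel C where
  obj (E : A.twQuiver.Ob) := R.total E.1
  map {E F : A.twQuiver.Ob} := (R.matrix (E := E.1) (F := F.1)).toLinearMap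
  map_injective {E F : A.twQuiver.Ob} := (R.matrix (E := E.1) (F := F.1)).injective
  δ (E : A.twQuiver.Ob) := R.matrix E.1.δ
  δ_δ := R.matrix_δ_comp
  map_one (E : A.twQuiver.Ob) := R.matrix_unitMatrix E.1
  one_mem := R.unitMatrix_mem
  internal := R.twGr_isInternal
  mem := R.twμ_mem
  μ_nil := tw_nil
  μ_single := R.matrix_tw_single
  μ_pair := R.matrix_tw_pair
  μ_long := R.tw_long

end AInfData.LinearModel

/-! ## The Brauer graph category -/

namespace GradedQuiver.Seq

variable {k : Type u} [Field k] {G : GradedQuiver.{u, w₁, w₂} k}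

lemma nil_comp {X Y : G.Ob} (p : G.Seq X Y) : (nil X).comp p = p := by
  induction p with
  | nil => rfl
  | cons p a ih => rw [comp, ih]

lemma comp_assoc {X Y Z W : G.Ob} (p : G.Seq X Y) (q : G.Seq Y Z) (r : G.Seq Z W) :
    (p.comp q).comp r = p.comp (q.comp r) := by
  induction r with
  | nil => rfl
  | cons r a ih => rw [comp, ih, comp, comp]

end GradedQuiver.Seq

lemma mem_projQuiver_gr {k : Type u} [Field k] {B : Type v} [Ring B] [Algebra k B] {ι : Type w}
    {P : ι → Submodule Bᵐᵒᵖ B} {i j : ι} {d : ℤ} {f : P i →ₗ[Bᵐᵒᵖ] P j} :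
    f ∈ (projQuiver k B P).gr i j d ↔ d = 0 ∨ f = 0 := by
  change f ∈ (if d = 0 then ⊤ else ⊥ : Submodule k (P i →ₗ[Bᵐᵒᵖ] P j)) ↔ _
  split_ifs with hd
  · simp [hd]
  · simp [hd]

namespace RibbonGraph

open GradedQuiver ModifiedBGA

variable {k : Type u} [Field k] {Γ : RibbonGraph.{v}} {m : Γ.V → ℕ+}

section Quiver

variable {arrowDeg : Γ.H → ℤ} {wn : Γ.Edge → ℤ}

lemma entries_nil (γ : Γ.Edge) :
    entries (Seq.nil (G := Γ.brauerQuiver k m arrowDeg wn) γ) = [] := by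
  simp only [entries]

lemma entries_cons {γ δ ε : Γ.Edge} (p : (Γ.brauerQuiver k m arrowDeg wn).Seq γ δ)
    (a : (Γ.brauerQuiver k m arrowDeg wn).HomogHom δ ε) :
    entries (p.cons a) = entries p ++ [(a.val : Γ.ModifiedBGA k m wn)] := by
  simp only [entries]

lemma entries_comp {γ δ ε : (Γ.brauerQuiver k m arrowDeg wn).Ob}
    (p : (Γ.brauerQuiver k m arrowDeg wn).Seq γ δ)
    (q : (Γ.brauerQuiver k m arrowDeg wn).Seq δ ε) :
    entries (p.comp q) = entries p ++ entries q := by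
  induction q with
  | nil => rw [Seq.comp, entries_nil, List.append_nil]
  | cons q a ih => rw [Seq.comp, entries_cons, entries_cons, ih, List.append_assoc]

/-- A multilinear operation which vanishes on sequences of paths vanishes. -/
lemma eq_zero_of_paths {μ : ∀ {γ δ : Γ.Edge}, (Γ.brauerQuiver k m arrowDeg wn).Seq γ δ →
    homSpace k m wn γ δ} (hμ : GradedQuiver.IsMultilinear μ) (n : ℕ)
    (h : ∀ {γ δ : Γ.Edge} (p : (Γ.brauerQuiver k m arrowDeg wn).Seq γ δ), n ≤ p.length →
      (∀ x ∈ entries p, ∃ (h : Γ.H) (ℓ : ℕ), ℓ ≤ Γ.maxLength m h ∧ x = path k m wn h ℓ) → μ p = 0)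
    {γ δ ε : (Γ.brauerQuiver k m arrowDeg wn).Ob}
    (p : (Γ.brauerQuiver k m arrowDeg wn).Seq γ δ)
    (q : (Γ.brauerQuiver k m arrowDeg wn).Seq δ ε) (hn : n ≤ (p.comp q).length)
    (hq : ∀ x ∈ entries q, ∃ (h : Γ.H) (ℓ : ℕ), ℓ ≤ Γ.maxLength m h ∧ x = path k m wn h ℓ) :
    μ (p.comp q) = 0 := by
  -- Entries are expanded into paths from the last to the first: the treated ones have moved to `q`,
  -- the remaining ones are still in `p`.
  induction p with
  | nil =>
    rw [Seq.nil_comp] at hn ⊢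
    exact h q hn hq
  | cons p a ih =>
    obtain ⟨d, a, ha⟩ := a
    have hn' : n ≤ p.length + 1 + q.length := by rwa [Seq.length_comp, Seq.length_cons] at hn
    clear hn
    induction ha using Submodule.span_induction with
    | mem a ha =>
      have h1 := Seq.comp_assoc p (.single ⟨d, a, Submodule.subset_span ha⟩) q
      rw [show (p.cons _).comp q = (p.comp (.single ⟨d, a, Submodule.subset_span ha⟩)).comp q
        from rfl, h1]
      refine ih _ ?_ fun x hx => ?_
      · rw [Seq.length_comp, Seq.length_comp, Seq.length_cons, Seq.length_nil]
        omega
      · rw [entries_comp, entries_cons, entries_nil, List.nil_append, List.singleton_append,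
          List.mem_cons] at hx
        rcases hx with rfl | hx
        · obtain ⟨h, ℓ, hℓ, -, -, -, hx⟩ := ha
          exact ⟨h, ℓ, hℓ, hx⟩
        · exact hq x hx
    | zero => exact hμ.zero_entry p _ q rfl
    | add a b ha hb iha ihb =>
      have := hμ.add p d a b ha hb q
      rw [iha, ihb, add_zero] at this
      exact this
    | smul c a ha iha =>
      have := hμ.smul p d c a ha q
      rw [iha, smul_zero] at this
      exact this

/-- When all arrows have degree zero so do all paths, and paths up to the maximal length span the
morphism space. -/
lemma gr_zero (γ δ : Γ.Edge) : (Γ.brauerQuiver k m 0 wn).gr γ δ 0 = ⊤ := by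
  rw [eq_top_iff]
  rintro x -
  have h1 := homSpace_le_span (k := k) (m := m) (wn := wn) γ δ x.2
  have h2 : Submodule.span k {x | ∃ (h : Γ.H) (ℓ : ℕ), ℓ ≤ Γ.maxLength m h ∧
      Γ.edge h = γ ∧ Γ.edge (Γ.ρ^[ℓ] h) = δ ∧ x = path k m wn h ℓ} ≤
      ((Γ.brauerQuiver k m 0 wn).gr γ δ 0).map (homSpace k m wn γ δ).subtype := by
    rw [Submodule.span_le]
    rintro _ ⟨h, ℓ, hℓ, rfl, rfl, rfl⟩
    refine ⟨⟨path k m wn h ℓ, e_mul_path k m wn h ℓ, path_mul_e k m wn h ℓ⟩,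
      Submodule.subset_span ⟨h, ℓ, hℓ, rfl, rfl, ?_, rfl⟩, rfl⟩
    simp [pathDeg]
  obtain ⟨y, hy, hyx⟩ := h2 h1
  rwa [Subtype.ext hyx] at hy

lemma gr_ne (γ δ : Γ.Edge) {d : ℤ} (hd : d ≠ 0) : (Γ.brauerQuiver k m 0 wn).gr γ δ d = ⊥ := by
  refine Submodule.span_eq_bot.2 ?_
  rintro x ⟨h, ℓ, -, -, -, h1, -⟩
  exact absurd (by simp [pathDeg] at h1; exact h1.symm) hd

end Quiver

namespace ModifiedBGA

variable (k m) in
/-- The module `P_γ`, as an object of the category of modules. -/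
def modP (γ : Γ.Edge) : ModuleCat.{max u v} (Γ.BGA k m)ᵐᵒᵖ :=
  ModuleCat.of (Γ.BGA k m)ᵐᵒᵖ (P k m 0 γ)

/-- The morphisms between the modules `P_γ`, as morphisms in the category of modules. -/
def homEquivModuleCat (γ δ : Γ.Edge) : homSpace k m 0 γ δ ≃ₗ[k]
    (modP k m γ ⟶ modP k m δ) where
  toFun a := ModuleCat.ofHom (homEquiv k m 0 γ δ a)
  map_add' a b := by
    rw [map_add]
    rfl
  map_smul' c a := by
    refine ModuleCat.hom_ext (LinearMap.ext fun x => Subtype.ext ?_)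
    -- A scalar acts on module morphisms through right multiplication by its image in the algebra,
    -- which is central.
    change (c • a.1) * x.1 = a.1 * x.1 * algebraMap k (Γ.BGA k m) c
    rw [smul_mul_assoc, Algebra.smul_def, Algebra.commutes]
  invFun f := (homEquiv k m 0 γ δ).symm f.hom
  left_inv a := (homEquiv k m 0 γ δ).symm_apply_apply a
  right_inv f := by
    exact ModuleCat.hom_ext ((homEquiv k m 0 γ δ).apply_symm_apply f.hom)

lemma homEquivModuleCat_comp {γ δ ε : Γ.Edge} (a : homSpace k m 0 γ δ) (b : homSpace k m 0 δ ε)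
    (c : homSpace k m 0 γ ε) (hc : c.1 = b.1 * a.1) :
    homEquivModuleCat γ ε c = homEquivModuleCat γ δ a ≫ homEquivModuleCat δ ε b := by
  refine ModuleCat.hom_ext (LinearMap.ext fun x => Subtype.ext ?_)
  change c.1 * x.1 = b.1 * (a.1 * x.1)
  rw [hc, mul_assoc]

end ModifiedBGA

/-- The data of a category with the graded quiver of the Brauer graph category, if all degrees and
winding numbers are zero. -/
@[reducible] def brauerData
    (μ : ∀ {γ δ : Γ.Edge}, (Γ.brauerQuiver k m 0 0).Seq γ δ → homSpace k m 0 γ δ) :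
    AInfData.{u, v, max u v} k where
  toGradedQuiver := Γ.brauerQuiver k m 0 0
  one γ := ⟨e k m 0 γ, e_mul_e k m 0 γ, e_mul_e k m 0 γ⟩
  μ := μ

section Model

variable (μ : ∀ {γ δ : Γ.Edge}, (Γ.brauerQuiver k m 0 0).Seq γ δ → homSpace k m 0 γ δ)
  (hpair : ∀ {γ δ ε} (a : (Γ.brauerQuiver k m 0 0).HomogHom γ δ)
    (b : (Γ.brauerQuiver k m 0 0).HomogHom δ ε), (μ (.pair a b) : Γ.ModifiedBGA k m 0) =
      a.deg.negOnePow • ((b.val : Γ.ModifiedBGA k m 0) * a.val))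
  (hzero : ∀ {γ δ} (p : (Γ.brauerQuiver k m 0 0).Seq γ δ), p.length ≠ 2 → μ p = 0)

/-- A morphism carrying a nonzero degree is zero, so the sign in the binary product never shows.
This makes the isomorphism with the module category strict. -/
lemma negOnePow_smul_eq {γ δ : Γ.Edge} (a : (Γ.brauerQuiver k m 0 0).HomogHom γ δ)
    (b : Γ.ModifiedBGA k m 0) :
    a.deg.negOnePow • (b * (a.val : Γ.ModifiedBGA k m 0)) = b * a.val := by
  by_cases ha : a.deg = 0
  · rw [ha, Int.negOnePow_zero, one_smul]
  · have : a.val = 0 := by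
      have := a.mem
      rwa [gr_ne _ _ ha, Submodule.mem_bot] at this
    rw [this]
    simp

include hpair hzero in
/-- The Brauer graph category as a category of modules. -/
def linearModel : AInfData.LinearModel
    (brauerData μ) (ModuleCat.{max u v} (Γ.BGA k m)ᵐᵒᵖ) where
  obj := modP k m
  map := homEquivModuleCat _ _
  gr_zero := gr_zero
  gr_ne _ _ _ := gr_ne _ _
  map_one _ := ModuleCat.hom_ext (LinearMap.ext fun x => Subtype.ext (mem_P.1 x.2))
  map_pair a b := homEquivModuleCat_comp a.val b.val _ ((hpair a b).trans (negOnePow_smul_eq a _))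
  μ_eq_zero := hzero

variable (k m) in
/-- The isomorphism of the graded quiver of the Brauer graph category with the one of the
modules `P_γ`. -/
def projQuiverIso : (Γ.brauerQuiver k m 0 0).Iso
    (projQuiver k (Γ.BGA k m) (P (Γ := Γ) k m 0)) where
  obj := Equiv.refl _
  map γ δ := homEquiv k m 0 γ δ
  map_mem {γ δ} d a := by
    refine mem_projQuiver_gr.trans ?_
    by_cases hd : d = 0
    · subst hd
      exact iff_of_true (Or.inl rfl) (by rw [gr_zero]; exact Submodule.mem_top)
    · rw [gr_ne _ _ hd, Submodule.mem_bot]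
      exact (or_iff_right hd).trans (homEquiv k m 0 γ δ).map_eq_zero_iff

include hpair in
lemma projQuiverIso_pair {γ δ ε : (Γ.brauerQuiver k m 0 0).Ob}
    (a : (Γ.brauerQuiver k m 0 0).HomogHom γ δ) (b : (Γ.brauerQuiver k m 0 0).HomogHom δ ε) :
    homEquiv k m 0 γ ε (μ (.pair a b)) =
      LinearMap.comp (homEquiv k m 0 δ ε b.val) (homEquiv k m 0 γ δ a.val) := by
  refine LinearMap.ext fun x => Subtype.ext ?_
  rw [LinearMap.comp_apply, homEquiv_apply, homEquiv_apply, homEquiv_apply, hpair,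
    negOnePow_smul_eq, mul_assoc]

include hpair hzero in
lemma projQuiverIso_μ {γ δ : (Γ.brauerQuiver k m 0 0).Ob}
    (p : (Γ.brauerQuiver k m 0 0).Seq γ δ) :
    homEquiv k m 0 γ δ (μ p) =
      projComp k (Γ.BGA k m) (P (Γ := Γ) k m 0) ((projQuiverIso k m).mapSeq p) := by
  cases p with
  | nil =>
    rw [hzero _ (by rw [Seq.length_nil]; omega), map_zero]
    simp only [Iso.mapSeq]
    rfl
  | cons p b =>
    cases p with
    | nil =>
      rw [hzero _ (by rw [Seq.length_cons, Seq.length_nil]; omega), map_zero]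
      simp only [Iso.mapSeq]
      rfl
    | cons p a =>
      cases p with
      | nil =>
        rw [projQuiverIso_pair μ hpair]
        simp only [Iso.mapSeq]
        rfl
      | cons p c =>
        rw [hzero _ (by simp only [Seq.length_cons]; omega), map_zero]
        simp only [Iso.mapSeq]
        rfl

include hpair hzero in
/-- The strict isomorphism to the category of the modules `P_γ`. -/
def projIso : AInfIso (brauerData μ) (projAInf k (Γ.BGA k m) (P (Γ := Γ) k m 0)) where
  toIso := projQuiverIso k m
  map_one _ := LinearMap.ext fun x => Subtype.ext (mem_P.1 x.2)
  map_μ p := projQuiverIso_μ μ hpair hzero p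

end Model

/-- The composition of sequences of length two, up to a sign. -/
def brauerComp : ∀ {γ δ : Γ.Edge}, (Γ.brauerQuiver k m 0 0).Seq γ δ → homSpace k m 0 γ δ
  | γ, δ, Seq.cons (Seq.cons (Seq.nil _) a) b =>
      a.deg.negOnePow • ⟨(b.val : Γ.ModifiedBGA k m 0) * a.val, by
        rw [← mul_assoc, b.val.2.1], by rw [mul_assoc, a.val.2.2]⟩
  | _, _, _ => 0

lemma brauerComp_pair {γ δ ε : Γ.Edge} (a : (Γ.brauerQuiver k m 0 0).HomogHom γ δ)
    (b : (Γ.brauerQuiver k m 0 0).HomogHom δ ε) :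
    (brauerComp (.pair a b) : Γ.ModifiedBGA k m 0) =
      a.deg.negOnePow • ((b.val : Γ.ModifiedBGA k m 0) * a.val) := by
  simp [brauerComp, Units.smul_def]

lemma brauerComp_eq_zero {γ δ : (Γ.brauerQuiver k m 0 0).Ob}
    (p : (Γ.brauerQuiver k m 0 0).Seq γ δ)
    (hp : p.length ≠ 2) : brauerComp p = 0 := by
  cases p with
  | nil => rfl
  | cons p a =>
    cases p with
    | nil => rfl
    | cons p b =>
      cases p with
      | nil => simp [Seq.length_nil, Seq.length_cons] at hp
      | cons p c => rfl

/-! ### Existence and uniqueness of the Brauer graph category -/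

variable {M : Type w} [TopologicalSpace M] [T2Space M] [ChartedSpace (EuclideanHalfSpace 2) M]
  [IsManifold (𝓡∂ 2) ∞ M] {J : QuarterTurn M} {κ : ArcSystem J Γ} {η : LineField κ.punctures}
  {𝔤 : κ.Grading η}

-- Each of the three kinds of prescribed values presupposes a disc sequence.
omit [T2Space M] in
lemma not_specialValue {arrowDeg : Γ.H → ℤ} {wn : Γ.Edge → ℤ}
    (hκ : ∀ L, ¬ κ.IsDiscSequence L) (L : List (Γ.ModifiedBGA k m wn))
    (v : Γ.ModifiedBGA k m wn) : ¬ SpecialValue k m κ arrowDeg wn L v := by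
  rintro (⟨_, _, _, _, hL, _⟩ | ⟨_, _, _, _, _, hL, _, _⟩ | ⟨_, _, _, _, _, _, _, hL, _⟩)
  all_goals exact hκ _ hL

namespace BrauerGraphCategory

/-- Without discs nothing is special, so higher operations vanish on sequences of paths, and by
multilinearity on all sequences. -/
lemma μ_eq_zero (hκ : κ.IsFilling) (𝔹 : BrauerGraphCategory k m 𝔤)
    {γ δ : (Γ.brauerQuiver k m 𝔹.arrowDeg 𝔹.winding).Ob}
    (p : (Γ.brauerQuiver k m 𝔹.arrowDeg 𝔹.winding).Seq γ δ) (hp : p.length ≠ 2) : 𝔹.μ p = 0 := by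
  by_cases h3 : 3 ≤ p.length
  · refine eq_zero_of_paths 𝔹.multilinear 3 (fun q hq hq' => 𝔹.μ_other q hq hq' ?_) p
      (Seq.nil (G := Γ.brauerQuiver k m 𝔹.arrowDeg 𝔹.winding) δ) h3 (by simp [entries_nil])
    rintro ⟨L, v, -, hv⟩
    exact not_specialValue (fun L => hκ.not_isDiscSequence L) _ _ hv
  · cases p with
    | nil => exact 𝔹.μ_nil _
    | cons p a =>
      cases p with
      | nil => exact 𝔹.μ_single a
      | cons p b => simp [Seq.length_cons] at hp h3; omega

omit [T2Space M] in
lemma arrowDeg_eq_zero (h𝔤 : 𝔤.IsShortestClockwise) (𝔹 : BrauerGraphCategory k m 𝔤) :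
    𝔹.arrowDeg = 0 := funext fun h => h𝔤.arrowDegree_eq_zero (𝔹.arrowDeg_spec h)

omit [T2Space M] in
lemma winding_eq_zero (h𝔤 : 𝔤.IsShortestClockwise) (𝔹 : BrauerGraphCategory k m 𝔤) :
    𝔹.winding = 0 := funext fun γ => by
  obtain ⟨h, -, hw⟩ := 𝔹.winding_spec γ
  exact h𝔤.winding_eq_zero hw

/-- The Brauer graph category is determined by its defining properties. -/
lemma eq (hκ : κ.IsFilling) (h𝔤 : 𝔤.IsShortestClockwise) (𝔹 𝔹' : BrauerGraphCategory k m 𝔤) :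
    𝔹 = 𝔹' := by
  have h1 := 𝔹.arrowDeg_eq_zero h𝔤
  have h2 := 𝔹.winding_eq_zero h𝔤
  have h3 := 𝔹'.arrowDeg_eq_zero h𝔤
  have h4 := 𝔹'.winding_eq_zero h𝔤
  have h5 : ∀ {γ δ} p, p.length ≠ 2 → 𝔹.μ (γ := γ) (δ := δ) p = 0 := 𝔹.μ_eq_zero hκ
  have h6 : ∀ {γ δ} p, p.length ≠ 2 → 𝔹'.μ (γ := γ) (δ := δ) p = 0 := 𝔹'.μ_eq_zero hκ
  -- The types of the operations depend on the degrees and winding numbers. Taking the structures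
  -- apart allows these to be replaced by zero before the operations are compared.
  obtain ⟨a, _, wn, _, μ, _, _, _, h7, _, _⟩ := 𝔹
  obtain ⟨a', _, wn', _, μ', _, _, _, h8, _, _⟩ := 𝔹'
  obtain rfl : a = 0 := h1
  obtain rfl : wn = 0 := h2
  obtain rfl : a' = 0 := h3
  obtain rfl : wn' = 0 := h4
  have : @μ = @μ' := by
    funext γ δ p
    by_cases hp : p.length = 2
    · obtain ⟨ε, a, b, rfl⟩ := p.exists_eq_pair hp
      exact Subtype.ext ((h7 a b).trans (h8 a b).symm)
    · exact (h5 p hp).trans (h6 p hp).symm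
  subst this
  rfl

variable (k m) in
/-- The Brauer graph category. -/
def ofFilling (hκ : κ.IsFilling) (hη : κ.IsRibbonLineField η) (h𝔤 : 𝔤.IsShortestClockwise) :
    BrauerGraphCategory k m 𝔤 where
  arrowDeg := 0
  arrowDeg_spec := h𝔤.isArrowDegree hη
  winding := 0
  winding_spec γ := by
    obtain ⟨h, rfl⟩ := edge_surjective γ
    exact ⟨h, rfl, h𝔤.hasWinding hη h⟩
  μ := brauerComp
  multilinear := (linearModel brauerComp brauerComp_pair
    brauerComp_eq_zero).toDGModel.isMultilinear
  μ_nil _ := brauerComp_eq_zero _ (by simp [Seq.length_nil])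
  μ_single _ := brauerComp_eq_zero _ (by simp [Seq.length_nil, Seq.length_cons])
  μ_pair := brauerComp_pair
  -- The three prescriptions cannot contradict each other because none of them ever applies.
  μ_special p v _ h := absurd h (not_specialValue (fun L => hκ.not_isDiscSequence L) _ _)
  μ_other p hp _ _ := brauerComp_eq_zero p (by omega)

lemma exists_linearModel (hκ : κ.IsFilling) (h𝔤 : 𝔤.IsShortestClockwise)
    (𝔹 : BrauerGraphCategory k m 𝔤) :
    ∃ R : 𝔹.data.LinearModel (ModuleCat.{max u v} (Γ.BGA k m)ᵐᵒᵖ),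
      ∀ γ : Γ.Edge, R.obj γ = modP k m γ := by
  have h1 := 𝔹.arrowDeg_eq_zero h𝔤
  have h2 := 𝔹.winding_eq_zero h𝔤
  have h5 : ∀ {γ δ} p, p.length ≠ 2 → 𝔹.μ (γ := γ) (δ := δ) p = 0 := 𝔹.μ_eq_zero hκ
  obtain ⟨a, _, wn, _, μ, _, _, _, h7, _, _⟩ := 𝔹
  obtain rfl : a = 0 := h1
  obtain rfl : wn = 0 := h2
  exact ⟨linearModel μ h7 h5, fun _ => rfl⟩

lemma nonempty_projIso (hκ : κ.IsFilling) (h𝔤 : 𝔤.IsShortestClockwise)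
    (𝔹 : BrauerGraphCategory k m 𝔤) :
    Nonempty (AInfIso 𝔹.data (projAInf k (Γ.BGA k m) (P (Γ := Γ) k m 0))) := by
  have h1 := 𝔹.arrowDeg_eq_zero h𝔤
  have h2 := 𝔹.winding_eq_zero h𝔤
  have h5 : ∀ {γ δ} p, p.length ≠ 2 → 𝔹.μ (γ := γ) (δ := δ) p = 0 := 𝔹.μ_eq_zero hκ
  obtain ⟨a, _, wn, _, μ, _, _, _, h7, _, _⟩ := 𝔹
  obtain rfl : a = 0 := h1
  obtain rfl : wn = 0 := h2
  exact ⟨projIso μ h7 h5⟩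

end BrauerGraphCategory

end RibbonGraph

/-! ## The complex of a twisted complex -/

namespace AInfData.LinearModel

open GradedQuiver Limits CochainComplex.HomComplex

variable {k : Type u} [Field k] {A : AInfData.{u, w₁, w₂} k} {C : Type v}
    [Category.{w} C] [Preadditive C] [Linear k C] (R : A.LinearModel C) [HasFiniteBiproducts C]

/-- The inclusion of a summand. -/
abbrev inj (E : A.PreTw) (i : E.ι) : R.obj (E.ob i) ⟶ R.total E :=
  biproduct.ι (fun i => R.obj (E.ob i)) i

/-- The projection to a summand. -/
abbrev prj (E : A.PreTw) (i : E.ι) : R.total E ⟶ R.obj (E.ob i) :=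
  biproduct.π (fun i => R.obj (E.ob i)) i

/-- The sum of the summands of a twisted complex of cohomological degree `n`. -/
abbrev part (E : A.PreTw) (n : ℤ) : C :=
  ⨁ fun i : {i // E.shift i = -n} => R.obj (E.ob i.1)

/-- The inclusion of a summand of degree `n` into the part of degree `n`. -/
abbrev partInj (E : A.PreTw) (n : ℤ) (i : {i // E.shift i = -n}) :
    R.obj (E.ob i.1) ⟶ R.part E n :=
  biproduct.ι (fun i : {i // E.shift i = -n} => R.obj (E.ob i.1)) i

/-- The projection of the part of degree `n` to a summand. -/
abbrev partPrj (E : A.PreTw) (n : ℤ) (i : {i // E.shift i = -n}) :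
    R.part E n ⟶ R.obj (E.ob i.1) :=
  biproduct.π (fun i : {i // E.shift i = -n} => R.obj (E.ob i.1)) i

/-- The inclusion of the part of degree `n`. -/
def incl (E : A.PreTw) (n : ℤ) : R.part E n ⟶ R.total E := biproduct.desc fun i => R.inj E i.1

/-- The projection to the part of degree `n`. -/
def proj (E : A.PreTw) (n : ℤ) : R.total E ⟶ R.part E n := biproduct.lift fun i => R.prj E i.1

lemma partInj_incl (E : A.PreTw) (n : ℤ) (i : {i // E.shift i = -n}) :
    R.partInj E n i ≫ R.incl E n = R.inj E i.1 := biproduct.ι_desc _ _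

lemma proj_partPrj (E : A.PreTw) (n : ℤ) (i : {i // E.shift i = -n}) :
    R.proj E n ≫ R.partPrj E n i = R.prj E i.1 := biproduct.lift_π _ _

lemma incl_proj (E : A.PreTw) (n : ℤ) : R.incl E n ≫ R.proj E n = 𝟙 _ := by
  refine biproduct.hom_ext' _ _ fun i => biproduct.hom_ext _ _ fun j => ?_
  rw [Category.assoc, Category.assoc, proj_partPrj, ← Category.assoc, partInj_incl,
    Category.comp_id]
  by_cases h : i = j
  · subst h
    rw [biproduct.ι_π_self, biproduct.ι_π_self]
  · rw [biproduct.ι_π_ne _ h, biproduct.ι_π_ne _ fun h' => h (Subtype.ext h')]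

lemma incl_proj_assoc (E : A.PreTw) (n : ℤ) {Z : C} (f : R.part E n ⟶ Z) :
    R.incl E n ≫ R.proj E n ≫ f = f := by
  rw [← Category.assoc, incl_proj, Category.id_comp]

lemma inj_proj (E : A.PreTw) (n : ℤ) (i : {i // E.shift i = -n}) :
    R.inj E i.1 ≫ R.proj E n = R.partInj E n i := by
  rw [← partInj_incl, Category.assoc, incl_proj, Category.comp_id]

lemma incl_prj (E : A.PreTw) (n : ℤ) (i : {i // E.shift i = -n}) :
    R.incl E n ≫ R.prj E i.1 = R.partPrj E n i := by
  rw [← proj_partPrj, incl_proj_assoc]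

lemma inj_proj_of_ne {E : A.PreTw} {i : E.ι} {n : ℤ} (h : E.shift i ≠ -n) :
    R.inj E i ≫ R.proj E n = 0 := by
  refine biproduct.hom_ext _ _ fun j => ?_
  rw [Category.assoc, proj_partPrj, zero_comp, biproduct.ι_π_ne]
  rintro rfl
  exact h j.2

lemma incl_prj_of_ne {E : A.PreTw} {i : E.ι} {n : ℤ} (h : E.shift i ≠ -n) :
    R.incl E n ≫ R.prj E i = 0 := by
  refine biproduct.hom_ext' _ _ fun j => ?_
  rw [← Category.assoc, partInj_incl, comp_zero, biproduct.ι_π_ne]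
  rintro rfl
  exact h j.2

lemma inj_proj_incl {E : A.PreTw} {i : E.ι} {n : ℤ} (h : E.shift i = -n) :
    R.inj E i ≫ R.proj E n ≫ R.incl E n = R.inj E i := by
  rw [← Category.assoc, R.inj_proj E n ⟨i, h⟩, partInj_incl]

lemma proj_incl_prj {E : A.PreTw} {i : E.ι} {n : ℤ} (h : E.shift i = -n) :
    R.proj E n ≫ R.incl E n ≫ R.prj E i = R.prj E i := by
  rw [R.incl_prj E n ⟨i, h⟩, proj_partPrj]

lemma total_ext {E F : A.PreTw} {f g : R.total E ⟶ R.total F}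
    (h : ∀ i j, R.inj E i ≫ f ≫ R.prj F j = R.inj E i ≫ g ≫ R.prj F j) : f = g :=
  biproduct.hom_ext' _ _ fun i => biproduct.hom_ext _ _ fun j => by
    simpa using h i j

/-- A morphism is homogeneous of degree `d` if it maps the part of degree `n` to
the part of degree `n + d`. -/
def IsHomogeneous {E F : A.PreTw} (m : R.total E ⟶ R.total F) (d : ℤ) : Prop :=
  ∀ i j, d + F.shift j - E.shift i ≠ 0 → R.inj E i ≫ m ≫ R.prj F j = 0

variable {R}

/-- In degree zero of `A` there is no condition on an entry, in all other degrees it has to vanish.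
-/
lemma mem_twGr_iff {E F : A.twQuiver.Ob} {f : A.twQuiver.Hom E F} {d : ℤ} :
    f ∈ A.twQuiver.gr E F d ↔ R.IsHomogeneous (R.matrix f) d := by
  rw [mem_twGr]
  refine forall₂_congr fun i j => ?_
  rw [R.ι_matrix_π]
  constructor
  · intro h hd
    rw [R.eq_zero_of_mem h hd, map_zero]
  · intro h
    exact R.mem_gr_of_ne_zero fun hd => R.map.map_eq_zero_iff.1 (h hd)

namespace IsHomogeneous

variable {E F G : A.PreTw} {m : R.total E ⟶ R.total F} {d : ℤ}

/-- Homogeneous maps intertwine the idempotents onto the parts. The passage from matrices on the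
total object to families of maps between parts rests on this identity. -/
lemma proj_incl_comp (hm : R.IsHomogeneous m d) {p q : ℤ} (h : p + d = q) :
    R.proj E p ≫ R.incl E p ≫ m = m ≫ R.proj F q ≫ R.incl F q := by
  refine R.total_ext fun i j => ?_
  simp only [Category.assoc]
  by_cases hi : E.shift i = -p
  · have h1 := congrArg (· ≫ m ≫ R.prj F j) (R.inj_proj_incl hi)
    simp only [Category.assoc] at h1
    rw [h1]
    by_cases hj : F.shift j = -q
    · rw [R.proj_incl_prj hj]
    · rw [R.incl_prj_of_ne hj, comp_zero, comp_zero, comp_zero]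
      exact hm i j (by omega)
  · rw [← Category.assoc (R.inj E i), R.inj_proj_of_ne hi, zero_comp]
    by_cases hj : F.shift j = -q
    · rw [R.proj_incl_prj hj]
      exact (hm i j (by omega)).symm
    · rw [R.incl_prj_of_ne hj, comp_zero, comp_zero, comp_zero]

lemma incl_comp (hm : R.IsHomogeneous m d) {p q : ℤ} (h : p + d = q) :
    R.incl E p ≫ m ≫ R.proj F q ≫ R.incl F q = R.incl E p ≫ m := by
  rw [← hm.proj_incl_comp h, incl_proj_assoc]

lemma incl_comp_assoc (hm : R.IsHomogeneous m d) {p q : ℤ} (h : p + d = q) {Z : C}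
    (f : R.total F ⟶ Z) :
    R.incl E p ≫ m ≫ R.proj F q ≫ R.incl F q ≫ f = R.incl E p ≫ m ≫ f := by
  have := congrArg (· ≫ f) (hm.incl_comp h)
  simpa only [Category.assoc] using this

lemma incl_comp_proj_eq_zero (hm : R.IsHomogeneous m d) {p q : ℤ} (h : p + d ≠ q) :
    R.incl E p ≫ m ≫ R.proj F q = 0 := by
  rw [← hm.incl_comp_assoc rfl]
  have h2 : R.incl F (p + d) ≫ R.proj F q = 0 := by
    refine biproduct.hom_ext' _ _ fun i => ?_
    rw [← Category.assoc, partInj_incl, comp_zero]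
    exact R.inj_proj_of_ne (by rw [i.2]; omega)
  rw [h2, comp_zero, comp_zero, comp_zero]

lemma add {m' : R.total E ⟶ R.total F} (hm : R.IsHomogeneous m d) (hm' : R.IsHomogeneous m' d) :
    R.IsHomogeneous (m + m') d := fun i j h => by
  rw [Preadditive.add_comp, Preadditive.comp_add, hm i j h, hm' i j h, add_zero]

lemma neg (hm : R.IsHomogeneous m d) : R.IsHomogeneous (-m) d := fun i j h => by
  rw [Preadditive.neg_comp, Preadditive.comp_neg, hm i j h, neg_zero]

lemma id (E : A.PreTw) : R.IsHomogeneous (𝟙 (R.total E)) 0 := fun i j h => by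
  rw [Category.id_comp, biproduct.ι_π_ne]
  rintro rfl
  omega

lemma comp {m' : R.total F ⟶ R.total G} {d' e : ℤ} (hm : R.IsHomogeneous m d)
    (hm' : R.IsHomogeneous m' d') (he : d + d' = e) : R.IsHomogeneous (m ≫ m') e := fun i j h => by
  have h1 := hm.proj_incl_comp (p := -E.shift i) rfl
  have h2 := hm'.proj_incl_comp (p := -E.shift i + d) (q := -E.shift i + e) (by omega)
  have h3 : R.inj E i ≫ (R.proj E (-E.shift i) ≫ R.incl E (-E.shift i) ≫ m) ≫ m' ≫ R.prj G j =
      R.inj E i ≫ (m ≫ m') ≫ R.prj G j := by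
    have := congrArg (· ≫ m ≫ m' ≫ R.prj G j)
      (R.inj_proj_incl (i := i) (n := -E.shift i) (by omega))
    simpa only [Category.assoc] using this
  rw [← h3, h1]
  have h4 := congrArg (· ≫ R.prj G j) h2
  simp only [Category.assoc] at h4 ⊢
  rw [h4, R.incl_prj_of_ne (by omega)]
  simp

end IsHomogeneous

variable (R)

lemma isHomogeneous_δ (E : A.PreTw) : R.IsHomogeneous (R.matrix E.δ) 1 := fun i j h => by
  rw [R.ι_matrix_π, R.eq_zero_of_mem (E.δ_mem i j) (by omega), map_zero]

/-- The complex of a twisted complex. -/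
abbrev complex (E : A.twQuiver.Ob) : CochainComplex C ℤ where
  X n := R.part E.1 n
  d p q := R.incl E.1 p ≫ R.matrix E.1.δ ≫ R.proj E.1 q
  shape p q h := (R.isHomogeneous_δ E.1).incl_comp_proj_eq_zero h
  d_comp_d' p q r hpq _ := by
    rw [Category.assoc, Category.assoc, (R.isHomogeneous_δ E.1).incl_comp_assoc hpq,
      ← Category.assoc (R.matrix E.1.δ), R.matrix_δ_comp, zero_comp, comp_zero]

lemma complex_d (E : A.twQuiver.Ob) (p q : ℤ) :
    (R.complex E).d p q = R.incl E.1 p ≫ R.matrix E.1.δ ≫ R.proj E.1 q := rfl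

section Cochain

variable {E F G : A.twQuiver.Ob}

/-- The cochain of degree `d` given by a morphism between the total objects. -/
def cochain (m : R.total E.1 ⟶ R.total F.1) (d : ℤ) : Cochain (R.complex E) (R.complex F) d :=
  Cochain.mk fun p q _ => R.incl E.1 p ≫ m ≫ R.proj F.1 q

lemma cochain_v (m : R.total E.1 ⟶ R.total F.1) {d p q : ℤ} (h : p + d = q) :
    (R.cochain m d).v p q h = R.incl E.1 p ≫ m ≫ R.proj F.1 q := rfl

lemma cochain_neg (m : R.total E.1 ⟶ R.total F.1) (d : ℤ) :
    R.cochain (-m) d = -R.cochain m d := by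
  refine Cochain.ext _ _ fun p q h => ?_
  simp [cochain_v]

lemma cochain_add (m m' : R.total E.1 ⟶ R.total F.1) (d : ℤ) :
    R.cochain (m + m') d = R.cochain m d + R.cochain m' d := by
  refine Cochain.ext _ _ fun p q h => ?_
  simp [cochain_v]

lemma cochain_id : R.cochain (𝟙 (R.total E.1)) 0 = Cochain.ofHom (𝟙 _) := by
  refine Cochain.ext₀ _ _ fun p => ?_
  rw [cochain_v, Category.id_comp, incl_proj, Cochain.ofHom_v]
  rfl

variable {R}

/-- Homogeneity of the first factor makes the composite from the part of degree `p` pass only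
through the part of degree `p + d`. -/
lemma cochain_comp {m : R.total E.1 ⟶ R.total F.1} {d d' e : ℤ} (hm : R.IsHomogeneous m d)
    (m' : R.total F.1 ⟶ R.total G.1) (h : d + d' = e) :
    (R.cochain m d).comp (R.cochain m' d') h = R.cochain (m ≫ m') e := by
  refine Cochain.ext _ _ fun p q hpq => ?_
  rw [Cochain.comp_v _ _ h p (p + d) q rfl (by omega), cochain_v, cochain_v, cochain_v,
    Category.assoc, Category.assoc, Category.assoc, hm.incl_comp_assoc rfl]

lemma δ_cochain {m : R.total E.1 ⟶ R.total F.1} {d e : ℤ} (hm : R.IsHomogeneous m d)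
    (h : d + 1 = e) : δ d e (R.cochain m d) =
      R.cochain (m ≫ R.matrix F.1.δ + e.negOnePow • (R.matrix E.1.δ ≫ m)) e := by
  refine Cochain.ext _ _ fun p q hpq => ?_
  rw [δ_v d e h _ p q hpq (q - 1) (p + 1) rfl rfl, cochain_v, cochain_v, cochain_v, complex_d,
    complex_d, Category.assoc, Category.assoc, Category.assoc, Category.assoc,
    hm.incl_comp_assoc (by omega), (R.isHomogeneous_δ E.1).incl_comp_assoc rfl]
  simp [Units.smul_def]

/-- Every summand lies in the part whose degree is minus its shift, and a homogeneous map is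
determined there by one component of the cochain. -/
lemma cochain_injective {m m' : R.total E.1 ⟶ R.total F.1} {d : ℤ} (hm : R.IsHomogeneous m d)
    (hm' : R.IsHomogeneous m' d) (h : R.cochain m d = R.cochain m' d) : m = m' := by
  refine biproduct.hom_ext' _ _ fun i => ?_
  have h1 := congrArg (fun z => z.v (-E.1.shift i) (-E.1.shift i + d) rfl ≫ R.incl F.1 _) h
  simp only [cochain_v, Category.assoc, hm.incl_comp, hm'.incl_comp] at h1
  have h2 := R.inj_proj_incl (E := E.1) (i := i) (n := -E.1.shift i) (by omega)
  change R.inj E.1 i ≫ m = R.inj E.1 i ≫ m'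
  rw [← h2, Category.assoc, Category.assoc, Category.assoc, Category.assoc, h1]

/-- On the summand `i` the matrix is assembled from the component of `z` that starts in the degree
of this summand. -/
lemma cochain_surjective {d : ℤ} (z : Cochain (R.complex E) (R.complex F) d) :
    ∃ m : R.total E.1 ⟶ R.total F.1, R.IsHomogeneous m d ∧ R.cochain m d = z := by
  let m : R.total E.1 ⟶ R.total F.1 := biproduct.desc fun i =>
    R.inj E.1 i ≫ R.proj E.1 (-E.1.shift i) ≫ z.v (-E.1.shift i) (-E.1.shift i + d) rfl ≫
      R.incl F.1 (-E.1.shift i + d)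
  have hm : ∀ i, R.inj E.1 i ≫ m = R.inj E.1 i ≫ R.proj E.1 (-E.1.shift i) ≫
      z.v (-E.1.shift i) (-E.1.shift i + d) rfl ≫ R.incl F.1 (-E.1.shift i + d) := fun i => by
    simp only [m, biproduct.ι_desc]
  refine ⟨m, fun i j hij => ?_, ?_⟩
  · rw [← Category.assoc, hm, Category.assoc, Category.assoc, Category.assoc,
      R.incl_prj_of_ne (by omega)]
    simp
  · refine Cochain.ext _ _ fun p q hpq => ?_
    suffices H : ∀ i, R.partInj E.1 p i ≫ (R.cochain m d).v p q hpq =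
        R.partInj E.1 p i ≫ z.v p q hpq from
      biproduct.hom_ext' ((R.cochain m d).v p q hpq : R.part E.1 p ⟶ R.part F.1 q) _ H
    intro i
    obtain ⟨i, hi⟩ := i
    obtain rfl : p = -E.1.shift i := by omega
    subst hpq
    have h1 := R.partInj_incl E.1 (-E.1.shift i) ⟨i, hi⟩
    rw [cochain_v, reassoc_of% h1, reassoc_of% (hm i), incl_proj, Category.comp_id,
      ← Category.assoc, R.inj_proj E.1 (-E.1.shift i) ⟨i, hi⟩]

end Cochain

/-! ### Morphisms of complexes -/

section Hom

variable {E F G : A.twQuiver.Ob}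

/-- A closed morphism of degree `0`. -/
def IsClosed (m : R.total E.1 ⟶ R.total F.1) : Prop :=
  R.IsHomogeneous m 0 ∧ m ≫ R.matrix F.1.δ = R.matrix E.1.δ ≫ m

variable {R}

/-- The morphism of complexes given by a closed morphism of degree `0`. -/
def homOf (m : R.total E.1 ⟶ R.total F.1) (hm : R.IsClosed m) : R.complex E ⟶ R.complex F where
  f n := R.incl E.1 n ≫ m ≫ R.proj F.1 n
  comm' p q h := by
    rw [complex_d, complex_d, Category.assoc, Category.assoc, Category.assoc, Category.assoc,
      hm.1.incl_comp_assoc (add_zero p), (R.isHomogeneous_δ E.1).incl_comp_assoc h,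
      reassoc_of% hm.2]

lemma ofHom_homOf {m : R.total E.1 ⟶ R.total F.1} (hm : R.IsClosed m) :
    Cochain.ofHom (homOf m hm) = R.cochain m 0 := by
  refine Cochain.ext₀ _ _ fun p => ?_
  rw [Cochain.ofHom_v]
  rfl

lemma isClosed_id : R.IsClosed (𝟙 (R.total E.1)) :=
  ⟨.id _, by rw [Category.id_comp, Category.comp_id]⟩

lemma IsClosed.comp {m : R.total E.1 ⟶ R.total F.1} {m' : R.total F.1 ⟶ R.total G.1}
    (hm : R.IsClosed m) (hm' : R.IsClosed m') : R.IsClosed (m ≫ m') :=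
  ⟨hm.1.comp hm'.1 (add_zero 0), by rw [Category.assoc, hm'.2, reassoc_of% hm.2]⟩

lemma homOf_id : homOf (𝟙 (R.total E.1)) isClosed_id = 𝟙 (R.complex E) := by
  refine HomologicalComplex.hom_ext _ _ fun n => ?_
  exact (congrArg (R.incl E.1 n ≫ ·) (Category.id_comp _)).trans (R.incl_proj E.1 n)

lemma homOf_comp {m : R.total E.1 ⟶ R.total F.1} {m' : R.total F.1 ⟶ R.total G.1}
    (hm : R.IsClosed m) (hm' : R.IsClosed m') :
    homOf (m ≫ m') (hm.comp hm') = homOf m hm ≫ homOf m' hm' := by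
  refine HomologicalComplex.hom_ext _ _ fun n => ?_
  change R.incl E.1 n ≫ (m ≫ m') ≫ R.proj G.1 n =
    (R.incl E.1 n ≫ m ≫ R.proj F.1 n) ≫ R.incl F.1 n ≫ m' ≫ R.proj G.1 n
  rw [Category.assoc, Category.assoc, Category.assoc, hm.1.incl_comp_assoc (add_zero n)]

/-- Fullness before passing to homotopy classes: a chain map is a cochain of degree zero with
vanishing differential, and both facts transfer to its matrix. -/
lemma homOf_surjective (f : R.complex E ⟶ R.complex F) :
    ∃ (m : R.total E.1 ⟶ R.total F.1) (hm : R.IsClosed m), homOf m hm = f := by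
  obtain ⟨m, hm, hmf⟩ := cochain_surjective (Cochain.ofHom f)
  have h1 := δ_cochain hm (zero_add 1)
  have h2 : R.IsHomogeneous (m ≫ R.matrix F.1.δ + (1 : ℤ).negOnePow • (R.matrix E.1.δ ≫ m)) 1 := by
    rw [Int.negOnePow_one, Units.neg_smul, one_smul]
    exact (hm.comp (R.isHomogeneous_δ F.1) (zero_add 1)).add
      ((R.isHomogeneous_δ E.1).comp hm (add_zero 1)).neg
  have hc : R.IsClosed m := by
    refine ⟨hm, ?_⟩
    rw [← sub_eq_zero, sub_eq_add_neg]
    have h3 : (0 : R.total E.1 ⟶ R.total F.1) = -0 := neg_zero.symm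
    -- Commutation with the differentials is tested on the cochain of degree `1` of the commutator,
    -- which is the differential of the cochain of `f`.
    refine cochain_injective (d := 1) ?_ (m' := 0) (fun i j _ => by simp) ?_
    · simpa [Units.smul_def] using h2
    · rw [hmf, δ_ofHom] at h1
      simp only [Int.negOnePow_one, Units.neg_smul, one_smul] at h1
      rw [← h1]
      refine Cochain.ext _ _ fun p q h => ?_
      simp [cochain_v]
  refine ⟨m, hc, ?_⟩
  have h3 := (ofHom_homOf hc).trans hmf
  refine HomologicalComplex.hom_ext _ _ fun n => ?_
  have h4 := Cochain.congr_v h3 n n (add_zero n)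
  rwa [Cochain.ofHom_v, Cochain.ofHom_v] at h4

/-- Two closed morphisms give homotopic morphisms of complexes if and only if they differ by a
boundary. -/
lemma homotopy_iff {m : R.total E.1 ⟶ R.total F.1} (hm : R.IsClosed m) :
    Nonempty (Homotopy (homOf m hm) 0) ↔ ∃ c : R.total E.1 ⟶ R.total F.1,
      R.IsHomogeneous c (-1) ∧ c ≫ R.matrix F.1.δ + R.matrix E.1.δ ≫ c = m := by
  have key : ∀ c : R.total E.1 ⟶ R.total F.1, R.IsHomogeneous c (-1) →
      δ (-1) 0 (R.cochain c (-1)) = R.cochain (c ≫ R.matrix F.1.δ + R.matrix E.1.δ ≫ c) 0 := by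
    intro c hc
    rw [δ_cochain hc (by omega), Int.negOnePow_zero, one_smul]
  constructor
  · rintro ⟨ho⟩
    obtain ⟨c, hc, hco⟩ := cochain_surjective (Cochain.ofHomotopy ho)
    refine ⟨c, hc, cochain_injective (d := 0) ?_ hm.1 ?_⟩
    · exact (hc.comp (R.isHomogeneous_δ F.1) (by omega)).add
        ((R.isHomogeneous_δ E.1).comp hc (by omega))
    · rw [← key c hc, hco, δ_ofHomotopy, Cochain.ofHom_zero, sub_zero, ofHom_homOf]
  · rintro ⟨c, hc, hcm⟩
    refine ⟨(Cochain.equivHomotopy _ _).symm ⟨R.cochain c (-1), ?_⟩⟩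
    rw [key c hc, hcm, ofHom_homOf, Cochain.ofHom_zero, add_zero]

end Hom

end AInfData.LinearModel

/-! ## The functor to the homotopy category of complexes -/

namespace AInfData.LinearModel

open GradedQuiver Limits

variable {k : Type u} [Field k] {A : AInfData.{u, w₁, w₂} k} {C : Type v}
    [Category.{w} C] [Preadditive C] [Linear k C] (R : A.LinearModel C) [HasFiniteBiproducts C]

variable {R} in
lemma homOf_congr {E F : A.twQuiver.Ob} {m m' : R.total E.1 ⟶ R.total F.1} (hm : R.IsClosed m)
    (h : m = m') : homOf m hm = homOf m' (h ▸ hm) := by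
  subst h
  rfl

variable (h : A.tw.IsAInf) {E F G : A.twQuiver.Ob}

lemma mem_cycles_iff {f : A.twQuiver.Hom E F} :
    f ∈ h.cycles E F ↔ R.IsClosed (R.matrix f) := by
  have key : ∀ ha : f ∈ A.twQuiver.gr E F 0, twμ (.single ⟨0, f, ha⟩) = 0 ↔
      R.matrix f ≫ R.matrix F.1.δ = R.matrix E.1.δ ≫ R.matrix f := by
    intro ha
    rw [← (R.matrix (E := E.1) (F := F.1)).map_eq_zero_iff, R.matrix_tw_single,
      Int.negOnePow_zero, one_smul, sub_eq_zero]
  constructor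
  · rintro ⟨ha, ha'⟩
    exact ⟨mem_twGr_iff.1 ha, (key ha).1 ha'⟩
  · rintro ⟨ha, ha'⟩
    exact ⟨mem_twGr_iff.2 ha, (key (mem_twGr_iff.2 ha)).2 ha'⟩

lemma mem_boundaries_iff {f : A.twQuiver.Hom E F} :
    f ∈ h.boundaries E F ↔ ∃ c : R.total E.1 ⟶ R.total F.1,
      R.IsHomogeneous c (-1) ∧ c ≫ R.matrix F.1.δ + R.matrix E.1.δ ≫ c = R.matrix f := by
  have key : ∀ (c : A.twQuiver.Hom E F) (hc : c ∈ A.twQuiver.gr E F (-1)),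
      R.matrix (twμ (.single ⟨-1, c, hc⟩)) =
        -(R.matrix c ≫ R.matrix F.1.δ + R.matrix E.1.δ ≫ R.matrix c) := by
    intro c hc
    rw [R.matrix_tw_single]
    simp only [Int.negOnePow_neg, Int.negOnePow_one, Units.neg_smul, one_smul]
    abel
  constructor
  · rintro ⟨c, hc, rfl⟩
    -- In degree `-1` the operation `μ¹` is minus the differential of the Hom complex, so a
    -- primitive changes sign.
    refine ⟨-R.matrix c, (mem_twGr_iff.1 hc).neg, ?_⟩
    refine Eq.trans ?_ (key c hc).symm
    simp only [Preadditive.neg_comp, Preadditive.comp_neg, neg_add]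
  · rintro ⟨c, hc, hcf⟩
    have h1 : -(R.matrix (E := E.1) (F := F.1)).symm c ∈ A.twQuiver.gr E F (-1) := by
      refine neg_mem ((mem_twGr_iff (R := R)).2 ?_)
      rwa [LinearEquiv.apply_symm_apply]
    refine ⟨-(R.matrix (E := E.1) (F := F.1)).symm c, h1,
      (R.matrix (E := E.1) (F := F.1)).injective ((key _ h1).trans ?_)⟩
    rw [← hcf, map_neg, LinearEquiv.apply_symm_apply]
    simp only [Preadditive.neg_comp, Preadditive.comp_neg, neg_add, neg_neg]

variable {h} in
/-- The morphism of complexes of a closed morphism. -/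
def cycleHom (f : h.cycles E F) : R.complex E ⟶ R.complex F :=
  homOf (R.matrix f.1) ((R.mem_cycles_iff h).1 f.2)

/-- The class of the morphism of complexes of a closed morphism. -/
def cycleMap (E F : A.twQuiver.Ob) : h.cycles E F →ₗ[k]
    ((HomotopyCategory.quotient C (ComplexShape.up ℤ)).obj (R.complex E) ⟶
      (HomotopyCategory.quotient C (ComplexShape.up ℤ)).obj (R.complex F)) where
  toFun f := (HomotopyCategory.quotient C (ComplexShape.up ℤ)).map (R.cycleHom f)
  map_add' f g := by
    rw [← Functor.map_add]
    congr 1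
    refine HomologicalComplex.hom_ext _ _ fun n => ?_
    have key : ∀ f g : A.twQuiver.Hom E F, R.incl E.1 n ≫ R.matrix (f + g) ≫ R.proj F.1 n =
        R.incl E.1 n ≫ R.matrix f ≫ R.proj F.1 n + R.incl E.1 n ≫ R.matrix g ≫ R.proj F.1 n := by
      intro f g
      rw [map_add, Preadditive.add_comp, Preadditive.comp_add]
    exact key f.1 g.1
  map_smul' c f := by
    rw [RingHom.id_apply, ← Functor.map_smul]
    congr 1
    refine HomologicalComplex.hom_ext _ _ fun n => ?_
    have key : ∀ f : A.twQuiver.Hom E F, R.incl E.1 n ≫ R.matrix (c • f) ≫ R.proj F.1 n =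
        c • (R.incl E.1 n ≫ R.matrix f ≫ R.proj F.1 n) := by
      intro f
      rw [map_smul, Linear.smul_comp, Linear.comp_smul]
    exact key f.1

/-- One direction makes the functor well defined on classes, the other makes it faithful. -/
lemma cycleMap_eq_zero_iff (f : h.cycles E F) :
    R.cycleMap h E F f = 0 ↔ f.1 ∈ h.boundaries E F := by
  exact (HomotopyCategory.quotient_map_eq_zero_iff (R.cycleHom f)).trans
    ((homotopy_iff ((R.mem_cycles_iff h).1 f.2)).trans (R.mem_boundaries_iff h).symm)

/-- The functor from the homotopy category of twisted complexes to the homotopy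
category of complexes. -/
def toComplexes : H0 A.tw h ⥤ HomotopyCategory C (ComplexShape.up ℤ) where
  obj X := (HomotopyCategory.quotient C (ComplexShape.up ℤ)).obj (R.complex X.of)
  map {X Y} := Submodule.liftQ _ (R.cycleMap h X.of Y.of) fun f hf =>
    (R.cycleMap_eq_zero_iff h f).2 hf
  map_id X := by
    refine Eq.trans ?_ ((HomotopyCategory.quotient C (ComplexShape.up ℤ)).map_id _)
    refine congrArg (HomotopyCategory.quotient C (ComplexShape.up ℤ)).map ?_
    exact (homOf_congr _ (R.matrix_unitMatrix X.of.1)).trans homOf_id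
  map_comp {X Y Z} f g := by
    obtain ⟨f, rfl⟩ := Submodule.Quotient.mk_surjective _ f
    obtain ⟨g, rfl⟩ := Submodule.Quotient.mk_surjective _ g
    refine Eq.trans ?_ ((HomotopyCategory.quotient C (ComplexShape.up ℤ)).map_comp
      (R.cycleHom f) (R.cycleHom g))
    refine congrArg (HomotopyCategory.quotient C (ComplexShape.up ℤ)).map ?_
    refine (homOf_congr _ ?_).trans (homOf_comp _ _)
    exact (R.matrix_tw_pair (h.cycHom f) (h.cycHom g)).trans (one_smul _ _)

lemma toComplexes_map_cls {f : A.twQuiver.Hom E F} (hf : f ∈ h.cycles E F) :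
    (R.toComplexes h).map (X := ⟨E⟩) (Y := ⟨F⟩) (h.cls f hf) =
      (HomotopyCategory.quotient C (ComplexShape.up ℤ)).map
        (homOf (R.matrix f) ((R.mem_cycles_iff h).1 hf)) := rfl

instance : (R.toComplexes h).Additive where
  map_add {X Y f g} := (Submodule.liftQ _ (R.cycleMap h X.of Y.of) _).map_add f g

instance : (R.toComplexes h).Linear k where
  map_smul {X Y} f c := (Submodule.liftQ _ (R.cycleMap h X.of Y.of) _).map_smul c f

instance : (R.toComplexes h).Faithful where
  map_injective {X Y} := by
    refine (injective_iff_map_eq_zero ((R.toComplexes h).mapAddHom (X := X) (Y := Y))).2 ?_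
    intro f hf
    obtain ⟨f, rfl⟩ := Submodule.Quotient.mk_surjective _ f
    exact (Submodule.Quotient.mk_eq_zero _).2 ((R.cycleMap_eq_zero_iff h f).1 hf)

instance : (R.toComplexes h).Full where
  map_surjective {X Y} φ := by
    obtain ⟨φ, rfl⟩ := (HomotopyCategory.quotient C (ComplexShape.up ℤ)).map_surjective φ
    obtain ⟨m, hm, rfl⟩ := homOf_surjective φ
    have h1 : R.matrix (R.matrix.symm m) = m := R.matrix.apply_symm_apply m
    have h2 : R.matrix.symm m ∈ h.cycles X.of Y.of := (R.mem_cycles_iff h).2 (h1.symm ▸ hm)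
    refine ⟨h.cls _ h2, ?_⟩
    refine congrArg (HomotopyCategory.quotient C (ComplexShape.up ℤ)).map ?_
    exact homOf_congr _ h1

end AInfData.LinearModel

/-! ## Isomorphisms of complexes given by cochains -/

namespace CochainComplex

open Limits HomComplex

variable {C : Type v} [Category.{w} C] [Preadditive C] {K L M : CochainComplex C ℤ}

/-- A cocycle of degree `1` is a chain map to the shift. Compatibility with differentials is built
in, so only the components need inverses. -/
lemma HomComplex.Cocycle.isIso_equivHomShift_symm (z : Cocycle K L 1)
    (hz : ∀ p : ℤ, IsIso (z.1.v p (p + 1) rfl)) :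
    IsIso ((Cocycle.equivHomShift (n := 1)).symm z) := by
  have : ∀ p, IsIso (((Cocycle.equivHomShift (n := 1)).symm z).f p) := by
    intro p
    have h1 : ((Cocycle.equivHomShift (n := 1)).symm z).f p =
        z.1.v p (p + 1) rfl ≫ (L.shiftFunctorObjXIso 1 p (p + 1) rfl).inv := by
      rw [← Cochain.rightShift_v z.1 1 0 (zero_add 1) p p (add_zero p) (p + 1) rfl]
      rfl
    rw [h1]
    have := hz p
    infer_instance
  exact HomologicalComplex.Hom.isIso_of_components _

variable [HasBinaryBiproducts C] (φ : K ⟶ L)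

/-- The graded inverse `α', β'` need not be compatible with differentials, as a chain map with
invertible components is an isomorphism. -/
lemma mappingCone.isIso_lift (α : Cocycle M K 1) (β : Cochain M L 0)
    (eq : δ 0 1 β + α.1.comp (Cochain.ofHom φ) (add_zero 1) = 0)
    (α' : Cochain K M (-1)) (β' : Cochain L M 0)
    (h : α.1.comp α' (by omega) + β.comp β' (add_zero 0) = Cochain.ofHom (𝟙 M))
    (hαα : α'.comp α.1 (by omega) = Cochain.ofHom (𝟙 K))
    (hαβ : α'.comp β (add_zero (-1)) = 0) (hβα : β'.comp α.1 (zero_add 1) = 0)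
    (hββ : β'.comp β (add_zero 0) = Cochain.ofHom (𝟙 L)) :
    IsIso (mappingCone.lift φ α β eq) := by
  have : ∀ p, IsIso ((mappingCone.lift φ α β eq).f p) := by
    intro p
    refine ⟨(fst φ).1.v p (p + 1) rfl ≫ α'.v (p + 1) p (by omega) +
      (snd φ).v p p (add_zero p) ≫ β'.v p p (add_zero p), ?_, ?_⟩
    · have h1 := Cochain.congr_v h p p (add_zero p)
      rw [Cochain.add_v, Cochain.comp_v _ _ _ p (p + 1) p rfl (by omega),
        Cochain.comp_v _ _ _ p p p (add_zero p) (add_zero p), Cochain.ofHom_v] at h1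
      rw [Preadditive.comp_add, lift_f_fst_v_assoc, lift_f_snd_v_assoc, h1]
      rfl
    · rw [ext_from_iff φ (p + 1) p rfl]
      have h1 := Cochain.congr_v hαα (p + 1) (p + 1) (add_zero _)
      have h2 := Cochain.congr_v hαβ (p + 1) p (by omega)
      have h3 := Cochain.congr_v hβα p (p + 1) rfl
      have h4 := Cochain.congr_v hββ p p (add_zero p)
      rw [Cochain.comp_v _ _ _ (p + 1) p (p + 1) (by omega) rfl, Cochain.ofHom_v,
        HomologicalComplex.id_f] at h1
      rw [Cochain.comp_v _ _ _ (p + 1) p p (by omega) (add_zero p), Cochain.zero_v] at h2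
      rw [Cochain.comp_v _ _ _ p p (p + 1) (add_zero p) rfl, Cochain.zero_v] at h3
      rw [Cochain.comp_v _ _ _ p p p (add_zero p) (add_zero p), Cochain.ofHom_v,
        HomologicalComplex.id_f] at h4
      constructor
      · rw [Preadditive.add_comp, Preadditive.comp_add, Category.assoc, Category.assoc,
          inl_v_fst_v_assoc, inl_v_snd_v_assoc, zero_comp, add_zero, lift_f φ α β eq p (p + 1) rfl,
          Preadditive.comp_add, reassoc_of% h1, reassoc_of% h2, zero_comp, add_zero,
          Category.comp_id]
      · rw [Preadditive.add_comp, Preadditive.comp_add, Category.assoc, Category.assoc,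
          inr_f_fst_v_assoc, inr_f_snd_v_assoc, zero_comp, zero_add, lift_f φ α β eq p (p + 1) rfl,
          Preadditive.comp_add, reassoc_of% h3, reassoc_of% h4, zero_comp, zero_add,
          Category.comp_id]
  exact HomologicalComplex.Hom.isIso_of_components _

end CochainComplex

/-! ## Shifts and cones -/

namespace AInfData.LinearModel

open GradedQuiver Limits CochainComplex CochainComplex.HomComplex

variable {k : Type u} [Field k] {A : AInfData.{u, w₁, w₂} k} {C : Type v}
    [Category.{w} C] [Preadditive C] [Linear k C] (R : A.LinearModel C) [HasFiniteBiproducts C]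

lemma mc_iff_matrix (E : A.PreTw) : E.MC ↔ R.matrix E.δ ≫ R.matrix E.δ = 0 := by
  refine ⟨fun h => R.matrix_δ_comp ⟨E, h⟩, fun h => (R.mc_iff E).2 fun i j => ?_⟩
  rw [← R.matrix_comp, h, zero_comp, comp_zero]

include R in
lemma mc_shiftOne (E : A.twQuiver.Ob) : E.1.shiftOne.MC :=
  (R.mc_iff_matrix E.1.shiftOne).2 (R.matrix_δ_comp E)

/-- The twisted complex `E[1]`. -/
abbrev shiftOne (E : A.twQuiver.Ob) : A.twQuiver.Ob := ⟨E.1.shiftOne, R.mc_shiftOne E⟩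

/-- The endomorphism with the sign of the cohomological degree, up to a global sign. -/
def signEnd (E : A.PreTw) : R.total E ⟶ R.total E :=
  -- The `+ 1` fixes the global sign for which the last map of the mapping cone triangle, minus the
  -- first projection, agrees with the one of the cone triangle.
  biproduct.map fun i => (E.shift i + 1).negOnePow • 𝟙 (R.obj (E.ob i))

lemma inj_signEnd (E : A.PreTw) (i : E.ι) :
    R.inj E i ≫ R.signEnd E = (E.shift i + 1).negOnePow • R.inj E i := by
  rw [signEnd, biproduct.ι_map, Linear.units_smul_comp, Category.id_comp]

lemma signEnd_prj (E : A.PreTw) (i : E.ι) :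
    R.signEnd E ≫ R.prj E i = (E.shift i + 1).negOnePow • R.prj E i := by
  rw [signEnd, biproduct.map_π, Linear.comp_units_smul, Category.comp_id]

lemma signEnd_signEnd (E : A.PreTw) : R.signEnd E ≫ R.signEnd E = 𝟙 _ := by
  refine biproduct.hom_ext' _ _ fun i => ?_
  rw [← Category.assoc, inj_signEnd, Linear.units_smul_comp, inj_signEnd, smul_smul,
    Int.units_mul_self, one_smul, Category.comp_id]

lemma isHomogeneous_signEnd (E : A.PreTw) : R.IsHomogeneous (R.signEnd E) 0 := fun i j h => by
  rw [signEnd_prj, Linear.comp_units_smul, biproduct.ι_π_ne, smul_zero]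
  rintro rfl
  omega

-- A map of degree `d` changes the parity of the shifts by `d`. So the sign twist commutes with even
-- maps and anticommutes with `δ`.
variable {R} in
lemma IsHomogeneous.signEnd_comp {E F : A.PreTw} {m : R.total E ⟶ R.total F} {d : ℤ}
    (hm : R.IsHomogeneous m d) : R.signEnd E ≫ m = d.negOnePow • (m ≫ R.signEnd F) := by
  refine R.total_ext fun i j => ?_
  rw [Category.assoc, ← Category.assoc, inj_signEnd, Linear.units_smul_comp,
    Linear.units_smul_comp, Linear.comp_units_smul, Category.assoc, signEnd_prj,
    Linear.comp_units_smul, Linear.comp_units_smul, smul_smul, ← Int.negOnePow_add]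
  by_cases h : d + F.shift j - E.shift i = 0
  · rw [show d + (F.shift j + 1) = E.shift i + 1 by omega]
  · rw [hm i j h, smul_zero, smul_zero]

/-- The comparison of `E[1]` and `E`, of degree `1`. -/
def shiftMap (E : A.PreTw) : R.total E.shiftOne ⟶ R.total E := R.signEnd E

/-- The comparison of `E` and `E[1]`, of degree `-1`. -/
def unshiftMap (E : A.PreTw) : R.total E ⟶ R.total E.shiftOne := R.signEnd E

lemma isHomogeneous_shiftMap (E : A.PreTw) : R.IsHomogeneous (R.shiftMap E) 1 := fun i j h =>
  R.isHomogeneous_signEnd E i j (by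
    have : E.shiftOne.shift i = E.shift i + 1 := rfl
    omega)

lemma isHomogeneous_unshiftMap (E : A.PreTw) : R.IsHomogeneous (R.unshiftMap E) (-1) := fun i j h =>
  R.isHomogeneous_signEnd E i j (by
    have : E.shiftOne.shift j = E.shift j + 1 := rfl
    omega)

lemma shiftMap_unshiftMap (E : A.PreTw) : R.shiftMap E ≫ R.unshiftMap E = 𝟙 _ :=
  R.signEnd_signEnd E

lemma unshiftMap_shiftMap (E : A.PreTw) : R.unshiftMap E ≫ R.shiftMap E = 𝟙 _ :=
  R.signEnd_signEnd E

/-- `E[1]` keeps the differential `δ`, while the shifted complex has the opposite one; the sign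
twist in the comparison absorbs the difference. -/
lemma shiftMap_δ (E : A.PreTw) :
    R.shiftMap E ≫ R.matrix E.δ + R.matrix E.shiftOne.δ ≫ R.shiftMap E = 0 := by
  change R.signEnd E ≫ R.matrix E.δ + R.matrix E.δ ≫ R.signEnd E = 0
  rw [(R.isHomogeneous_δ E).signEnd_comp, Int.negOnePow_one, Units.neg_smul, one_smul,
    neg_add_cancel]

/-- The cocycle of degree `1` from `E[1]` to `E`. -/
def shiftCocycle (E : A.twQuiver.Ob) :
    Cocycle (R.complex (R.shiftOne E)) (R.complex E) 1 :=
  Cocycle.mk (R.cochain (E := R.shiftOne E) (R.shiftMap E.1) 1) 2 rfl (by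
    rw [δ_cochain (E := R.shiftOne E) (R.isHomogeneous_shiftMap E.1)
      (show (1 : ℤ) + 1 = 2 by norm_num), Int.negOnePow_even 2 even_two, one_smul]
    refine (congrArg (fun m => R.cochain (E := R.shiftOne E) (F := E) m 2)
      (R.shiftMap_δ E.1)).trans ?_
    refine Cochain.ext _ _ fun p q h => ?_
    simp [cochain_v])

/-- The functor to complexes commutes with the shift. -/
def shiftIso (E : A.twQuiver.Ob) : R.complex (R.shiftOne E) ≅ (R.complex E)⟦(1 : ℤ)⟧ :=
  @asIso _ _ _ _ ((Cocycle.equivHomShift (n := 1)).symm (R.shiftCocycle E))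
    (Cocycle.isIso_equivHomShift_symm _ fun p => by
      refine ⟨(R.cochain (F := R.shiftOne E) (R.unshiftMap E.1) (-1)).v (p + 1) p (by omega),
        ?_, ?_⟩
      · have h := Cochain.congr_v (cochain_comp (E := R.shiftOne E) (G := R.shiftOne E)
          (R.isHomogeneous_shiftMap E.1) (R.unshiftMap E.1) (add_neg_cancel 1)) p p (add_zero p)
        rw [Cochain.comp_v _ _ _ p (p + 1) p rfl (by omega), R.shiftMap_unshiftMap] at h
        refine h.trans ((congrArg (R.incl _ p ≫ ·) (Category.id_comp _)).trans (R.incl_proj _ p))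
      · have h := Cochain.congr_v (cochain_comp (F := R.shiftOne E) (E := E) (G := E)
          (R.isHomogeneous_unshiftMap E.1) (R.shiftMap E.1) (neg_add_cancel 1)) (p + 1) (p + 1)
          (add_zero _)
        rw [Cochain.comp_v _ _ _ (p + 1) p (p + 1) (by omega) rfl, R.unshiftMap_shiftMap] at h
        refine h.trans ((congrArg (R.incl _ _ ≫ ·) (Category.id_comp _)).trans (R.incl_proj _ _)))

lemma shiftIso_hom (E : A.twQuiver.Ob) :
    (R.shiftIso E).hom = (Cocycle.equivHomShift (n := 1)).symm (R.shiftCocycle E) := rfl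

variable {R} in
lemma IsClosed.shift {E F : A.twQuiver.Ob} {m : R.total E.1 ⟶ R.total F.1} (hm : R.IsClosed m) :
    R.IsClosed (E := R.shiftOne E) (F := R.shiftOne F) m :=
  ⟨fun i j h => hm.1 i j (by
    have h1 : E.1.shiftOne.shift i = E.1.shift i + 1 := rfl
    have h2 : F.1.shiftOne.shift j = F.1.shift j + 1 := rfl
    change 0 + F.1.shiftOne.shift j - E.1.shiftOne.shift i ≠ 0 at h
    omega), hm.2⟩

lemma shiftIso_naturality {E F : A.twQuiver.Ob} {m : R.total E.1 ⟶ R.total F.1}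
    (hm : R.IsClosed m) {m' : R.total E.1.shiftOne ⟶ R.total F.1.shiftOne}
    (hm' : R.IsClosed (E := R.shiftOne E) (F := R.shiftOne F) m')
    (h : m' ≫ R.shiftMap F.1 = R.shiftMap E.1 ≫ m) :
    homOf (E := R.shiftOne E) (F := R.shiftOne F) m' hm' ≫ (R.shiftIso F).hom =
      (R.shiftIso E).hom ≫ (homOf m hm)⟦(1 : ℤ)⟧' := by
  rw [shiftIso_hom, shiftIso_hom, ← Cocycle.equivHomShift_symm_precomp,
    ← Cocycle.equivHomShift_symm_postcomp]
  refine congrArg _ (Subtype.ext ?_)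
  change (Cochain.ofHom (homOf (E := R.shiftOne E) (F := R.shiftOne F) m' hm')).comp
    (R.cochain (E := R.shiftOne F) (R.shiftMap F.1) 1) (zero_add 1) =
    (R.cochain (E := R.shiftOne E) (R.shiftMap E.1) 1).comp (Cochain.ofHom (homOf m hm))
      (add_zero 1)
  rw [ofHom_homOf, ofHom_homOf, cochain_comp hm'.1,
    cochain_comp (E := R.shiftOne E) (R.isHomogeneous_shiftMap E.1), h]

lemma comp_shiftMap {E F : A.twQuiver.Ob} {m : R.total E.1 ⟶ R.total F.1}
    (hm : R.IsClosed m) :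
    (show R.total E.1.shiftOne ⟶ R.total F.1.shiftOne from m) ≫ R.shiftMap F.1 =
      R.shiftMap E.1 ≫ m := by
  change m ≫ R.signEnd F.1 = R.signEnd E.1 ≫ m
  rw [hm.1.signEnd_comp, Int.negOnePow_zero, one_smul]

/-! ### Cones -/

section Cone

variable {E F : A.twQuiver.Ob} {f : A.twQuiver.Hom E F} (hf : f ∈ A.twQuiver.gr E F 0)

/-- The inclusion of a summand of the first part of a cone. -/
def coneInj₁ (i : E.1.ι) : R.obj (E.1.ob i) ⟶ R.total (PreTw.cone E F f hf) :=
  R.inj (PreTw.cone E F f hf) (Sum.inlₗ i)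

/-- The inclusion of a summand of the second part of a cone. -/
def coneInj₂ (i : F.1.ι) : R.obj (F.1.ob i) ⟶ R.total (PreTw.cone E F f hf) :=
  R.inj (PreTw.cone E F f hf) (Sum.inrₗ i)

/-- The projection to a summand of the first part of a cone. -/
def conePrj₁ (i : E.1.ι) : R.total (PreTw.cone E F f hf) ⟶ R.obj (E.1.ob i) :=
  R.prj (PreTw.cone E F f hf) (Sum.inlₗ i)

/-- The projection to a summand of the second part of a cone. -/
def conePrj₂ (i : F.1.ι) : R.total (PreTw.cone E F f hf) ⟶ R.obj (F.1.ob i) :=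
  R.prj (PreTw.cone E F f hf) (Sum.inrₗ i)

lemma coneInj₁_conePrj₁ (i j : E.1.ι) :
    R.coneInj₁ hf i ≫ R.conePrj₁ hf j = R.inj E.1 i ≫ R.prj E.1 j := by
  by_cases h : i = j
  · subst h
    have h1 : R.inj (PreTw.cone E F f hf) (Sum.inlₗ i) ≫ R.prj _ (Sum.inlₗ i) = 𝟙 _ :=
      biproduct.ι_π_self _ _
    exact h1.trans (biproduct.ι_π_self (fun i => R.obj (E.1.ob i)) i).symm
  · have h0 : (Sum.inlₗ i : (PreTw.cone E F f hf).ι) ≠ Sum.inlₗ j :=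
      fun h' => h (Sum.inl_injective h')
    have h1 : R.inj (PreTw.cone E F f hf) (Sum.inlₗ i) ≫ R.prj _ (Sum.inlₗ j) = 0 :=
      biproduct.ι_π_ne _ h0
    exact h1.trans (biproduct.ι_π_ne (fun i => R.obj (E.1.ob i)) h).symm

lemma coneInj₂_conePrj₂ (i j : F.1.ι) :
    R.coneInj₂ hf i ≫ R.conePrj₂ hf j = R.inj F.1 i ≫ R.prj F.1 j := by
  by_cases h : i = j
  · subst h
    have h1 : R.inj (PreTw.cone E F f hf) (Sum.inrₗ i) ≫ R.prj _ (Sum.inrₗ i) = 𝟙 _ :=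
      biproduct.ι_π_self _ _
    exact h1.trans (biproduct.ι_π_self (fun i => R.obj (F.1.ob i)) i).symm
  · have h0 : (Sum.inrₗ i : (PreTw.cone E F f hf).ι) ≠ Sum.inrₗ j :=
      fun h' => h (Sum.inr_injective h')
    have h1 : R.inj (PreTw.cone E F f hf) (Sum.inrₗ i) ≫ R.prj _ (Sum.inrₗ j) = 0 :=
      biproduct.ι_π_ne _ h0
    exact h1.trans (biproduct.ι_π_ne (fun i => R.obj (F.1.ob i)) h).symm

lemma coneInj₁_conePrj₂ (i : E.1.ι) (j : F.1.ι) : R.coneInj₁ hf i ≫ R.conePrj₂ hf j = 0 :=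
  biproduct.ι_π_ne _ Sum.inl_ne_inr

lemma coneInj₂_conePrj₁ (i : F.1.ι) (j : E.1.ι) : R.coneInj₂ hf i ≫ R.conePrj₁ hf j = 0 :=
  biproduct.ι_π_ne _ Sum.inr_ne_inl

lemma cone_hom_ext {Z : C} {g g' : R.total (PreTw.cone E F f hf) ⟶ Z}
    (h₁ : ∀ i, R.coneInj₁ hf i ≫ g = R.coneInj₁ hf i ≫ g')
    (h₂ : ∀ i, R.coneInj₂ hf i ≫ g = R.coneInj₂ hf i ≫ g') : g = g' := by
  refine biproduct.hom_ext' _ _ fun x => ?_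
  rcases hx : ofLex x with i | i
  · obtain rfl : x = Sum.inlₗ i := hx
    exact h₁ i
  · obtain rfl : x = Sum.inrₗ i := hx
    exact h₂ i

lemma cone_hom_ext' {Z : C} {g g' : Z ⟶ R.total (PreTw.cone E F f hf)}
    (h₁ : ∀ i, g ≫ R.conePrj₁ hf i = g' ≫ R.conePrj₁ hf i)
    (h₂ : ∀ i, g ≫ R.conePrj₂ hf i = g' ≫ R.conePrj₂ hf i) : g = g' := by
  refine biproduct.hom_ext _ _ fun x => ?_
  rcases hx : ofLex x with i | i
  · obtain rfl : x = Sum.inlₗ i := hx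
    exact h₁ i
  · obtain rfl : x = Sum.inrₗ i := hx
    exact h₂ i

/-- The inclusion of the first part of a cone. -/
def coneIn₁ : R.total E.1 ⟶ R.total (PreTw.cone E F f hf) :=
  biproduct.desc fun i => R.coneInj₁ hf i

/-- The inclusion of the second part of a cone. -/
def coneIn₂ : R.total F.1 ⟶ R.total (PreTw.cone E F f hf) :=
  biproduct.desc fun i => R.coneInj₂ hf i

/-- The projection to the first part of a cone. -/
def coneOut₁ : R.total (PreTw.cone E F f hf) ⟶ R.total E.1 :=
  biproduct.lift fun i => R.conePrj₁ hf i

/-- The projection to the second part of a cone. -/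
def coneOut₂ : R.total (PreTw.cone E F f hf) ⟶ R.total F.1 :=
  biproduct.lift fun i => R.conePrj₂ hf i

lemma inj_coneIn₁ (i : E.1.ι) : R.inj E.1 i ≫ R.coneIn₁ hf = R.coneInj₁ hf i :=
  biproduct.ι_desc _ _

lemma inj_coneIn₂ (i : F.1.ι) : R.inj F.1 i ≫ R.coneIn₂ hf = R.coneInj₂ hf i :=
  biproduct.ι_desc _ _

lemma coneOut₁_prj (i : E.1.ι) : R.coneOut₁ hf ≫ R.prj E.1 i = R.conePrj₁ hf i :=
  biproduct.lift_π _ _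

lemma coneOut₂_prj (i : F.1.ι) : R.coneOut₂ hf ≫ R.prj F.1 i = R.conePrj₂ hf i :=
  biproduct.lift_π _ _

lemma coneInj₁_coneOut₁ (i : E.1.ι) : R.coneInj₁ hf i ≫ R.coneOut₁ hf = R.inj E.1 i :=
  biproduct.hom_ext _ _ fun j => by rw [Category.assoc, coneOut₁_prj, coneInj₁_conePrj₁]

lemma coneInj₂_coneOut₂ (i : F.1.ι) : R.coneInj₂ hf i ≫ R.coneOut₂ hf = R.inj F.1 i :=
  biproduct.hom_ext _ _ fun j => by rw [Category.assoc, coneOut₂_prj, coneInj₂_conePrj₂]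

lemma coneInj₁_coneOut₂ (i : E.1.ι) : R.coneInj₁ hf i ≫ R.coneOut₂ hf = 0 :=
  biproduct.hom_ext _ _ fun j => by rw [Category.assoc, coneOut₂_prj, coneInj₁_conePrj₂, zero_comp]

lemma coneInj₂_coneOut₁ (i : F.1.ι) : R.coneInj₂ hf i ≫ R.coneOut₁ hf = 0 :=
  biproduct.hom_ext _ _ fun j => by rw [Category.assoc, coneOut₁_prj, coneInj₂_conePrj₁, zero_comp]

lemma coneIn₁_coneOut₁ : R.coneIn₁ hf ≫ R.coneOut₁ hf = 𝟙 _ :=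
  biproduct.hom_ext' _ _ fun i => by
    rw [← Category.assoc, inj_coneIn₁, coneInj₁_coneOut₁, Category.comp_id]

lemma coneIn₂_coneOut₂ : R.coneIn₂ hf ≫ R.coneOut₂ hf = 𝟙 _ :=
  biproduct.hom_ext' _ _ fun i => by
    rw [← Category.assoc, inj_coneIn₂, coneInj₂_coneOut₂, Category.comp_id]

lemma coneIn₁_coneOut₂ : R.coneIn₁ hf ≫ R.coneOut₂ hf = 0 :=
  biproduct.hom_ext' _ _ fun i => by
    rw [← Category.assoc, inj_coneIn₁, coneInj₁_coneOut₂, comp_zero]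

lemma coneIn₂_coneOut₁ : R.coneIn₂ hf ≫ R.coneOut₁ hf = 0 :=
  biproduct.hom_ext' _ _ fun i => by
    rw [← Category.assoc, inj_coneIn₂, coneInj₂_coneOut₁, comp_zero]

lemma coneOut_coneIn :
    R.coneOut₁ hf ≫ R.coneIn₁ hf + R.coneOut₂ hf ≫ R.coneIn₂ hf = 𝟙 _ := by
  refine R.cone_hom_ext hf (fun i => ?_) (fun i => ?_)
  · rw [Preadditive.comp_add, reassoc_of% (R.coneInj₁_coneOut₁ hf i),
      reassoc_of% (R.coneInj₁_coneOut₂ hf i), zero_comp, add_zero, Category.comp_id, inj_coneIn₁]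
  · rw [Preadditive.comp_add, reassoc_of% (R.coneInj₂_coneOut₁ hf i),
      reassoc_of% (R.coneInj₂_coneOut₂ hf i), zero_comp, zero_add, Category.comp_id, inj_coneIn₂]

lemma isHomogeneous_coneIn₁ : R.IsHomogeneous (R.coneIn₁ hf) (-1) := fun i x h => by
  rw [← Category.assoc, inj_coneIn₁]
  refine biproduct.ι_π_ne _ ?_
  rintro rfl
  exact h (by change -1 + (E.1.shift i + 1) - E.1.shift i = 0; omega)

lemma isHomogeneous_coneIn₂ : R.IsHomogeneous (R.coneIn₂ hf) 0 := fun i x h => by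
  rw [← Category.assoc, inj_coneIn₂]
  refine biproduct.ι_π_ne _ ?_
  rintro rfl
  exact h (by change 0 + F.1.shift i - F.1.shift i = 0; omega)

lemma isHomogeneous_coneOut₁ : R.IsHomogeneous (R.coneOut₁ hf) 1 := fun x i h => by
  rw [coneOut₁_prj]
  refine biproduct.ι_π_ne _ ?_
  rintro rfl
  exact h (by change 1 + E.1.shift i - (E.1.shift i + 1) = 0; omega)

lemma isHomogeneous_coneOut₂ : R.IsHomogeneous (R.coneOut₂ hf) 0 := fun x i h => by
  rw [coneOut₂_prj]
  refine biproduct.ι_π_ne _ ?_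
  rintro rfl
  exact h (by change 0 + F.1.shift i - F.1.shift i = 0; omega)

/-- The sign of the off-diagonal entry uses the shift of the target, the twist that of the source.
They match because a degree zero morphism is nonzero only between summands of equal shift. -/
lemma coneIn₁_δ : R.coneIn₁ hf ≫ R.matrix (PreTw.cone E F f hf).δ =
    R.matrix E.1.δ ≫ R.coneIn₁ hf - R.signEnd E.1 ≫ R.matrix f ≫ R.coneIn₂ hf := by
  have h₁ (i j) : R.coneInj₁ hf i ≫ R.matrix (PreTw.cone E F f hf).δ ≫ R.conePrj₁ hf j =
      R.map (E.1.δ i j) := R.ι_matrix_π (PreTw.cone E F f hf).δ (Sum.inlₗ i) (Sum.inlₗ j)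
  have h₂ (i j) : R.coneInj₁ hf i ≫ R.matrix (PreTw.cone E F f hf).δ ≫ R.conePrj₂ hf j =
      R.map ((F.1.shift j).negOnePow • f i j) :=
    R.ι_matrix_π (PreTw.cone E F f hf).δ (Sum.inlₗ i) (Sum.inrₗ j)
  have e₁₁ : R.coneIn₁ hf ≫ R.coneOut₁ hf = 𝟙 _ := R.coneIn₁_coneOut₁ hf
  refine biproduct.hom_ext' _ _ fun i => R.cone_hom_ext' hf (fun j => ?_) (fun j => ?_)
  · have h3 := R.ι_matrix_π E.1.δ i j
    rw [← Category.assoc, inj_coneIn₁, Category.assoc, h₁, ← h3, ← coneOut₁_prj,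
      Category.assoc, Preadditive.sub_comp, Category.assoc, Category.assoc, Category.assoc,
      reassoc_of% e₁₁, reassoc_of% (R.coneIn₂_coneOut₁ hf), zero_comp, comp_zero, comp_zero,
      sub_zero]
  · have h3 := R.ι_matrix_π f i j
    rw [← Category.assoc, inj_coneIn₁, Category.assoc, h₂, ← coneOut₂_prj,
      Category.assoc, Preadditive.sub_comp, Category.assoc, Category.assoc, Category.assoc,
      reassoc_of% (R.coneIn₁_coneOut₂ hf), reassoc_of% (R.coneIn₂_coneOut₂ hf), zero_comp,
      comp_zero, zero_sub, Preadditive.comp_neg, ← Category.assoc, inj_signEnd,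
      Linear.units_smul_comp, h3]
    by_cases h : E.1.shift i = F.1.shift j
    · rw [h, Int.negOnePow_succ, Units.neg_smul, neg_neg, Units.smul_def, Units.smul_def, map_zsmul]
    · rw [R.eq_zero_of_mem (mem_twGr.1 hf i j) (by omega), smul_zero, map_zero, smul_zero,
        neg_zero]

lemma coneIn₂_δ : R.coneIn₂ hf ≫ R.matrix (PreTw.cone E F f hf).δ =
    R.matrix F.1.δ ≫ R.coneIn₂ hf := by
  have h₁ (i j) : R.coneInj₂ hf i ≫ R.matrix (PreTw.cone E F f hf).δ ≫ R.conePrj₁ hf j = 0 :=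
    (R.ι_matrix_π (PreTw.cone E F f hf).δ (Sum.inrₗ i) (Sum.inlₗ j)).trans R.map.map_zero
  have h₂ (i j) : R.coneInj₂ hf i ≫ R.matrix (PreTw.cone E F f hf).δ ≫ R.conePrj₂ hf j =
      R.map (F.1.δ i j) := R.ι_matrix_π (PreTw.cone E F f hf).δ (Sum.inrₗ i) (Sum.inrₗ j)
  refine biproduct.hom_ext' _ _ fun i => R.cone_hom_ext' hf (fun j => ?_) (fun j => ?_)
  · rw [← Category.assoc, inj_coneIn₂, Category.assoc, h₁, ← coneOut₁_prj, Category.assoc,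
      Category.assoc, reassoc_of% (R.coneIn₂_coneOut₁ hf), zero_comp, comp_zero, comp_zero]
  · have h3 := R.ι_matrix_π F.1.δ i j
    rw [← Category.assoc, inj_coneIn₂, Category.assoc, h₂, ← h3, ← coneOut₂_prj, Category.assoc,
      Category.assoc, reassoc_of% (R.coneIn₂_coneOut₂ hf)]

/-- Dual to the formulas for the inclusions, and deduced from them by inserting the decomposition of
the identity of the cone. -/
lemma δ_coneOut₁ : R.matrix (PreTw.cone E F f hf).δ ≫ R.coneOut₁ hf =
    R.coneOut₁ hf ≫ R.matrix E.1.δ := by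
  have h := congrArg (· ≫ R.matrix (PreTw.cone E F f hf).δ ≫ R.coneOut₁ hf) (R.coneOut_coneIn hf)
  simp only [Preadditive.add_comp, Category.assoc, Category.id_comp,
    reassoc_of% (R.coneIn₁_δ hf), reassoc_of% (R.coneIn₂_δ hf), Preadditive.sub_comp,
    R.coneIn₁_coneOut₁, R.coneIn₂_coneOut₁, comp_zero, add_zero, sub_zero, Category.comp_id] at h
  exact h.symm

lemma δ_coneOut₂ : R.matrix (PreTw.cone E F f hf).δ ≫ R.coneOut₂ hf =
    R.coneOut₂ hf ≫ R.matrix F.1.δ - R.coneOut₁ hf ≫ R.signEnd E.1 ≫ R.matrix f := by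
  have h := congrArg (· ≫ R.matrix (PreTw.cone E F f hf).δ ≫ R.coneOut₂ hf) (R.coneOut_coneIn hf)
  simp only [Preadditive.add_comp, Category.assoc, Category.id_comp,
    reassoc_of% (R.coneIn₁_δ hf), reassoc_of% (R.coneIn₂_δ hf), Preadditive.sub_comp,
    R.coneIn₁_coneOut₂, R.coneIn₂_coneOut₂, comp_zero, zero_sub, Preadditive.comp_neg,
    Category.comp_id] at h
  rw [← h]
  abel

/-- The diagonal blocks square to zero. In the off-diagonal block the two terms cancel, because `f`
commutes with the differentials and the sign twist anticommutes with `δ`. -/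
lemma mc_cone (hc : R.IsClosed (R.matrix f)) : (PreTw.cone E F f hf).MC := by
  refine (R.mc_iff_matrix _).2 ?_
  have h₁ : R.coneIn₁ hf ≫ R.matrix (PreTw.cone E F f hf).δ ≫
      R.matrix (PreTw.cone E F f hf).δ = 0 := by
    have h2 := (R.isHomogeneous_δ E.1).signEnd_comp
    rw [Int.negOnePow_one, Units.neg_smul, one_smul] at h2
    rw [← Category.assoc, coneIn₁_δ, Preadditive.sub_comp, Category.assoc, coneIn₁_δ,
      Category.assoc, Category.assoc, coneIn₂_δ, Preadditive.comp_sub,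
      reassoc_of% (R.matrix_δ_comp E), zero_comp, zero_sub, reassoc_of% hc.2, reassoc_of% h2,
      Preadditive.neg_comp, Category.assoc, sub_neg_eq_add, neg_add_cancel]
  have h₂ : R.coneIn₂ hf ≫ R.matrix (PreTw.cone E F f hf).δ ≫
      R.matrix (PreTw.cone E F f hf).δ = 0 := by
    rw [← Category.assoc, coneIn₂_δ, Category.assoc, coneIn₂_δ, reassoc_of% (R.matrix_δ_comp F),
      zero_comp]
  refine R.cone_hom_ext hf (fun i => ?_) (fun i => ?_)
  · rw [← inj_coneIn₁, Category.assoc, h₁, comp_zero, comp_zero]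
  · rw [← inj_coneIn₂, Category.assoc, h₂, comp_zero, comp_zero]

lemma map_unitMatrix (E : A.PreTw) (i j : E.ι) :
    R.map (A.unitMatrix E.ob i j) = R.inj E i ≫ R.prj E j := by
  rw [← R.ι_matrix_π (F := E), matrix_unitMatrix, Category.id_comp]

lemma matrix_coneInr (hc : (PreTw.cone E F f hf).MC) :
    R.matrix (coneInr E F f hf hc) = R.coneIn₂ hf := by
  have h₁ (i j) : R.inj F.1 i ≫ R.matrix (coneInr E F f hf hc) ≫ R.conePrj₁ hf j = 0 :=
    (R.ι_matrix_π (F := PreTw.cone E F f hf) (coneInr E F f hf hc) i (Sum.inlₗ j)).trans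
      R.map.map_zero
  have h₂ (i j) : R.inj F.1 i ≫ R.matrix (coneInr E F f hf hc) ≫ R.conePrj₂ hf j =
      R.inj F.1 i ≫ R.prj F.1 j :=
    (R.ι_matrix_π (F := PreTw.cone E F f hf) (coneInr E F f hf hc) i (Sum.inrₗ j)).trans
      (R.map_unitMatrix F.1 i j)
  refine biproduct.hom_ext' _ _ fun i => R.cone_hom_ext' hf (fun j => ?_) (fun j => ?_)
  · rw [Category.assoc, h₁, inj_coneIn₂, coneInj₂_conePrj₁]
  · rw [Category.assoc, h₂, inj_coneIn₂, coneInj₂_conePrj₂]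

lemma matrix_coneFst (hc : (PreTw.cone E F f hf).MC) (hE : E.1.shiftOne.MC) :
    R.matrix (E := PreTw.cone E F f hf) (F := E.1.shiftOne) (coneFst E F f hf hc hE) =
      R.coneOut₁ hf := by
  have h₁ (i j) : R.coneInj₁ hf i ≫ R.matrix (E := PreTw.cone E F f hf) (F := E.1.shiftOne)
      (coneFst E F f hf hc hE) ≫ R.prj E.1.shiftOne j = R.inj E.1 i ≫ R.prj E.1 j :=
    (R.ι_matrix_π (E := PreTw.cone E F f hf) (F := E.1.shiftOne) (coneFst E F f hf hc hE)
      (Sum.inlₗ i) j).trans (R.map_unitMatrix E.1 i j)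
  have h₂ (i j) : R.coneInj₂ hf i ≫ R.matrix (E := PreTw.cone E F f hf) (F := E.1.shiftOne)
      (coneFst E F f hf hc hE) ≫ R.prj E.1.shiftOne j = 0 :=
    (R.ι_matrix_π (E := PreTw.cone E F f hf) (F := E.1.shiftOne) (coneFst E F f hf hc hE)
      (Sum.inrₗ i) j).trans R.map.map_zero
  refine R.cone_hom_ext hf (fun i => ?_) (fun i => ?_)
  · refine biproduct.hom_ext _ _ fun j => ?_
    refine (Category.assoc _ _ _).trans ((h₁ i j).trans ?_)
    exact congrArg (· ≫ R.prj E.1 j) (R.coneInj₁_coneOut₁ hf i).symm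
  · refine biproduct.hom_ext _ _ fun j => ?_
    refine (Category.assoc _ _ _).trans ((h₂ i j).trans ?_)
    exact (zero_comp.symm).trans (congrArg (· ≫ R.prj E.1 j) (R.coneInj₂_coneOut₁ hf i).symm)

variable (hm : R.IsClosed (R.matrix f))

/-- The cone of a closed morphism of degree `0`. -/
abbrev coneOb : A.twQuiver.Ob := ⟨PreTw.cone E F f hf, R.mc_cone hf hm⟩

/-- The projection of the cone to its first part, as a cocycle. -/
def coneCocycle : Cocycle (R.complex (R.coneOb hf hm)) (R.complex E) 1 :=
  Cocycle.mk (R.cochain (E := R.coneOb hf hm) (R.coneOut₁ hf ≫ R.signEnd E.1) 1) 2 rfl (by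
    have h1 := (R.isHomogeneous_coneOut₁ hf).comp (R.isHomogeneous_signEnd E.1) (add_zero 1)
    have h2 := (R.isHomogeneous_δ E.1).signEnd_comp
    rw [Int.negOnePow_one, Units.neg_smul, one_smul] at h2
    rw [δ_cochain (E := R.coneOb hf hm) h1 (show (1 : ℤ) + 1 = 2 by norm_num),
      Int.negOnePow_even 2 even_two, one_smul]
    have h3 : (R.coneOut₁ hf ≫ R.signEnd E.1) ≫ R.matrix E.1.δ +
        R.matrix (R.coneOb hf hm).1.δ ≫ R.coneOut₁ hf ≫ R.signEnd E.1 = 0 := by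
      rw [Category.assoc, h2, reassoc_of% (R.δ_coneOut₁ hf), Preadditive.comp_neg, neg_add_cancel]
    rw [h3]
    refine Cochain.ext _ _ fun p q h => ?_
    simp [cochain_v])

lemma coneCocycle_coe : (R.coneCocycle hf hm).1 =
    R.cochain (E := R.coneOb hf hm) (R.coneOut₁ hf ≫ R.signEnd E.1) 1 := rfl

lemma cochain_zero (E F : A.twQuiver.Ob) (d : ℤ) :
    R.cochain (0 : R.total E.1 ⟶ R.total F.1) d = 0 := by
  refine Cochain.ext _ _ fun p q h => ?_
  simp [cochain_v]

/-- By `δ_coneOut₂` the differential of the second projection is the first projection followed by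
the sign twist and `f`. The minus sign on the cocycle cancels it. -/
lemma coneLift_condition : δ 0 1 (R.cochain (E := R.coneOb hf hm) (R.coneOut₂ hf) 0) +
    (-R.coneCocycle hf hm).1.comp (Cochain.ofHom (homOf (R.matrix f) hm)) (add_zero 1) = 0 := by
  have h1 := (R.isHomogeneous_coneOut₁ hf).comp (R.isHomogeneous_signEnd E.1) (add_zero 1)
  rw [δ_cochain (E := R.coneOb hf hm) (R.isHomogeneous_coneOut₂ hf) (zero_add 1)]
  change _ + (-R.cochain (E := R.coneOb hf hm) (R.coneOut₁ hf ≫ R.signEnd E.1) 1).comp _ _ = 0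
  rw [Cochain.neg_comp, ofHom_homOf, cochain_comp (E := R.coneOb hf hm) h1, ← cochain_neg,
    ← cochain_add, δ_coneOut₂, Int.negOnePow_one, Units.neg_smul, one_smul, Category.assoc,
    ← R.cochain_zero]
  congr 1
  abel

lemma isClosed_coneIn₂ : R.IsClosed (F := R.coneOb hf hm) (R.coneIn₂ hf) :=
  ⟨R.isHomogeneous_coneIn₂ hf, R.coneIn₂_δ hf⟩

lemma isClosed_coneOut₁ {p : R.total (PreTw.cone E F f hf) ⟶ R.total E.1.shiftOne}
    (hp : p = R.coneOut₁ hf) :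
    R.IsClosed (E := R.coneOb hf hm) (F := R.shiftOne E) p := by
  subst hp
  exact ⟨fun x i h => R.isHomogeneous_coneOut₁ hf x i (by
    have h1 : E.1.shiftOne.shift i = E.1.shift i + 1 := rfl
    change 0 + E.1.shiftOne.shift i - (PreTw.cone E F f hf).shift x ≠ 0 at h
    omega), R.δ_coneOut₁ hf |>.symm⟩

variable [HasBinaryBiproducts C]

/-- The comparison of the complex of a cone with the mapping cone. -/
def coneLift : R.complex (R.coneOb hf hm) ⟶ mappingCone (homOf (R.matrix f) hm) :=
  mappingCone.lift _ (-R.coneCocycle hf hm) (R.cochain (E := R.coneOb hf hm) (R.coneOut₂ hf) 0)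
    (R.coneLift_condition hf hm)

lemma isIso_coneLift : IsIso (R.coneLift hf hm) := by
  have h1 := (R.isHomogeneous_coneOut₁ hf).comp (R.isHomogeneous_signEnd E.1) (add_zero 1)
  have h2 := (R.isHomogeneous_signEnd E.1).comp (R.isHomogeneous_coneIn₁ hf) (zero_add (-1))
  have h3 := R.isHomogeneous_coneOut₂ hf
  have h4 := R.isHomogeneous_coneIn₂ hf
  have hc : (-R.coneCocycle hf hm).1 =
    R.cochain (E := R.coneOb hf hm) (-(R.coneOut₁ hf ≫ R.signEnd E.1)) 1 := (R.cochain_neg _ _).symm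
  refine mappingCone.isIso_lift _ _ _ _
    (R.cochain (F := R.coneOb hf hm) (-(R.signEnd E.1 ≫ R.coneIn₁ hf)) (-1))
    (R.cochain (F := R.coneOb hf hm) (R.coneIn₂ hf) 0) ?_ ?_ ?_ ?_ ?_
  · rw [hc, cochain_comp (E := R.coneOb hf hm) h1.neg, cochain_comp (E := R.coneOb hf hm) h3,
      ← cochain_add, ← cochain_id]
    congr 1
    rw [← R.coneOut_coneIn hf, Preadditive.neg_comp, Preadditive.comp_neg, neg_neg, Category.assoc,
      reassoc_of% (R.signEnd_signEnd E.1)]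
  · rw [hc, cochain_comp (F := R.coneOb hf hm) h2.neg, ← cochain_id]
    congr 1
    rw [Preadditive.neg_comp, Preadditive.comp_neg, neg_neg, Category.assoc,
      reassoc_of% (R.coneIn₁_coneOut₁ hf), signEnd_signEnd]
  · rw [cochain_comp (F := R.coneOb hf hm) h2.neg, Preadditive.neg_comp, Category.assoc,
      coneIn₁_coneOut₂, comp_zero, neg_zero, cochain_zero]
  · rw [hc, cochain_comp (F := R.coneOb hf hm) h4, Preadditive.comp_neg,
      reassoc_of% (R.coneIn₂_coneOut₁ hf), zero_comp, neg_zero, cochain_zero]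
  · rw [cochain_comp (F := R.coneOb hf hm) h4, coneIn₂_coneOut₂, cochain_id]

lemma coneIn₂_coneLift : homOf (F := R.coneOb hf hm) (R.coneIn₂ hf) (R.isClosed_coneIn₂ hf hm) ≫
    R.coneLift hf hm = mappingCone.inr (homOf (R.matrix f) hm) := by
  have h4 := R.isHomogeneous_coneIn₂ hf
  have h5 : (R.cochain (F := R.coneOb hf hm) (R.coneIn₂ hf) 0).comp (-R.coneCocycle hf hm).1
      (zero_add 1) = 0 := by
    change Cochain.comp _ (-R.cochain (E := R.coneOb hf hm) (R.coneOut₁ hf ≫ R.signEnd E.1) 1) _ = 0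
    rw [Cochain.comp_neg, cochain_comp (F := R.coneOb hf hm) h4,
      reassoc_of% (R.coneIn₂_coneOut₁ hf), zero_comp, cochain_zero, neg_zero]
  have h6 : (R.cochain (F := R.coneOb hf hm) (R.coneIn₂ hf) 0).comp
      (R.cochain (E := R.coneOb hf hm) (R.coneOut₂ hf) 0) (add_zero 0) = Cochain.ofHom (𝟙 _) := by
    rw [cochain_comp (F := R.coneOb hf hm) h4, coneIn₂_coneOut₂, cochain_id]
  refine HomologicalComplex.hom_ext _ _ fun p => ?_
  rw [mappingCone.ext_to_iff _ p (p + 1) rfl, HomologicalComplex.comp_f, Category.assoc,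
    Category.assoc, coneLift, mappingCone.lift_f_fst_v, mappingCone.lift_f_snd_v,
    mappingCone.inr_f_fst_v, mappingCone.inr_f_snd_v]
  refine ⟨?_, ?_⟩
  · have h7 := Cochain.congr_v h5 p (p + 1) rfl
    rwa [Cochain.comp_v _ _ _ p p (p + 1) (add_zero p) rfl, Cochain.zero_v] at h7
  · have h7 := Cochain.congr_v h6 p p (add_zero p)
    rwa [Cochain.comp_v _ _ _ p p p (add_zero p) (add_zero p), Cochain.ofHom_v] at h7

/-- The last map of the mapping cone triangle is minus the first projection, and the lift has minus
the cocycle as first component; the two signs cancel. -/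
lemma coneLift_triangle {p : R.total (PreTw.cone E F f hf) ⟶ R.total E.1.shiftOne}
    (hp : p = R.coneOut₁ hf) :
    homOf (E := R.coneOb hf hm) (F := R.shiftOne E) p (R.isClosed_coneOut₁ hf hm hp) ≫
      (R.shiftIso E).hom =
    R.coneLift hf hm ≫ (mappingCone.triangle (homOf (R.matrix f) hm)).mor₃ := by
  have h1 : (mappingCone.triangle (homOf (R.matrix f) hm)).mor₃ =
      (Cocycle.equivHomShift (n := 1)).symm (-mappingCone.fst (homOf (R.matrix f) hm)) := rfl
  rw [h1, shiftIso_hom, ← Cocycle.equivHomShift_symm_precomp]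
  refine Eq.trans ?_ (Cocycle.equivHomShift_symm_precomp _ (R.coneLift hf hm))
  refine congrArg _ (Subtype.ext ?_)
  have h2 : (Cochain.ofHom (R.coneLift hf hm)).comp
      (-mappingCone.fst (homOf (R.matrix f) hm)).1 (zero_add 1) = (R.coneCocycle hf hm).1 := by
    change Cochain.comp _ (-(mappingCone.fst (homOf (R.matrix f) hm)).1) _ = _
    rw [Cochain.comp_neg, coneLift, mappingCone.lift_fst]
    exact neg_neg (R.coneCocycle hf hm).1
  refine Eq.trans ?_ h2.symm
  change (Cochain.ofHom (homOf (E := R.coneOb hf hm) (F := R.shiftOne E) p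
    (R.isClosed_coneOut₁ hf hm hp))).comp
    (R.cochain (E := R.shiftOne E) (R.shiftMap E.1) 1) (zero_add 1) = _
  rw [ofHom_homOf, cochain_comp (E := R.coneOb hf hm) (F := R.shiftOne E)
    (R.isClosed_coneOut₁ hf hm hp).1, coneCocycle_coe]
  subst hp
  rfl

end Cone

/-! ### Exactness -/

open HomotopyCategory

variable (h : A.tw.IsAInf)

/-- The comparison of shifts. -/
def toComplexesShiftIso (E : A.twQuiver.Ob) :
    (R.toComplexes h).obj ⟨R.shiftOne E⟩ ≅ ((R.toComplexes h).obj ⟨E⟩)⟦(1 : ℤ)⟧ :=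
  (quotient C (ComplexShape.up ℤ)).mapIso (R.shiftIso E) ≪≫
    ((quotient C (ComplexShape.up ℤ)).commShiftIso (1 : ℤ)).app (R.complex E)

lemma toComplexesShiftIso_hom (E : A.twQuiver.Ob) : (R.toComplexesShiftIso h E).hom =
    (quotient C (ComplexShape.up ℤ)).map (R.shiftIso E).hom ≫
      ((quotient C (ComplexShape.up ℤ)).commShiftIso (1 : ℤ)).hom.app (R.complex E) := rfl

lemma isExact_toComplexes [HasBinaryBiproducts C] [HasZeroObject C] :
    IsExact h (R.toComplexes h) := by
  refine ⟨fun E => R.mc_shiftOne E, R.toComplexesShiftIso h, fun E F f hf => ?_,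
    fun E F f hf => ?_⟩
  · have hm := (R.mem_cycles_iff h).1 hf
    have hm' : R.IsClosed (E := R.shiftOne E) (F := R.shiftOne F)
      (R.matrix (E := E.1.shiftOne) (F := F.1.shiftOne) f) := hm.shift
    have hf' := (R.mem_cycles_iff h (E := R.shiftOne E) (F := R.shiftOne F)).2 hm'
    refine ⟨hf', ?_⟩
    rw [toComplexes_map_cls]
    have h1 := R.shiftIso_naturality hm hm' (R.comp_shiftMap hm)
    rw [toComplexesShiftIso_hom, toComplexesShiftIso_hom]
    have h2 := ((quotient C (ComplexShape.up ℤ)).commShiftIso (1 : ℤ)).hom.naturality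
      (homOf (R.matrix f) hm)
    have h3 := congrArg (fun g => (quotient C (ComplexShape.up ℤ)).map g ≫
      ((quotient C (ComplexShape.up ℤ)).commShiftIso (1 : ℤ)).hom.app (R.complex F)) h1
    simp only [Functor.map_comp, Category.assoc] at h3
    refine h3.trans ?_
    refine Eq.trans ?_ (Category.assoc _ _ _).symm
    exact congrArg ((quotient C (ComplexShape.up ℤ)).map (R.shiftIso E).hom ≫ ·) h2
  · have hm := (R.mem_cycles_iff h).1 hf
    have hi : R.IsClosed (F := R.coneOb hf.1 hm)
        (R.matrix (coneInr E F f hf.1 (R.mc_cone hf.1 hm))) :=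
      (R.matrix_coneInr hf.1 _).symm ▸ R.isClosed_coneIn₂ hf.1 hm
    have hp := R.isClosed_coneOut₁ hf.1 hm
      (R.matrix_coneFst hf.1 (R.mc_cone hf.1 hm) (R.mc_shiftOne E))
    refine ⟨R.mc_cone hf.1 hm, (R.mem_cycles_iff h (F := R.coneOb hf.1 hm)).2 hi,
      (R.mem_cycles_iff h (E := R.coneOb hf.1 hm) (F := R.shiftOne E)).2 hp, ?_⟩
    let e := @asIso _ _ _ _ (R.coneLift hf.1 hm) (R.isIso_coneLift hf.1 hm)
    refine CategoryTheory.Pretriangulated.isomorphic_distinguished _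
      (mappingCone_triangleh_distinguished (homOf (R.matrix f) hm)) _ ?_
    -- The comparison with the mapping cone triangle is the identity on both ends of `f` and the
    -- lift on the cone.
    refine CategoryTheory.Pretriangulated.Triangle.isoMk _ _ (Iso.refl _) (Iso.refl _)
      ((quotient C (ComplexShape.up ℤ)).mapIso e) ?_ ?_ ?_
    · exact (Category.comp_id _).trans (Category.id_comp _).symm
    · refine Eq.trans ?_ (Category.id_comp _).symm
      refine ((quotient C (ComplexShape.up ℤ)).map_comp _ _).symm.trans ?_
      refine congrArg (quotient C (ComplexShape.up ℤ)).map ?_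
      refine Eq.trans ?_ (R.coneIn₂_coneLift hf.1 hm)
      exact congrArg (· ≫ R.coneLift hf.1 hm) (homOf_congr _ (R.matrix_coneInr hf.1 _))
    · have h1 := R.coneLift_triangle hf.1 hm
        (R.matrix_coneFst hf.1 (R.mc_cone hf.1 hm) (R.mc_shiftOne E))
      have h2 := (((quotient C (ComplexShape.up ℤ)).map_comp _ _).symm.trans
        (congrArg (quotient C (ComplexShape.up ℤ)).map h1)).trans
        ((quotient C (ComplexShape.up ℤ)).map_comp _ _)
      have h3 := congrArg (· ≫
        ((quotient C (ComplexShape.up ℤ)).commShiftIso (1 : ℤ)).hom.app (R.complex E)) h2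
      refine (whisker_eq _ (CategoryTheory.Functor.map_id _ _)).trans
        ((Category.comp_id _).trans ?_)
      exact ((Category.assoc _ _ _).symm.trans h3).trans (Category.assoc _ _ _)

end AInfData.LinearModel

/-! ## Realizing complexes by twisted complexes -/

namespace AInfData.LinearModel

open GradedQuiver Limits CochainComplex.HomComplex

variable {k : Type u} [Field k] {A : AInfData.{u, w₁, w₂} k} {C : Type v}
    [Category.{w} C] [Preadditive C] [Linear k C] (R : A.LinearModel C) [HasFiniteBiproducts C]

include R in
/-- Formal sums with zero differential are twisted complexes. -/
lemma mc_of_δ_eq_zero {E : A.PreTw} (h : E.δ = 0) : E.MC :=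
  (R.mc_iff_matrix E).2 (by rw [h, map_zero, zero_comp])

/-- A complex whose terms are the parts of a twisted complex `E` comes from a twisted complex,
if the summands of `E` are ordered by degree. -/
lemma exists_complex_iso (E : A.PreTw) (hE : E.δ = 0)
    (hlt : ∀ i j, E.shift j + 1 = E.shift i → i < j) (L : CochainComplex C ℤ)
    (e : ∀ n, R.part E n ≅ L.X n) : ∃ E' : A.twQuiver.Ob, Nonempty (R.complex E' ≅ L) := by
  let E₀ : A.twQuiver.Ob := ⟨E, R.mc_of_δ_eq_zero hE⟩
  -- The differential of `L`, transported to the parts, is a cochain of degree `1` for the zero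
  -- differential. Its matrix becomes the new `δ`.
  let z : Cochain (R.complex E₀) (R.complex E₀) 1 :=
    Cochain.mk fun p q _ => (e p).hom ≫ L.d p q ≫ (e q).inv
  have hz : ∀ p q h, z.v p q h = (e p).hom ≫ L.d p q ≫ (e q).inv := fun p q h => rfl
  obtain ⟨m, hm, hmz⟩ := cochain_surjective z
  have hmm : m ≫ m = 0 := by
    refine cochain_injective (E := E₀) (F := E₀) (d := 2) (hm.comp hm (by norm_num))
      (fun i j _ => by simp) ?_
    rw [← cochain_comp hm m (show (1 : ℤ) + 1 = 2 by norm_num), hmz, cochain_zero]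
    refine Cochain.ext _ _ fun p q hpq => ?_
    rw [Cochain.comp_v _ _ _ p (p + 1) q rfl (by omega), hz, hz, Cochain.zero_v]
    simp
  let E₁ : A.PreTw :=
    { E with
      δ := R.matrix.symm m
      δ_mem := fun i j => R.mem_gr_of_ne_zero fun h => R.map.map_eq_zero_iff.1 (by
        rw [← R.ι_matrix_π (E := E) (F := E), LinearEquiv.apply_symm_apply]
        exact hm i j (by change 1 + E.shift j - E.shift i ≠ 0; omega))
      -- A nonzero entry of degree `1` lowers the shift by one, so `hlt` makes it strictly
      -- increasing for the order of the summands.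
      δ_strict := fun i j h => R.map.map_eq_zero_iff.1 (by
        rw [← R.ι_matrix_π (E := E) (F := E), LinearEquiv.apply_symm_apply]
        refine hm i j ?_
        have := mt (hlt i j) h
        change 1 + E.shift j - E.shift i ≠ 0
        omega) }
  have hδ : R.matrix (E := E₁) (F := E₁) E₁.δ = m := R.matrix.apply_symm_apply m
  have hMC : E₁.MC := (R.mc_iff_matrix E₁).2 (by
    rw [hδ]
    exact hmm)
  refine ⟨⟨E₁, hMC⟩, ⟨HomologicalComplex.Hom.isoOfComponents e fun p q hpq => ?_⟩⟩
  have h1 : (R.complex ⟨E₁, hMC⟩).d p q = (e p).hom ≫ L.d p q ≫ (e q).inv := by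
    rw [← hz p q hpq, ← hmz]
    exact congrArg (fun m => R.incl E p ≫ m ≫ R.proj E q) hδ
  rw [h1]
  simp

/-- A bounded complex whose terms are sums of objects of the category comes from a
twisted complex. -/
lemma exists_complex_iso_of_bounded (L : CochainComplex C ℤ) (a b : ℤ)
    (hL : ∀ n, n < a ∨ b < n → IsZero (L.X n)) (I : ℤ → Type) [∀ n, Fintype (I n)]
    (γ : ∀ n, I n → A.Ob) (e : ∀ n, (⨁ fun i => R.obj (γ n i)) ≅ L.X n) :
    ∃ E : A.twQuiver.Ob, Nonempty (R.complex E ≅ L) := by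
  classical
  -- Any order within one degree will do. In the lexicographic sum the degrees decide first, and the
  -- differential raises the degree.
  let _ : ∀ n, LinearOrder (I n) := fun n => linearOrderOfSTO WellOrderingRel
  let _ : Fintype (Σₗ n : Set.Icc a b, I n) := inferInstanceAs (Fintype (Σ n : Set.Icc a b, I n))
  let E : A.PreTw :=
    { ι := Σₗ n : Set.Icc a b, I n
      ob := fun x => γ x.1 x.2
      shift := fun x => -x.1
      δ := 0
      δ_mem := fun _ _ => zero_mem _
      δ_strict := fun _ _ _ => rfl }
  refine R.exists_complex_iso E rfl (fun x y h => ?_) L fun n => ?_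
  · refine Sigma.Lex.lt_def.2 (Or.inl ?_)
    change -(y.1 : ℤ) + 1 = -(x.1 : ℤ) at h
    rw [← Subtype.coe_lt_coe]
    omega
  · by_cases hn : n ∈ Set.Icc a b
    · let f : I n ≃ {x : E.ι // E.shift x = -n} := Equiv.ofBijective
        (fun i => ⟨(⟨⟨n, hn⟩, i⟩ : Σ n : Set.Icc a b, I n), rfl⟩) (by
          constructor
          · intro i j hij
            exact sigma_mk_injective (i := (⟨n, hn⟩ : Set.Icc a b)) (congrArg Subtype.val hij)
          · rintro ⟨⟨⟨n', hn'⟩, i⟩, hi⟩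
            obtain rfl : n' = n := neg_injective hi
            exact ⟨i, rfl⟩)
      exact (biproduct.whiskerEquiv (f := fun i => R.obj (γ n i))
        (g := fun x : {x : E.ι // E.shift x = -n} => R.obj (E.ob x.1)) f
        fun i => Iso.refl _).symm ≪≫ e n
    · have h1 : IsEmpty {x : E.ι // E.shift x = -n} :=
        ⟨fun x => hn (neg_injective x.2 ▸ x.1.1.2)⟩
      have h2 : IsZero (R.part E n) :=
        (IsZero.iff_id_eq_zero _).2 (biproduct.hom_ext _ _ fun i => h1.elim i)
      refine h2.iso (hL n ?_)
      by_contra hn'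
      exact hn ⟨by omega, by omega⟩

end AInfData.LinearModel

/-! ## Perfect complexes -/

namespace RibbonGraph.ModifiedBGA

variable {k : Type u} [Field k] {Γ : RibbonGraph.{v}} {m : Γ.V → ℕ+}

/-- Finitely generated projective modules are direct sums of modules `P_γ`. -/
lemma exists_linearEquiv_pi (Q : ModuleCat.{w} (Γ.BGA k m)ᵐᵒᵖ)
    [Module.Finite (Γ.BGA k m)ᵐᵒᵖ Q] [Module.Projective (Γ.BGA k m)ᵐᵒᵖ Q] :
    ∃ (I : Type) (_ : Fintype I) (γ : I → Γ.Edge),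
      Nonempty (Q ≃ₗ[(Γ.BGA k m)ᵐᵒᵖ] ∀ i, P (Γ := Γ) k m 0 (γ i)) := by
  -- The decomposition is found by induction on the dimension over `k`, so the scalars have to be
  -- restricted first.
  let _ : Module k Q := Module.compHom Q (algebraMap k (Γ.BGA k m)ᵐᵒᵖ)
  have : IsScalarTower k (Γ.BGA k m)ᵐᵒᵖ Q := IsScalarTower.of_algebraMap_smul fun _ _ => rfl
  have : Module.Finite k (Γ.BGA k m)ᵐᵒᵖ :=
    Module.Finite.equiv (MulOpposite.opLinearEquiv k (M := Γ.BGA k m))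
  have : Module.Finite k Q := Module.Finite.trans (Γ.BGA k m)ᵐᵒᵖ Q
  exact exists_equiv_pi _ Q le_rfl

end RibbonGraph.ModifiedBGA

lemma Module.Projective.pi_of_finite {R : Type u} [Ring R] {I : Type w} [Finite I]
    (N : I → Type v) [∀ i, AddCommGroup (N i)] [∀ i, Module R (N i)]
    [∀ i, Module.Projective R (N i)] : Module.Projective R (∀ i, N i) := by
  classical
  have := Fintype.ofFinite I
  exact Module.Projective.of_equiv (DFinsupp.linearEquivFunOnFintype (R := R) (M := N))

/-! ### The equivalence with perfect complexes -/

namespace RibbonGraph.BrauerGraphCategory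

open AInfData AInfData.LinearModel Limits

variable {k : Type u} [Field k] {Γ : RibbonGraph.{v}} {m : Γ.V → ℕ+}
  {A : AInfData.{u, w₁, w₂} k}
  (R : A.LinearModel (ModuleCat.{max u v} (Γ.BGA k m)ᵐᵒᵖ)) (h : A.tw.IsAInf)

lemma isPerfectComplex_toComplexes
    (hR : ∀ X, Module.Finite (Γ.BGA k m)ᵐᵒᵖ (R.obj X) ∧ Module.Projective (Γ.BGA k m)ᵐᵒᵖ (R.obj X))
    (X : H0 A.tw h) : IsPerfectComplex (Γ.BGA k m) ((R.toComplexes h).obj X) := by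
  let E : A.twQuiver.Ob := X.of
  have h1 := fun X => (hR X).1
  have h2 := fun X => (hR X).2
  refine ⟨fun n => ?_, ?_⟩
  · let e := (ModuleCat.biproductIsoPi
      fun i : {i // E.1.shift i = -n} => R.obj (E.1.ob i.1)).symm.toLinearEquiv
    have := Module.Projective.pi_of_finite (R := (Γ.BGA k m)ᵐᵒᵖ)
      fun i : {i // E.1.shift i = -n} => R.obj (E.1.ob i.1)
    exact ⟨Module.Finite.equiv e, Module.Projective.of_equiv e⟩
  · obtain ⟨a, ha⟩ := (Set.finite_range E.1.shift).bddBelow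
    obtain ⟨b, hb⟩ := (Set.finite_range E.1.shift).bddAbove
    refine ⟨-b, -a, fun n hn => ?_⟩
    have h3 : IsEmpty {i // E.1.shift i = -n} := by
      refine ⟨fun i => ?_⟩
      have h4 := ha ⟨i.1, rfl⟩
      have h5 := hb ⟨i.1, rfl⟩
      rw [i.2] at h4 h5
      omega
    let e := (ModuleCat.biproductIsoPi
      fun i : {i // E.1.shift i = -n} => R.obj (E.1.ob i.1)).toLinearEquiv
    exact e.toEquiv.subsingleton

lemma exists_complex_iso (o : Γ.Edge → A.Ob) (ho : ∀ γ, R.obj (o γ) = ModifiedBGA.modP k m γ)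
    (L : CochainComplex (ModuleCat.{max u v} (Γ.BGA k m)ᵐᵒᵖ) ℤ)
    (hL : ∀ n, Module.Finite (Γ.BGA k m)ᵐᵒᵖ (L.X n) ∧ Module.Projective (Γ.BGA k m)ᵐᵒᵖ (L.X n))
    (a b : ℤ) (hab : ∀ n, n < a ∨ b < n → Subsingleton (L.X n)) :
    ∃ E : A.twQuiver.Ob, Nonempty (R.complex E ≅ L) := by
  have h1 := fun n => (hL n).1
  have h2 := fun n => (hL n).2
  choose I hI γ e using fun n => ModifiedBGA.exists_linearEquiv_pi (L.X n)
  refine R.exists_complex_iso_of_bounded L a b (fun n hn => ?_) I (fun n i => o (γ n i))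
    fun n => ?_
  · have := hab n hn
    exact ModuleCat.isZero_of_subsingleton _
  · exact biproduct.mapIso (fun i => eqToIso (ho (γ n i))) ≪≫
      ModuleCat.biproductIsoPi (fun i => ModifiedBGA.modP k m (γ n i)) ≪≫
      (e n).some.symm.toModuleIso

/-- The equivalence of the homotopy category of twisted complexes with the
category of perfect complexes. -/
lemma exists_equivalence (o : Γ.Edge → A.Ob) (ho : ∀ γ, R.obj (o γ) = ModifiedBGA.modP k m γ)
    (hR : ∀ X, ∃ γ, X = o γ) :
    ∃ F : H0 A.tw h ≌ PerfectComplexes (Γ.BGA k m),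
      F.functor.Additive ∧ F.functor.Linear k ∧
        IsExact h (F.functor ⋙ (IsPerfectComplex (Γ.BGA k m)).ι) := by
  have hP (X : A.Ob) : Module.Finite (Γ.BGA k m)ᵐᵒᵖ (R.obj X) ∧
      Module.Projective (Γ.BGA k m)ᵐᵒᵖ (R.obj X) := by
    obtain ⟨γ, rfl⟩ := hR X
    rw [ho]
    exact ⟨inferInstanceAs (Module.Finite _ (ModifiedBGA.P k m 0 γ)),
      inferInstanceAs (Module.Projective _ (ModifiedBGA.P k m 0 γ))⟩
  let G : H0 A.tw h ⥤ PerfectComplexes (Γ.BGA k m) :=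
    (IsPerfectComplex (Γ.BGA k m)).lift (R.toComplexes h) (isPerfectComplex_toComplexes R h hP)
  have hG : G.EssSurj := by
    refine ⟨fun K => ?_⟩
    obtain ⟨hK, a, b, hab⟩ := K.property
    obtain ⟨E, ⟨e⟩⟩ := exists_complex_iso R o ho K.obj.as hK a b hab
    exact ⟨⟨E⟩, ⟨(IsPerfectComplex (Γ.BGA k m)).isoMk
      ((HomotopyCategory.quotient _ (ComplexShape.up ℤ)).mapIso e)⟩⟩
  -- Full and faithful are inherited from the functor to all complexes, as the target is a full
  -- subcategory.
  have hG' : G.IsEquivalence := { }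
  refine ⟨G.asEquivalence, ⟨?_⟩, ⟨?_⟩, R.isExact_toComplexes h⟩
  · intro X Y f g
    exact (IsPerfectComplex (Γ.BGA k m)).ι.map_injective ((R.toComplexes h).map_add)
  · intro X Y f c
    exact (IsPerfectComplex (Γ.BGA k m)).ι.map_injective ((R.toComplexes h).map_smul c f)

end RibbonGraph.BrauerGraphCategory

end

theorem proposition4p2
    (k : Type u) [Field k] (Γ : RibbonGraph.{v}) (m : Γ.V → ℕ+)
    (M : Type w) [TopologicalSpace M] [T2Space M] [CompactSpace M]
    [ChartedSpace (EuclideanHalfSpace 2) M] [IsManifold (𝓡∂ 2) ∞ M]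
    (J : QuarterTurn M) (κ : ArcSystem J Γ) (hκ : κ.IsFilling)
    (η : LineField κ.punctures) (hη : κ.IsRibbonLineField η)
    (𝔤 : κ.Grading η) (h𝔤 : 𝔤.IsShortestClockwise) :
    -- `B` is a basic finite-dimensional algebra, the sum of the indecomposable projectives `P γ`
    (Module.Finite k (Γ.BGA k m) ∧
      iSupIndep (RibbonGraph.ModifiedBGA.P (Γ := Γ) k m 0) ∧
      ⨆ γ, RibbonGraph.ModifiedBGA.P (Γ := Γ) k m 0 γ = ⊤ ∧
      (∀ γ, Module.Projective (Γ.BGA k m)ᵐᵒᵖ (RibbonGraph.ModifiedBGA.P (Γ := Γ) k m 0 γ) ∧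
        IsIndecomposableModule (Γ.BGA k m)ᵐᵒᵖ (RibbonGraph.ModifiedBGA.P (Γ := Γ) k m 0 γ)) ∧
      ∀ γ δ, γ ≠ δ → IsEmpty (RibbonGraph.ModifiedBGA.P (Γ := Γ) k m 0 γ ≃ₗ[(Γ.BGA k m)ᵐᵒᵖ]
        RibbonGraph.ModifiedBGA.P (Γ := Γ) k m 0 δ)) ∧
    -- the Brauer graph category is well-defined
    Nonempty (Unique (RibbonGraph.BrauerGraphCategory k m 𝔤)) ∧
    ∀ 𝔹 : RibbonGraph.BrauerGraphCategory k m 𝔤,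
      -- it is isomorphic to the category of the modules `P γ`
      𝔹.data.IsAInf ∧
      Nonempty (AInfIso 𝔹.data
        (projAInf k (Γ.BGA k m) (RibbonGraph.ModifiedBGA.P (Γ := Γ) k m 0))) ∧
      -- `H⁰(Tw 𝔹)` and `K^b(proj B)` are equivalent
      ∃ (h : 𝔹.data.tw.IsAInf)
        (F : AInfData.H0 𝔹.data.tw h ≌ PerfectComplexes (Γ.BGA k m)),
        F.functor.Additive ∧ F.functor.Linear k ∧
          AInfData.IsExact h (F.functor ⋙ (IsPerfectComplex (Γ.BGA k m)).ι) := by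
  refine ⟨⟨inferInstance, RibbonGraph.ModifiedBGA.iSupIndep_P, RibbonGraph.ModifiedBGA.iSup_P,
    fun γ => ⟨inferInstance, RibbonGraph.ModifiedBGA.isIndecomposableModule_P γ⟩,
    fun γ δ h => RibbonGraph.ModifiedBGA.isEmpty_P_equiv h⟩, ?_, fun 𝔹 => ?_⟩
  · exact ⟨⟨⟨RibbonGraph.BrauerGraphCategory.ofFilling k m hκ hη h𝔤⟩,
      fun 𝔹 => RibbonGraph.BrauerGraphCategory.eq hκ h𝔤 𝔹 _⟩⟩
  · obtain ⟨R, hR⟩ := RibbonGraph.BrauerGraphCategory.exists_linearModel hκ h𝔤 𝔹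
    refine ⟨R.toDGModel.isAInf, RibbonGraph.BrauerGraphCategory.nonempty_projIso hκ h𝔤 𝔹,
      R.twDGModel.isAInf, ?_⟩
    -- The objects of the Brauer graph category are the edges themselves, so the map from edges to
    -- objects is the identity.
    exact RibbonGraph.BrauerGraphCategory.exists_equivalence R _ _ hR fun X => ⟨X, rfl⟩
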